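/- Let $k$ be an uncountable field and let $A=\bigoplus_{n\in\mathbb{Z}}A_n$ be a (left and right) noetherian, countably generated $\mathbb{Z}$-graded $k$-algebra. Prime ideals are understood to be two-sided and proper, with $IJ\subseteq P$ implying $I\subseteq P$ or $J\subseteq P$ for all two-sided ideals $I,J$. Definitions. (i) $\operatorname{Spec}A$ is the set of prime ideals of $A$ with the Zariski topology, whose closed sets are the sets $V(I)=\{P : P\supseteq I\}$ for ideals $I$; $\operatorname{hSpec}A$ is the set of homogeneous prime ideals of $A$. (ii) A nonzero prime $P$ of a prime ring has height one if there is no prime $Q$ with $0\subsetneq Q\subsetneq P$; a nonzero homogeneous prime $P$ of a graded prime ring has h-height one if there is no homogeneous prime $Q$ with $0\subsetneq Q\subsetneq P$. $\operatorname{Spec}A$ (respectively $\operatorname{hSpec}A$) is countable-avoiding if for every prime (respectively homogeneous prime) $P$ of $A$ the factor ring $A/P$ has either finitely many or uncountably many height one (respectively h-height one) primes. (iii) Let $B$ be a noetherian $\mathbb{Z}$-graded $k$-algebra which is a prime ring. Its graded quotient ring $Q_{\rm gr}(B)$, the localization of $B$ at its homogeneous regular elements, is isomorphic as a graded algebra to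 a matrix ring $M_n(S)$ over a graded division ring $S$, with a grading of the form $M_n(S)_m=\{M : M_{ij}\in S_{m+d_i-d_j}\}$ for some $d_1,\dots,d_n\in\mathbb{Z}$. $B$ is birationally PI if the division ring $D=S_0$ is a PI algebra, that is, satisfies a nonzero noncommutative polynomial over $k$. (iv) A prime $P$ of $A$ is locally closed if $\{P\}$ is open in its closure in $\operatorname{Spec}A$; rational if the center of the Goldie quotient ring $Q(A/P)$ is algebraic over $k$; left (right) primitive if it is the annihilator of a simple left (right) $A$-module. $A$ satisfies the Dixmier–Moeglin equivalence if for every prime $P$ of $A$ the conditions locally closed, rational, left primitive and right primitive are equivalent. Proposition. Suppose that $A/P$ is birationally PI for every homogeneous prime $P$ of $A$, that $A$ satisfies the descending chain condition on homogeneous primes, and that $\operatorname{hSpec}A$ is countable-avoiding. Then $A$ satisfies the descending chain condition on prime ideals, $\operatorname{Spec}A$ is countable-avoiding, and $A$ satisfies the Dixmier–Moeglin equivalence. -/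

import Mathlib

universe u v

namespace DixmierMoeglin

/-! ### Two-sided prime ideals, the prime spectrum and its Zariski topology -/

/-- Prime ideals of a (not necessarily commutative) ring: proper two-sided ideals `P` such that
`I * J ≤ P` implies `I ≤ P` or `J ≤ P` for all two-sided ideals `I`, `J`. (Mathlib's
`Ideal.IsPrime` is the elementwise notion, which is too strong for noncommutative rings.) -/
structure IsPrimeIdeal {A : Type u} [Ring A] (P : Ideal A) : Prop where
  isTwoSided : P.IsTwoSided
  ne_top : P ≠ ⊤
  le_or_le : ∀ I J : Ideal A, I.IsTwoSided → J.IsTwoSided → I * J ≤ P → I ≤ P ∨ J ≤ P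

/-- `Spec A`, the set of all prime ideals of `A`. -/
@[ext] structure PrimeSpec (A : Type u) [Ring A] where
  ideal : Ideal A
  isPrime : IsPrimeIdeal ideal

instance {A : Type u} [Ring A] (P : PrimeSpec A) : P.ideal.IsTwoSided := P.isPrime.isTwoSided

instance {A : Type u} [Ring A] : PartialOrder (PrimeSpec A) :=
  PartialOrder.lift PrimeSpec.ideal fun _ _ h => PrimeSpec.ext h

/-- `V(I) = {P ∈ Spec A | P ⊇ I}`. -/
def zeroLocus {A : Type u} [Ring A] (I : Ideal A) : Set (PrimeSpec A) := {P | I ≤ P.ideal}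

/-- The Zariski topology: the closed sets are the `V(I)` for `I` a two-sided ideal. -/
instance {A : Type u} [Ring A] : TopologicalSpace (PrimeSpec A) :=
  TopologicalSpace.ofClosed {Z | ∃ I : Ideal A, I.IsTwoSided ∧ Z = zeroLocus I}
    ⟨⊤, inferInstance, by
      ext P
      simpa [zeroLocus] using P.isPrime.ne_top⟩
    (by
      intro T hT
      refine ⟨sSup {I | I.IsTwoSided ∧ zeroLocus I ∈ T}, ⟨fun {a} b ha => ?_⟩, ?_⟩
      · rw [sSup_eq_iSup'] at ha ⊢
        refine Submodule.iSup_induction _ (motive := fun x => x * b ∈ _) ha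
          (fun I x hx => ?_) (by simp) (fun x y hx hy => ?_)
        · have := I.2.1
          exact Submodule.mem_iSup_of_mem I (I.1.mul_mem_right b hx)
        · rw [add_mul]
          exact add_mem hx hy
      · ext P
        simp only [Set.mem_sInter, zeroLocus, Set.mem_ofPred_eq, sSup_le_iff]
        constructor
        · rintro h I ⟨_, hI⟩
          exact h _ hI
        · intro h Z hZ
          obtain ⟨I, hI, rfl⟩ := hT hZ
          exact h I ⟨hI, hZ⟩)
    (by
      rintro _ ⟨I, hI, rfl⟩ _ ⟨J, hJ, rfl⟩
      refine ⟨I * J, inferInstance, ?_⟩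
      ext P
      simp only [Set.mem_union, zeroLocus, Set.mem_ofPred_eq]
      constructor
      · rintro (h | h)
        · exact Ideal.mul_le_left.trans h
        · exact Ideal.mul_le_right.trans h
      · exact P.isPrime.le_or_le I J hI hJ)

/-- The height one primes of a prime ring `B`: the nonzero primes `P` such that there is no prime
`Q` with `0 ⊊ Q ⊊ P`. -/
def heightOnePrimes (B : Type u) [Ring B] : Set (PrimeSpec B) :=
  {P | P.ideal ≠ ⊥ ∧ ¬ ∃ Q : PrimeSpec B, ⊥ < Q.ideal ∧ Q < P}

/-- `Spec A` is countable-avoiding: every prime factor ring of `A` has either finitely many or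
uncountably many height one primes. -/
def SpecCountableAvoiding (A : Type u) [Ring A] : Prop :=
  ∀ P : PrimeSpec A,
    (heightOnePrimes (A ⧸ P.ideal)).Finite ∨ ¬ (heightOnePrimes (A ⧸ P.ideal)).Countable

/-! ### The Dixmier–Moeglin equivalence -/

/-- `P` is left primitive: the annihilator of a simple left module. -/
def IsLeftPrimitive {A : Type u} [Ring A] (P : Ideal A) : Prop :=
  ∃ (M : Type u) (_ : AddCommGroup M) (_ : Module A M),
    IsSimpleModule A M ∧ ∀ a : A, a ∈ P ↔ ∀ m : M, a • m = 0

/-- `P` is right primitive: the annihilator of a simple right module. -/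
def IsRightPrimitive {A : Type u} [Ring A] (P : Ideal A) : Prop :=
  ∃ (M : Type u) (_ : AddCommGroup M) (_ : Module Aᵐᵒᵖ M),
    IsSimpleModule Aᵐᵒᵖ M ∧ ∀ a : A, a ∈ P ↔ ∀ m : M, MulOpposite.op a • m = 0

/-- `i : B → Q` exhibits `Q` as the (two-sided) classical quotient ring of `B`: the regular
elements of `B` become units, and every element of `Q` is both a right and a left fraction. -/
structure IsClassicalQuotientRing {k : Type v} [Field k] {B Q : Type u} [Ring B] [Algebra k B]
    [Ring Q] [Algebra k Q] (i : B →ₐ[k] Q) : Prop where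
  injective : Function.Injective i
  isUnit : ∀ s : B, IsRegular s → IsUnit (i s)
  right_fraction : ∀ q : Q, ∃ b s : B, IsRegular s ∧ q * i s = i b
  left_fraction : ∀ q : Q, ∃ b s : B, IsRegular s ∧ i s * q = i b

/-- The prime `P` is rational: the center of the Goldie quotient ring of `A ⧸ P` is an algebraic
extension of `k`. -/
def IsRational (k : Type v) [Field k] {A : Type u} [Ring A] [Algebra k A]
    (P : PrimeSpec A) : Prop :=
  ∃ (Q : Type u) (_ : Ring Q) (_ : Algebra k Q) (i : (A ⧸ P.ideal) →ₐ[k] Q),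
    IsClassicalQuotientRing i ∧ Algebra.IsAlgebraic k (Subalgebra.center k Q)

/-- The Dixmier–Moeglin equivalence: for every prime ideal `P`, the conditions locally closed
(in the Zariski topology), primitive (on either side) and rational are equivalent. -/
def DixmierMoeglinEquivalence (k : Type v) [Field k] (A : Type u) [Ring A] [Algebra k A] : Prop :=
  ∀ P : PrimeSpec A,
    (IsLocallyClosed ({P} : Set (PrimeSpec A)) ↔ IsRational k P) ∧
    (IsLeftPrimitive P.ideal ↔ IsRational k P) ∧
    (IsRightPrimitive P.ideal ↔ IsRational k P)

/-! ### Polynomial identities and countable generation -/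

/-- The `k`-algebra `R` is PI: it satisfies a nonzero noncommutative polynomial. -/
def IsPI (k : Type v) [Field k] (R : Type u) [Ring R] [Algebra k R] : Prop :=
  ∃ f : FreeAlgebra k ℕ, f ≠ 0 ∧ ∀ x : ℕ → R, FreeAlgebra.lift k x f = 0

/-- `A` is generated as a `k`-algebra by a countable set. -/
def IsCountablyGenerated (k : Type v) [Field k] (A : Type u) [Ring A] [Algebra k A] : Prop :=
  ∃ s : Set A, s.Countable ∧ Algebra.adjoin k s = ⊤

/-! ### Homogeneous primes of a `ℤ`-graded algebra -/

section Graded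

variable {k : Type v} [Field k] {A : Type u} [Ring A] [Algebra k A]

/-- `hSpec A`, the set of homogeneous prime ideals. -/
@[ext] structure HSpec (𝒜 : ℤ → Submodule k A) [GradedAlgebra 𝒜] extends PrimeSpec A where
  isHomogeneous : ideal.IsHomogeneous 𝒜

instance (𝒜 : ℤ → Submodule k A) [GradedAlgebra 𝒜] : PartialOrder (HSpec 𝒜) :=
  PartialOrder.lift HSpec.toPrimeSpec fun _ _ h => HSpec.ext (congrArg PrimeSpec.ideal h)

/-- The grading on `A ⧸ I` induced by the grading `𝒜` of `A`. -/
def quotientGrading (𝒜 : ℤ → Submodule k A) (I : Ideal A) [I.IsTwoSided] (n : ℤ) :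
    Submodule k (A ⧸ I) :=
  (𝒜 n).map (Ideal.Quotient.mkₐ k I).toLinearMap

instance (𝒜 : ℤ → Submodule k A) [GradedAlgebra 𝒜] (I : Ideal A) [I.IsTwoSided] :
    SetLike.GradedMonoid (quotientGrading 𝒜 I) where
  one_mem := ⟨1, SetLike.GradedOne.one_mem, (Ideal.Quotient.mkₐ k I).map_one⟩
  mul_mem := by
    rintro m n _ _ ⟨a, ha, rfl⟩ ⟨b, hb, rfl⟩
    exact ⟨a * b, SetLike.GradedMul.mul_mem ha hb, (Ideal.Quotient.mkₐ k I).map_mul a b⟩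

theorem quotientGrading_isInternal (𝒜 : ℤ → Submodule k A) [GradedAlgebra 𝒜] (I : Ideal A)
    [I.IsTwoSided] (hI : I.IsHomogeneous 𝒜) :
    DirectSum.IsInternal (quotientGrading 𝒜 I) := by
  classical
  have key : ∀ x : DirectSum ℤ fun n => quotientGrading 𝒜 I n,
      ∃ y : DirectSum ℤ fun n => 𝒜 n,
        ∀ n, ((x n : A ⧸ I)) = Ideal.Quotient.mk I (y n : A) := by
    intro x
    induction x using DirectSum.induction_on with
    | zero => exact ⟨0, fun n => by simp⟩
    | of n x =>
      obtain ⟨_, a, ha, rfl⟩ := x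
      refine ⟨DirectSum.of (fun n => 𝒜 n) n ⟨a, ha⟩, fun m => ?_⟩
      by_cases h : n = m
      · subst h
        simp
      · rw [DirectSum.of_eq_of_ne _ _ _ (Ne.symm h), DirectSum.of_eq_of_ne _ _ _ (Ne.symm h)]
        simp
    | add x y hx hy =>
      obtain ⟨a, ha⟩ := hx
      obtain ⟨b, hb⟩ := hy
      exact ⟨a + b, fun n => by simp [ha, hb]⟩
  have hcoe : ∀ (x : DirectSum ℤ fun n => quotientGrading 𝒜 I n)
      (y : DirectSum ℤ fun n => 𝒜 n),
      (∀ n, ((x n : A ⧸ I)) = Ideal.Quotient.mk I (y n : A)) →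
      DirectSum.coeAddMonoidHom (quotientGrading 𝒜 I) x
        = Ideal.Quotient.mk I (DirectSum.coeAddMonoidHom 𝒜 y) := by
    intro x y h
    rw [DirectSum.coeAddMonoidHom_eq_dfinsuppSum, DirectSum.coeAddMonoidHom_eq_dfinsuppSum,
      DFinsupp.sum, DFinsupp.sum, map_sum]
    trans ∑ n ∈ DFinsupp.support x ∪ DFinsupp.support y, ((x n : A ⧸ I))
    · refine Finset.sum_subset Finset.subset_union_left fun n _ hn => ?_
      rw [DFinsupp.notMem_support_iff] at hn
      simp [hn]
    · rw [Finset.sum_congr rfl fun n _ => h n]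
      refine (Finset.sum_subset Finset.subset_union_right fun n _ hn => ?_).symm
      rw [DFinsupp.notMem_support_iff] at hn
      simp [hn]
  constructor
  · rw [injective_iff_map_eq_zero]
    intro x hx
    obtain ⟨y, hy⟩ := key x
    rw [hcoe x y hy, Ideal.Quotient.eq_zero_iff_mem] at hx
    have hdec : DirectSum.decompose 𝒜 (DirectSum.coeAddMonoidHom 𝒜 y) = y :=
      DirectSum.Decomposition.right_inv y
    ext n
    have := hI n hx
    rw [hdec] at this
    rw [hy n, Ideal.Quotient.eq_zero_iff_mem.2 this]
    simp
  · intro q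
    obtain ⟨a, rfl⟩ := Ideal.Quotient.mk_surjective q
    refine DirectSum.Decomposition.inductionOn 𝒜
      (motive := fun a => ∃ x, DirectSum.coeAddMonoidHom (quotientGrading 𝒜 I) x
        = Ideal.Quotient.mk I a) ⟨0, by simp⟩ (fun {n} m => ?_) (fun a b ha hb => ?_) a
    · exact ⟨DirectSum.of (fun n => quotientGrading 𝒜 I n) n
        ⟨Ideal.Quotient.mk I m, m, m.2, rfl⟩, by simp⟩
    · obtain ⟨x, hx⟩ := ha
      obtain ⟨y, hy⟩ := hb
      exact ⟨x + y, by rw [map_add, map_add, hx, hy]⟩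

/-- The factor ring of `A` by a homogeneous prime is a graded algebra. -/
noncomputable instance (𝒜 : ℤ → Submodule k A) [GradedAlgebra 𝒜] (P : HSpec 𝒜) :
    GradedAlgebra (quotientGrading 𝒜 P.ideal) where
  toDecomposition := (quotientGrading_isInternal 𝒜 P.ideal P.isHomogeneous).chooseDecomposition

/-- The h-height one primes of a graded prime ring: the nonzero homogeneous primes `P` such that
there is no homogeneous prime `Q` with `0 ⊊ Q ⊊ P`. -/
def hHeightOnePrimes (𝒜 : ℤ → Submodule k A) [GradedAlgebra 𝒜] : Set (HSpec 𝒜) :=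
  {P | P.ideal ≠ ⊥ ∧ ¬ ∃ Q : HSpec 𝒜, ⊥ < Q.ideal ∧ Q < P}

/-- `hSpec A` is countable-avoiding: every factor ring of `A` by a homogeneous prime has either
finitely many or uncountably many h-height one primes. -/
def HSpecCountableAvoiding (𝒜 : ℤ → Submodule k A) [GradedAlgebra 𝒜] : Prop :=
  ∀ P : HSpec 𝒜,
    (hHeightOnePrimes (quotientGrading 𝒜 P.ideal)).Finite ∨
      ¬ (hHeightOnePrimes (quotientGrading 𝒜 P.ideal)).Countable

/-! ### Graded quotient rings and birationally PI algebras -/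

/-- `i : B → Q` exhibits the graded algebra `(Q, 𝒬)` as the graded quotient ring of `(B, ℬ)`, the
localization of `B` at its homogeneous regular elements. -/
structure IsGradedQuotientRing {B Q : Type u} [Ring B] [Algebra k B] [Ring Q] [Algebra k Q]
    (ℬ : ℤ → Submodule k B) (𝒬 : ℤ → Submodule k Q) (i : B →ₐ[k] Q) : Prop where
  injective : Function.Injective i
  map_mem : ∀ n : ℤ, ∀ b ∈ ℬ n, i b ∈ 𝒬 n
  isUnit : ∀ s : B, SetLike.IsHomogeneousElem ℬ s → IsRegular s → IsUnit (i s)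
  right_fraction : ∀ q : Q, ∃ b s : B,
    SetLike.IsHomogeneousElem ℬ s ∧ IsRegular s ∧ q * i s = i b
  left_fraction : ∀ q : Q, ∃ b s : B,
    SetLike.IsHomogeneousElem ℬ s ∧ IsRegular s ∧ i s * q = i b

/-- A graded division ring: a nonzero graded ring in which every nonzero homogeneous element is
invertible. -/
structure IsGradedDivisionRing {S : Type u} [Ring S] [Algebra k S] (𝒮 : ℤ → Submodule k S) :
    Prop where
  nontrivial : Nontrivial S
  isUnit : ∀ s : S, SetLike.IsHomogeneousElem 𝒮 s → s ≠ 0 → IsUnit s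

/-- The graded prime algebra `(B, ℬ)` is birationally PI: its graded quotient ring is isomorphic,
as a graded algebra, to `M_n(S)` for a graded division ring `S` whose degree zero part, the
division ring `D = S₀`, is PI. Here `M_n(S)` is graded by means of shifts `d₁, …, d_n ∈ ℤ`: a matrix
`M` is homogeneous of degree `m` if each entry `M i j` lies in `S_{m + d i - d j}`. -/
def IsBirationallyPI {B : Type u} [Ring B] [Algebra k B] (ℬ : ℤ → Submodule k B) : Prop :=
  ∃ (Q : Type u) (_ : Ring Q) (_ : Algebra k Q) (𝒬 : ℤ → Submodule k Q) (_ : GradedAlgebra 𝒬)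
    (i : B →ₐ[k] Q) (S : Type u) (_ : Ring S) (_ : Algebra k S) (𝒮 : ℤ → Submodule k S)
    (_ : GradedAlgebra 𝒮) (n : ℕ) (d : Fin n → ℤ) (e : Q ≃ₐ[k] Matrix (Fin n) (Fin n) S),
    IsGradedQuotientRing ℬ 𝒬 i ∧ IsGradedDivisionRing 𝒮 ∧
    (∀ (m : ℤ) (q : Q), q ∈ 𝒬 m ↔ ∀ a b : Fin n, e q a b ∈ 𝒮 (m + d a - d b)) ∧
    IsPI k (SetLike.GradeZero.subalgebra 𝒮)

end Graded

end DixmierMoeglin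

open DixmierMoeglin

/-!
The primes of `A` are sorted by their homogeneous part `P*`, the prime generated by the homogeneous
elements of `P`. Fix a homogeneous prime `H` and let `M_n(S)` be the graded quotient ring of `A ⧸ H`.
A prime `P ⊇ H` satisfies `P* = H` exactly when it contains no homogeneous element that becomes
invertible in `M_n(S)`, and then it is determined by its extension to `M_n(S)`, that is, by an ideal
`J` of the graded division ring `S`.

If `J` is nonzero, an element of `J` of minimal support has central homogeneous components, whence a
central homogeneous unit `z` of nonzero degree. Since `S₀` is PI, Kaplansky's theorem makes it finite
over its center, and the conjugations by homogeneous units act on this center through a finite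
group. So `S₀` is finite over the field `K` of central elements of degree zero, and so is `S ⧸ J`
(`IsGradedDivisionRing.exists_finite_quotient`). Consequently a prime `P` strictly above `H` with
`P* = H` has a factor ring whose localization is finite over a central field
(`IsMatrixLocalization.hasFiniteFractions`), and this has three consequences.

* Primes strictly above `P` contain a denominator, so their homogeneous part is larger than `H`. Thus
  a strict inclusion of primes with the same homogeneous part starts at a homogeneous prime, and the
  descending chain condition passes from homogeneous primes to all primes
  (`wellFoundedLT_primeSpec`).
* Over `P` there are no or uncountably many minimal primes
  (`HasFiniteFractions.not_countable_primesAbove`): countably many elements meeting all of them would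
  force `A ⧸ P` to contain a regular algebraic element of one of them, as in an algebra of countable
  dimension over the uncountable field `k` an element all of whose translates `x - c` are
  invertible is algebraic.
* Over `H` there are uncountably many minimal primes, produced by the ideals generated by `z - c` with
  `c ∈ kˣ` (`IsMatrixLocalization.not_countable_primesAbove`).

If there is no such `P` over `H`, the primes minimal over `H` are homogeneous and the hypothesis on
`hSpec A` applies. Hence `Spec A` is countable-avoiding.

The equivalence then follows from general facts on prime noetherian algebras `R = A ⧸ P` of countable
dimension. If `P` is locally closed it is primitive, because the Jacobson radical of `R` vanishes
(`isLeftPrimitive_of_forall_le`). If `P` is primitive it is rational, because the center of the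
quotient ring of `R` acts on a faithful simple module, whose endomorphism ring is algebraic over `k`
(`isRational_of_isLeftPrimitive`). If `P` is rational, a countable set of nonzero elements of `R` meets
every nonzero ideal, by an induction on finite-dimensional subspaces based on Martindale's lemma, so
`P` has countably many minimal primes above it (`IsRational.countable_primesAbove`). When `Spec A` is
countable-avoiding these are finitely many, and by the descending chain condition `P` is locally
closed.
-/

universe w

namespace DixmierMoeglin

/-! ### Prime noetherian rings: nil ideals, regular elements and Goldie's theorem -/

/-- A prime ring, described elementwise: `a R b = 0` only if `a = 0` or `b = 0`. -/
structure IsPrimeRing (R : Type*) [Ring R] : Prop where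
  nontrivial : Nontrivial R
  eq_zero_or : ∀ a b : R, (∀ x, a * x * b = 0) → a = 0 ∨ b = 0

section PrimeRing

variable {R : Type*} [Ring R]

theorem IsPrimeRing.op (h : IsPrimeRing R) : IsPrimeRing Rᵐᵒᵖ where
  nontrivial := by
    have := h.nontrivial
    infer_instance
  eq_zero_or a b hab := by
    have := h.eq_zero_or b.unop a.unop fun x => by
      simpa [mul_assoc] using congrArg MulOpposite.unop (hab (MulOpposite.op x))
    simpa [or_comm] using this

/-- The left annihilator of an element, as a left ideal. -/
def leftAnn (a : R) : Ideal R where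
  carrier := {x | x * a = 0}
  add_mem' {x y} hx hy := by
    simp only [Set.mem_ofPred_eq] at hx hy ⊢
    rw [add_mul, hx, hy, add_zero]
  zero_mem' := by simp
  smul_mem' c x hx := by
    simp only [Set.mem_ofPred_eq] at hx ⊢
    rw [smul_eq_mul, mul_assoc, hx, mul_zero]

@[simp] theorem mem_leftAnn {a x : R} : x ∈ leftAnn a ↔ x * a = 0 := Iff.rfl

/-- A prime left noetherian ring has no nonzero nil right ideals: if `a ≠ 0` is chosen in such an
ideal with the largest possible left annihilator, then `a R a = 0`. -/
theorem IsPrimeRing.exists_not_isNilpotent [IsNoetherianRing R] (h : IsPrimeRing R) (a : R)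
    (ha : a ≠ 0) : ∃ x, ¬ IsNilpotent (a * x) := by
  by_contra! hnil
  let 𝓕 : Set (Ideal R) := {I | ∃ x, a * x ≠ 0 ∧ I = leftAnn (a * x)}
  obtain ⟨_, ⟨x, hx, rfl⟩, hmax⟩ := set_has_maximal_iff_noetherian.2 ‹_› 𝓕
    ⟨_, 1, by simpa using ha, rfl⟩
  set b := a * x with hb
  refine hx ?_
  have key : ∀ y, b * y * b = 0 := by
    intro y
    by_cases hy : b * y = 0
    · rw [hy, zero_mul]
    have hny : IsNilpotent (b * y) := by
      rw [hb, mul_assoc]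
      exact hnil _
    -- the last nonzero power of `b * y` has the same left annihilator as `b`
    have hex := hny
    classical
    set n := Nat.find hex with hn
    have hn0 : (b * y) ^ n = 0 := Nat.find_spec hex
    have hn2 : 2 ≤ n := by
      by_contra hlt
      interval_cases hh : n
      · have := h.nontrivial
        simp at hn0
      · exact hy (by simpa using hn0)
    obtain ⟨m, hm⟩ : ∃ m, n = m + 2 := ⟨n - 2, by omega⟩
    have hmin : (b * y) ^ (m + 1) ≠ 0 := Nat.find_min hex (by omega)
    have hmem : leftAnn ((b * y) ^ (m + 1)) ∈ 𝓕 := by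
      have e : (b * y) ^ (m + 1) = a * (x * y * (b * y) ^ m) := by
        rw [pow_succ', hb]
        simp only [mul_assoc]
      exact ⟨_, e ▸ hmin, by rw [e]⟩
    have hle : leftAnn b ≤ leftAnn ((b * y) ^ (m + 1)) := by
      intro z hz
      rw [mem_leftAnn] at hz ⊢
      rw [pow_succ', ← mul_assoc, ← mul_assoc, hz, zero_mul, zero_mul]
    have heq : leftAnn b = leftAnn ((b * y) ^ (m + 1)) :=
      hle.eq_of_not_lt (hmax _ hmem)
    have : b * y ∈ leftAnn b := by
      rw [heq, mem_leftAnn, ← pow_succ', ← hn0, hm]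
    simpa using this
  simpa using h.eq_zero_or b b key

theorem leftAnn_pow_le (a : R) {m n : ℕ} (h : m ≤ n) : leftAnn (a ^ m) ≤ leftAnn (a ^ n) := by
  intro x hx
  rw [mem_leftAnn] at hx ⊢
  rw [← Nat.add_sub_cancel' h, pow_add, ← mul_assoc, hx, zero_mul]

/-- In a left noetherian ring every element has a positive power `b` with `l(b) = l(b²)`. -/
theorem exists_pow_leftAnn_stable [IsNoetherianRing R] (a : R) :
    ∃ n, 0 < n ∧ ∀ x, x * a ^ n * a ^ n = 0 → x * a ^ n = 0 := by
  let f : ℕ →o Ideal R := ⟨fun n => leftAnn (a ^ n), fun m n h => leftAnn_pow_le a h⟩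
  obtain ⟨n, hn⟩ := monotone_stabilizes_iff_noetherian.2 ‹IsNoetherianRing R› f
  refine ⟨n + 1, Nat.succ_pos _, fun x hx => ?_⟩
  have h1 : x ∈ f (n + 1 + (n + 1)) := by
    change x * a ^ (n + 1 + (n + 1)) = 0
    rw [pow_add, ← mul_assoc, hx]
  rw [← hn _ (by omega), hn (n + 1) (by omega)] at h1
  exact h1

/-- A nonzero left ideal of a prime left noetherian ring contains `b ≠ 0` with `l(b) = l(b²)`. -/
theorem IsPrimeRing.exists_mem_stable [IsNoetherianRing R] (h : IsPrimeRing R) (I : Ideal R)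
    (hI : I ≠ ⊥) : ∃ b ∈ I, b ≠ 0 ∧ ∀ x, x * b * b = 0 → x * b = 0 := by
  obtain ⟨a, haI, ha⟩ := Submodule.exists_mem_ne_zero_of_ne_bot hI
  obtain ⟨x, hx⟩ := h.exists_not_isNilpotent a ha
  have hc : ¬ IsNilpotent (x * a) := by
    rintro ⟨n, hn⟩
    refine hx ⟨n + 1, ?_⟩
    have : ∀ n, (a * x) ^ (n + 1) = a * (x * a) ^ n * x := by
      intro n
      induction n with
      | zero => simp
      | succ n ih => rw [pow_succ, ih, pow_succ]; simp only [mul_assoc]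
    rw [this, hn, mul_zero, zero_mul]
  obtain ⟨n, hn, hs⟩ := exists_pow_leftAnn_stable (x * a)
  refine ⟨(x * a) ^ n, ?_, fun h0 => hc ⟨n, h0⟩, hs⟩
  obtain ⟨m, rfl⟩ : ∃ m, n = m + 1 := ⟨n - 1, by omega⟩
  rw [pow_succ]
  exact I.mul_mem_left _ (I.mul_mem_left _ haI)

/-- Essential left ideals. -/
def IsEssentialIdeal (I : Ideal R) : Prop := ∀ J : Ideal R, I ⊓ J = ⊥ → J = ⊥

/-- The left singular ideal of a prime left noetherian ring vanishes. -/
theorem IsPrimeRing.eq_zero_of_essential_leftAnn [IsNoetherianRing R] (h : IsPrimeRing R) (a : R)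
    (ha : IsEssentialIdeal (leftAnn a)) : a = 0 := by
  by_contra ha0
  obtain ⟨x, hx⟩ := h.exists_not_isNilpotent a ha0
  obtain ⟨n, hn, hs⟩ := exists_pow_leftAnn_stable (a * x)
  refine hx ⟨n, ?_⟩
  have := ha (Ideal.span {(a * x) ^ n}) ?_
  · rwa [Ideal.span_singleton_eq_bot] at this
  · rw [eq_bot_iff]
    rintro y ⟨hy1, hy2⟩
    obtain ⟨z, rfl⟩ := Ideal.mem_span_singleton'.1 hy2
    refine hs z ?_
    obtain ⟨m, rfl⟩ : ∃ m, n = m + 1 := ⟨n - 1, by omega⟩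
    have hy1 : z * (a * x) ^ (m + 1) * a = 0 := hy1
    rw [pow_succ' (a * x) m] at hy1 ⊢
    calc _ = z * (a * x * (a * x) ^ m) * a * (x * (a * x) ^ m) := by simp only [mul_assoc]
      _ = 0 := by rw [hy1, zero_mul]

/-- An element with zero left annihilator generates an essential left ideal. -/
theorem isEssentialIdeal_span_singleton [IsNoetherianRing R] (a : R)
    (ha : ∀ x, x * a = 0 → x = 0) : IsEssentialIdeal (Ideal.span {a}) := by
  intro J hJ
  let f : R × J →ₗ[R] R := (LinearMap.toSpanSingleton R R a).coprod J.subtype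
  have hf : Function.Injective f := by
    rw [injective_iff_map_eq_zero]
    rintro ⟨x, j⟩ hxj
    have hxj : x * a + (j : R) = 0 := by simpa [f] using hxj
    have hj : (j : R) ∈ Ideal.span {a} ⊓ J := by
      refine ⟨?_, j.2⟩
      rw [eq_neg_of_add_eq_zero_right hxj]
      exact neg_mem (Ideal.mul_mem_left _ _ (Ideal.mem_span_singleton_self a))
    rw [hJ, Submodule.mem_bot] at hj
    rw [hj, add_zero] at hxj
    exact Prod.ext (ha x hxj) (Subtype.ext hj)
  -- the cyclic left ideal is a copy of `R`, so `R × J` would embed in the noetherian module `R`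
  have := IsNoetherian.subsingleton_of_prod_injective f hf
  exact (Submodule.subsingleton_iff_eq_bot).1 this

theorem IsPrimeRing.isRegular [IsNoetherianRing R] (h : IsPrimeRing R) (a : R)
    (ha : ∀ x, x * a = 0 → x = 0) : IsRegular a := by
  refine ⟨?_, ?_⟩
  · refine isLeftRegular_of_non_zero_divisor a fun x hx => ?_
    refine h.eq_zero_of_essential_leftAnn x fun J hJ => ?_
    refine isEssentialIdeal_span_singleton a ha J ?_
    rw [eq_bot_iff] at hJ ⊢
    refine le_trans (inf_le_inf_right _ ?_) hJ
    rw [Ideal.span_le]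
    simpa using hx
  · exact isRightRegular_of_non_zero_divisor a ha

/-- Goldie: an essential left ideal of a prime left noetherian ring contains a regular element. -/
theorem IsPrimeRing.exists_isRegular_of_essential [IsNoetherianRing R] (h : IsPrimeRing R)
    (I : Ideal R) (hI : IsEssentialIdeal I) : ∃ a ∈ I, IsRegular a := by
  -- a left ideal `E ≤ I` is recorded with an element `a ∈ I` with `l(a) = l(a²)`, `E ∩ l(a) = 0`
  let 𝓕 : Set (Ideal R) := {E | E ≤ I ∧ ∃ a ∈ I, (∀ x, x * a * a = 0 → x * a = 0) ∧
    ∀ x ∈ E, x * a = 0 → x = 0}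
  obtain ⟨E, ⟨hEI, a, haI, hs, hE⟩, hmax⟩ := set_has_maximal_iff_noetherian.2 ‹_› 𝓕
    ⟨⊥, bot_le, 0, I.zero_mem, by simp, by simp⟩
  refine ⟨a, haI, h.isRegular a ?_⟩
  suffices hinf : I ⊓ leftAnn a = ⊥ by
    intro x hx
    have := hI _ hinf
    have hx' : x ∈ leftAnn a := hx
    rwa [this] at hx'
  by_contra hne
  obtain ⟨b, ⟨hbI, hba⟩, hb0, hbs⟩ := h.exists_mem_stable _ hne
  have hba : b * a = 0 := hba
  have hl : ∀ x, x * (a + b) = 0 → x * a = 0 ∧ x * b = 0 := by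
    intro x hx
    rw [mul_add] at hx
    have h1 : x * a = 0 := by
      apply hs
      have := congrArg (· * a) hx
      simpa [add_mul, mul_assoc, hba] using this
    exact ⟨h1, by simpa [h1] using hx⟩
  refine hmax (E ⊔ Ideal.span {b}) ⟨sup_le hEI ?_, a + b, I.add_mem haI hbI, ?_, ?_⟩ ?_
  · rw [Ideal.span_le]
    simpa using hbI
  · intro x hx
    obtain ⟨h1, h2⟩ := hl _ hx
    have h3 : x * a = 0 := by
      apply hs
      rw [mul_add, add_mul, mul_assoc x b a, hba, mul_zero, add_zero] at h1
      exact h1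
    have h4 : x * b = 0 := by
      apply hbs
      rw [mul_add, h3, zero_add] at h2
      exact h2
    rw [mul_add, h3, h4, add_zero]
  · intro x hx hx0
    obtain ⟨e, he, y, hy, rfl⟩ := Submodule.mem_sup.1 hx
    obtain ⟨z, rfl⟩ := Ideal.mem_span_singleton'.1 hy
    obtain ⟨h1, h2⟩ := hl _ hx0
    have he0 : e = 0 := by
      apply hE e he
      rwa [add_mul, mul_assoc z b a, hba, mul_zero, add_zero] at h1
    rw [he0, zero_add] at h2 ⊢
    exact hbs z h2
  · refine lt_of_le_of_ne le_sup_left fun heq => hb0 (hE b ?_ hba)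
    rw [heq]
    exact Submodule.mem_sup_right (Ideal.mem_span_singleton_self b)

theorem IsPrimeRing.isEssentialIdeal (h : IsPrimeRing R) (I : Ideal R) [I.IsTwoSided]
    (hI : I ≠ ⊥) : IsEssentialIdeal I := by
  intro J hJ
  rw [eq_bot_iff]
  intro y hy
  obtain ⟨x, hx, hx0⟩ := Submodule.exists_mem_ne_zero_of_ne_bot hI
  refine (h.eq_zero_or x y fun z => ?_).resolve_left hx0
  have : x * z * y ∈ I ⊓ J := ⟨I.mul_mem_right _ (I.mul_mem_right _ hx), J.mul_mem_left _ hy⟩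
  simpa [hJ] using this

theorem IsPrimeRing.exists_isRegular [IsNoetherianRing R] (h : IsPrimeRing R) (I : Ideal R)
    [I.IsTwoSided] (hI : I ≠ ⊥) : ∃ a ∈ I, IsRegular a :=
  h.exists_isRegular_of_essential I (h.isEssentialIdeal I hI)

/-- The left Ore condition for the regular elements of a prime left noetherian ring. -/
theorem IsPrimeRing.left_ore [IsNoetherianRing R] (h : IsPrimeRing R) (a s : R)
    (hs : IsRegular s) : ∃ b t : R, IsRegular t ∧ t * a = b * s := by
  let I : Ideal R := Submodule.comap (LinearMap.toSpanSingleton R R a) (Ideal.span {s})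
  have hmem : ∀ x, x ∈ I ↔ x * a ∈ Ideal.span {s} := fun x => Iff.rfl
  have hI : IsEssentialIdeal I := by
    intro J hJ
    have hes := isEssentialIdeal_span_singleton s
      (fun x hx => (hs.right (by simpa using hx : x * s = 0 * s)))
    rw [eq_bot_iff]
    intro y hy
    have h1 : Submodule.map (LinearMap.toSpanSingleton R R a) J = ⊥ := by
      apply hes
      rw [eq_bot_iff]
      rintro _ ⟨hx1, x, hx, rfl⟩
      have hx2 : x ∈ I ⊓ J := ⟨hx1, hx⟩
      rw [hJ, Submodule.mem_bot] at hx2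
      simp [hx2]
    have h2 : y * a ∈ Submodule.map (LinearMap.toSpanSingleton R R a) J := ⟨y, hy, rfl⟩
    rw [h1, Submodule.mem_bot] at h2
    have h3 : y ∈ I ⊓ J := ⟨(hmem y).2 (h2 ▸ zero_mem _), hy⟩
    rwa [hJ] at h3
  obtain ⟨t, ht, htr⟩ := h.exists_isRegular_of_essential I hI
  obtain ⟨b, hb⟩ := Ideal.mem_span_singleton'.1 ht
  exact ⟨b, t, htr, hb.symm⟩

theorem isRegular_op {a : R} : IsRegular (MulOpposite.op a) ↔ IsRegular a := by
  constructor
  · intro h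
    exact ⟨fun x y hxy => MulOpposite.op_injective (h.right (congrArg MulOpposite.op hxy)),
      fun x y hxy => MulOpposite.op_injective (h.left (congrArg MulOpposite.op hxy))⟩
  · intro h
    exact ⟨fun x y hxy => MulOpposite.unop_injective (h.right (congrArg MulOpposite.unop hxy)),
      fun x y hxy => MulOpposite.unop_injective (h.left (congrArg MulOpposite.unop hxy))⟩

theorem IsPrimeRing.right_ore [IsNoetherianRing Rᵐᵒᵖ] (h : IsPrimeRing R) (a s : R)
    (hs : IsRegular s) : ∃ b t : R, IsRegular t ∧ a * t = s * b := by
  obtain ⟨b, t, ht, hbt⟩ := h.op.left_ore (MulOpposite.op a) (MulOpposite.op s) (isRegular_op.2 hs)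
  exact ⟨b.unop, t.unop, isRegular_op.1 ht, congrArg MulOpposite.unop hbt⟩

end PrimeRing

/-- Goldie's theorem for prime noetherian algebras. -/
theorem IsPrimeRing.exists_isClassicalQuotientRing {k : Type v} [Field k] {B : Type u} [Ring B]
    [Algebra k B] [IsNoetherianRing B] [IsNoetherianRing Bᵐᵒᵖ] (h : IsPrimeRing B) :
    ∃ (Q : Type u) (_ : Ring Q) (_ : Algebra k Q) (i : B →ₐ[k] Q), IsClassicalQuotientRing i := by
  let S : Submonoid B :=
    { carrier := {s | IsRegular s}
      one_mem' := isRegular_one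
      mul_mem' := fun ha hb => ha.mul hb }
  choose num den hden hore using fun (a : B) (s : S) => h.left_ore a s.1 s.2
  let _ : OreLocalization.OreSet S :=
    { ore_right_cancel := fun r₁ r₂ s hs => ⟨1, by rw [s.2.right hs]⟩
      oreNum := num
      oreDenom := fun a s => ⟨den a s, hden a s⟩
      ore_eq := hore }
  let i : B →ₐ[k] OreLocalization S B :=
    { (OreLocalization.numeratorRingHom : B →+* OreLocalization S B) with
      commutes' := fun r => rfl }
  have hi : ∀ b, i b = OreLocalization.numeratorHom b := fun b => rfl
  have hunit : ∀ s : B, IsRegular s → IsUnit (i s) := fun s hs =>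
    OreLocalization.numerator_isUnit (⟨s, hs⟩ : S)
  have hleft : ∀ q, ∃ b s : B, IsRegular s ∧ i s * q = i b := by
    intro q
    induction q using OreLocalization.ind with
    | _ r s =>
      exact ⟨r, s, s.2, by rw [hi, hi]; simp [OreLocalization.numeratorHom_apply]⟩
  refine ⟨_, inferInstance, inferInstance, i, ?_, hunit, ?_, hleft⟩
  · refine OreLocalization.numeratorHom_inj (S := S) ?_
    intro s hs x hx
    exact hs.left (by simpa using hx)
  · intro q
    obtain ⟨b, s, hs, hq⟩ := hleft q
    obtain ⟨c, t, ht, hbt⟩ := h.right_ore b s hs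
    refine ⟨c, t, ht, (hunit s hs).mul_left_cancel ?_⟩
    rw [← mul_assoc, hq, ← map_mul, hbt, map_mul]

/-! ### Prime ideals and prime factor rings -/

section PrimeIdeal

variable {A : Type*} [Ring A]

/-- The two-sided ideal of all `a` with `a A b ⊆ I`. -/
def sandwichLeft (I : Ideal A) [I.IsTwoSided] (b : A) : Ideal A where
  carrier := {a | ∀ x, a * x * b ∈ I}
  add_mem' {a c} ha hc x := by
    rw [add_mul, add_mul]
    exact I.add_mem (ha x) (hc x)
  zero_mem' x := by simp
  smul_mem' c a ha x := by
    rw [smul_eq_mul, mul_assoc, mul_assoc, ← mul_assoc a]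
    exact I.mul_mem_left _ (ha x)

instance (I : Ideal A) [I.IsTwoSided] (b : A) : (sandwichLeft I b).IsTwoSided :=
  ⟨fun {a} c ha x => by
    rw [mul_assoc a]
    exact ha (c * x)⟩

end PrimeIdeal

variable {A : Type u} [Ring A]

theorem IsPrimeIdeal.mem_or_mem {P : Ideal A} (hP : IsPrimeIdeal P) {a b : A}
    (h : ∀ x, a * x * b ∈ P) : a ∈ P ∨ b ∈ P := by
  have := hP.isTwoSided
  let K : Ideal A :=
    { carrier := {c | ∀ y ∈ sandwichLeft P b, y * c ∈ P}
      add_mem' := fun {c d} hc hd y hy => by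
        rw [mul_add]
        exact P.add_mem (hc y hy) (hd y hy)
      zero_mem' := fun y _ => by simp
      smul_mem' := fun r c hc y hy => by
        rw [smul_eq_mul, ← mul_assoc]
        exact hc _ (Ideal.mul_mem_right _ _ hy) }
  have hK : K.IsTwoSided := ⟨fun {c} r hc y hy => by
    rw [← mul_assoc]
    exact P.mul_mem_right _ (hc y hy)⟩
  rcases hP.le_or_le (sandwichLeft P b) K inferInstance hK
    (Ideal.mul_le.2 fun y hy c hc => hc y hy) with h1 | h1
  · exact Or.inl (h1 h)
  · refine Or.inr (h1 fun y hy => ?_)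
    simpa using hy 1

theorem IsPrimeIdeal.of_mem_or_mem {P : Ideal A} (h2 : P.IsTwoSided) (h1 : P ≠ ⊤)
    (h : ∀ a b, (∀ x, a * x * b ∈ P) → a ∈ P ∨ b ∈ P) : IsPrimeIdeal P := by
  refine ⟨h2, h1, fun I J hI hJ hIJ => ?_⟩
  by_contra! hne
  obtain ⟨⟨a, haI, haP⟩, ⟨b, hbJ, hbP⟩⟩ :=
    And.intro (SetLike.not_le_iff_exists.1 hne.1) (SetLike.not_le_iff_exists.1 hne.2)
  rcases h a b fun x => hIJ (Ideal.mul_mem_mul (I.mul_mem_right _ haI) hbJ) with h | h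
  exacts [haP h, hbP h]

theorem IsPrimeIdeal.isPrimeRing_quotient {P : Ideal A} [P.IsTwoSided] (hP : IsPrimeIdeal P) :
    IsPrimeRing (A ⧸ P) := by
  refine ⟨Ideal.Quotient.nontrivial_iff.2 hP.ne_top, fun a b hab => ?_⟩
  obtain ⟨a, rfl⟩ := Ideal.Quotient.mk_surjective a
  obtain ⟨b, rfl⟩ := Ideal.Quotient.mk_surjective b
  simp only [Ideal.Quotient.eq_zero_iff_mem]
  refine hP.mem_or_mem fun x => ?_
  rw [← Ideal.Quotient.eq_zero_iff_mem]
  simpa using hab (Ideal.Quotient.mk P x)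

theorem isNoetherianRing_quotient [IsNoetherianRing A] (P : Ideal A) [P.IsTwoSided] :
    IsNoetherianRing (A ⧸ P) :=
  isNoetherianRing_of_surjective A _ (Ideal.Quotient.mk P) Ideal.Quotient.mk_surjective

theorem isNoetherianRing_quotient_op [IsNoetherianRing Aᵐᵒᵖ] (P : Ideal A) [P.IsTwoSided] :
    IsNoetherianRing (A ⧸ P)ᵐᵒᵖ :=
  isNoetherianRing_of_surjective Aᵐᵒᵖ _ (Ideal.Quotient.mk P).op fun x => by
    obtain ⟨a, ha⟩ := Ideal.Quotient.mk_surjective x.unop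
    exact ⟨MulOpposite.op a, MulOpposite.unop_injective (by simpa using ha)⟩

theorem isTwoSided_sup {I J : Ideal A} (hI : I.IsTwoSided) (hJ : J.IsTwoSided) :
    (I ⊔ J).IsTwoSided := by
  refine ⟨fun {a} b ha => ?_⟩
  obtain ⟨x, hx, y, hy, rfl⟩ := Submodule.mem_sup.1 ha
  rw [add_mul]
  exact Submodule.add_mem_sup (I.mul_mem_right _ hx) (J.mul_mem_right _ hy)

/-- If a prime `Q` contains all products `a₁ ⋯ aₙ` with `aᵢ` in the ideal `Pᵢ`, then it contains
some `Pᵢ`. The extra factor `c` is needed for the induction. -/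
theorem IsPrimeIdeal.exists_le_of_prod_mem {Q : Ideal A} (hQ : IsPrimeIdeal Q)
    (l : List (PrimeSpec A)) (c : A) (hc : c ∉ Q)
    (h : ∀ m : List A, List.Forall₂ (fun a P => a ∈ PrimeSpec.ideal P) m l → c * m.prod ∈ Q) :
    ∃ P ∈ l, P.ideal ≤ Q := by
  induction l generalizing c with
  | nil => exact absurd (by simpa using h [] .nil) hc
  | cons P l ih =>
    by_cases hPQ : P.ideal ≤ Q
    · exact ⟨P, List.mem_cons_self, hPQ⟩
    obtain ⟨a, haP, haQ⟩ := SetLike.not_le_iff_exists.1 hPQ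
    obtain ⟨x, hx⟩ : ∃ x, c * x * a ∉ Q := by
      by_contra! hall
      exact (hQ.mem_or_mem hall).elim hc haQ
    obtain ⟨P', hP', hle⟩ := ih (c * x * a) hx fun m hm => by
      simpa [mul_assoc] using h (x * a :: m) (.cons (P.ideal.mul_mem_left x haP) hm)
    exact ⟨P', List.mem_cons_of_mem _ hP', hle⟩

/-- Every two-sided ideal `I` of a noetherian ring contains a finite product of prime ideals
which contain `I`. -/
theorem exists_list_prod_mem [IsNoetherianRing A] (I : Ideal A) (hI : I.IsTwoSided) :
    ∃ l : List (PrimeSpec A), (∀ P ∈ l, I ≤ P.ideal) ∧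
      ∀ m : List A, List.Forall₂ (fun a P => a ∈ PrimeSpec.ideal P) m l → m.prod ∈ I := by
  by_contra hbad
  let 𝓕 : Set (Ideal A) := {I | I.IsTwoSided ∧ ¬ ∃ l : List (PrimeSpec A),
    (∀ P ∈ l, I ≤ P.ideal) ∧
      ∀ m : List A, List.Forall₂ (fun a P => a ∈ PrimeSpec.ideal P) m l → m.prod ∈ I}
  obtain ⟨J, ⟨hJ2, hJ⟩, hmax⟩ : ∃ J : Ideal A, J ∈ 𝓕 ∧ ∀ I ∈ 𝓕, ¬ J < I :=
    set_has_maximal_iff_noetherian.2 ‹IsNoetherianRing A› 𝓕 ⟨I, hI, hbad⟩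
  have hJtop : J ≠ ⊤ := fun h => hJ ⟨[], by simp, by simp [h]⟩
  have hprime : ¬ IsPrimeIdeal J := fun h => hJ ⟨[⟨J, h⟩], by simp, fun m hm => by
    obtain ⟨a, m', ha, hm', rfl⟩ := List.forall₂_cons_right_iff.1 hm
    obtain rfl := List.forall₂_nil_right_iff.1 hm'
    simpa using ha⟩
  have : ∃ K L : Ideal A, K.IsTwoSided ∧ L.IsTwoSided ∧ K * L ≤ J ∧ ¬ K ≤ J ∧ ¬ L ≤ J := by
    by_contra! hno
    refine hprime ⟨hJ2, hJtop, fun K L hK hL hKL => ?_⟩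
    by_contra! hne
    exact hne.2 (hno K L hK hL hKL hne.1)
  obtain ⟨K, L, hK, hL, hKL, hKJ, hLJ⟩ := this
  have aux : ∀ M : Ideal A, M.IsTwoSided → ¬ M ≤ J → ∃ l : List (PrimeSpec A),
      (∀ P ∈ l, J ⊔ M ≤ P.ideal) ∧
        ∀ m : List A, List.Forall₂ (fun a P => a ∈ PrimeSpec.ideal P) m l → m.prod ∈ J ⊔ M := by
    intro M hM hMJ
    by_contra hno
    refine hmax (J ⊔ M) ⟨isTwoSided_sup hJ2 hM, hno⟩ (lt_of_le_of_ne le_sup_left fun h => hMJ ?_)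
    rw [h]
    exact le_sup_right
  obtain ⟨l₁, h₁, h₁'⟩ := aux K hK hKJ
  obtain ⟨l₂, h₂, h₂'⟩ := aux L hL hLJ
  refine hJ ⟨l₁ ++ l₂, ?_, fun m hm => ?_⟩
  · intro P hP
    rcases List.mem_append.1 hP with h | h
    exacts [le_sup_left.trans (h₁ P h), le_sup_left.trans (h₂ P h)]
  · obtain ⟨m₁, m₂, hm₁, hm₂, rfl⟩ : ∃ m₁ m₂ : List A,
        List.Forall₂ (fun a P => a ∈ PrimeSpec.ideal P) m₁ l₁ ∧
        List.Forall₂ (fun a P => a ∈ PrimeSpec.ideal P) m₂ l₂ ∧ m = m₁ ++ m₂ := by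
      exact ⟨_, _, List.forall₂_take_append _ _ _ hm, List.forall₂_drop_append _ _ _ hm,
        (List.take_append_drop _ _).symm⟩
    rw [List.prod_append]
    obtain ⟨j, hj, a, ha, hja⟩ := Submodule.mem_sup.1 (h₁' m₁ hm₁)
    obtain ⟨j', hj', b, hb, hjb⟩ := Submodule.mem_sup.1 (h₂' m₂ hm₂)
    rw [← hja, ← hjb, add_mul, mul_add a]
    exact J.add_mem (J.mul_mem_right _ hj)
      (J.add_mem (J.mul_mem_left _ hj') (hKL (Ideal.mul_mem_mul ha hb)))

/-- The prime ideals minimal among those strictly containing `P`. -/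
def primesAbove (P : PrimeSpec A) : Set (PrimeSpec A) :=
  {Q | P < Q ∧ ∀ Q' : PrimeSpec A, P < Q' → ¬ Q' < Q}

/-- Only finitely many primes minimal above `P` contain a given ideal which is not in `P`. -/
theorem finite_primesAbove_of_le [IsNoetherianRing A] (P : PrimeSpec A) (I : Ideal A)
    [I.IsTwoSided] (hI : ¬ I ≤ P.ideal) : {Q ∈ primesAbove P | I ≤ Q.ideal}.Finite := by
  obtain ⟨l, hl, hle⟩ := exists_list_prod_mem (P.ideal ⊔ I) (isTwoSided_sup inferInstance ‹_›)
  refine Set.Finite.subset (l.finite_toSet) ?_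
  rintro Q ⟨⟨hPQ, hmin⟩, hIQ⟩
  have hPQ' : P.ideal ≤ Q.ideal := hPQ.le
  obtain ⟨P', hP', hJQ⟩ := Q.isPrime.exists_le_of_prod_mem l 1
    (fun h => Q.isPrime.ne_top ((Ideal.eq_top_iff_one _).2 h))
    (fun m hm => by simpa using sup_le hPQ' hIQ (hle m hm))
  have hlt : P < P' := by
    refine lt_of_le_of_ne (le_sup_left.trans (hl P' hP') : P.ideal ≤ P'.ideal) ?_
    rintro rfl
    exact hI (le_sup_right.trans (hl _ hP'))
  have hle' : P' ≤ Q := hJQ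
  rcases hle'.lt_or_eq with h | h
  · exact absurd h (hmin _ hlt)
  · exact h ▸ hP'

theorem exists_primesAbove_le [WellFoundedLT (PrimeSpec A)] {P Q : PrimeSpec A} (h : P < Q) :
    ∃ Q' ∈ primesAbove P, Q' ≤ Q := by
  obtain ⟨Q', ⟨h1, h2⟩, hmin⟩ := (wellFounded_lt (α := PrimeSpec A)).has_min
    {Q' | P < Q' ∧ Q' ≤ Q} ⟨Q, h, le_rfl⟩
  exact ⟨Q', ⟨h1, fun Q'' h3 h4 => hmin Q'' ⟨h3, h4.le.trans h2⟩ h4⟩, h2⟩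

/-! ### Algebras of countable dimension over an uncountable field -/

section CountableDimension

open Cardinal Polynomial

variable {k : Type v} [Field k]

theorem IsCountablyGenerated.rank_le [Algebra k A] (h : IsCountablyGenerated k A) :
    Module.rank k A ≤ ℵ₀ := by
  obtain ⟨s, hs, hgen⟩ := h
  have hc : (Submonoid.closure s : Set A).Countable := by
    have := hs.to_subtype
    rw [Submonoid.closure_eq_mrange, MonoidHom.coe_mrange]
    have : Countable (FreeMonoid s) := inferInstanceAs (Countable (List s))
    exact Set.countable_range _
  have := rank_span_le (R := k) (Submonoid.closure s : Set A)
  rw [← Algebra.adjoin_eq_span, hgen] at this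
  rw [← rank_top k A]
  exact this.trans (Cardinal.le_aleph0_iff_set_countable.2 hc)

theorem rank_quotient_le [Algebra k A] (hA : Module.rank k A ≤ ℵ₀) (P : Ideal A) [P.IsTwoSided] :
    Module.rank k (A ⧸ P) ≤ ℵ₀ :=
  (LinearMap.rank_le_of_surjective (Ideal.Quotient.mkₐ k P).toLinearMap
    (Ideal.Quotient.mkₐ_surjective k P)).trans hA

/-- In a countable-dimensional algebra over an uncountable field, an element `x` such that all
`x - c` with `c ≠ 0` are invertible is algebraic: the inverses cannot be linearly independent. -/
theorem isAlgebraic_of_isUnit_sub [Uncountable k] [Algebra k A] (hA : Module.rank k A ≤ ℵ₀)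
    (x : A) (hx : ∀ c : k, c ≠ 0 → IsUnit (x - algebraMap k A c)) : IsAlgebraic k x := by
  classical
  choose! g hg using fun (c : k) (hc : c ≠ 0) => (hx c hc).exists_right_inv
  have hdep : ¬ LinearIndependent k fun c : {c : k // c ≠ 0} => g c := by
    intro hli
    have h1 := hli.cardinal_lift_le_rank
    have h2 : lift.{u} #{c : k // c ≠ 0} ≤ ℵ₀ := by
      refine h1.trans ?_
      simpa using hA
    have h3 : Countable {c : k // c ≠ 0} := by
      rw [← Cardinal.mk_le_aleph0_iff]
      simpa using h2
    have h4 : (Set.univ : Set k).Countable := by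
      have : (Set.univ : Set k) = {c | c ≠ 0} ∪ {0} := by
        ext c
        simp [em]
      rw [this]
      exact (Set.countable_coe_iff.1 h3).union (Set.countable_singleton 0)
    exact Set.not_countable_univ h4
  rw [linearIndependent_iff'] at hdep
  push Not at hdep
  obtain ⟨s, a, hsum, c₀, hc₀, hac₀⟩ := hdep
  refine ⟨∑ c ∈ s, C (a c) * ∏ b ∈ s.erase c, (X - C (b : k)), ?_, ?_⟩
  · intro h0
    have h1 := congrArg (eval (c₀ : k)) h0
    rw [eval_finsetSum, Finset.sum_eq_single_of_mem c₀ hc₀] at h1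
    · rw [eval_mul, eval_C, eval_prod, eval_zero, mul_eq_zero, or_iff_right hac₀,
        Finset.prod_eq_zero_iff] at h1
      obtain ⟨b, hb, hb'⟩ := h1
      rw [eval_sub, eval_X, eval_C, sub_eq_zero] at hb'
      exact (Finset.mem_erase.1 hb).1 (Subtype.ext hb').symm
    · intro b hb hne
      rw [eval_mul, eval_prod, Finset.prod_eq_zero (Finset.mem_erase.2 ⟨hne.symm, hc₀⟩), mul_zero]
      simp
  · have h1 : ∀ c ∈ s, aeval x (C (a c) * ∏ b ∈ s.erase c, (X - C (b : k)))
        = aeval x (∏ b ∈ s, (X - C (b : k))) * (a c • g c) := by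
      intro c hc
      rw [← Finset.prod_erase_mul s _ hc, map_mul, map_mul, mul_assoc, mul_smul_comm]
      have : aeval x (X - C (c : k)) * g c = 1 := by
        simpa using hg c c.2
      rw [this, mul_smul_comm, mul_one, aeval_C, Algebra.smul_def]
    rw [map_sum, Finset.sum_congr rfl h1, ← Finset.mul_sum, hsum, mul_zero]

theorem isUnit_one_sub_of_mem_jacobson {R : Type*} [Ring R] {a : R}
    (ha : a ∈ Ideal.jacobson (⊥ : Ideal R)) : IsUnit (1 - a) := by
  have hleft : ∀ b ∈ Ideal.jacobson (⊥ : Ideal R), ∃ s, s * (1 - b) = 1 := by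
    intro b hb
    obtain ⟨s, hs⟩ := Ideal.exists_mul_sub_mem_of_sub_one_mem_jacobson (I := (⊥ : Ideal R)) (1 - b)
      (by simpa using hb)
    exact ⟨s, sub_eq_zero.1 (by simpa using hs)⟩
  obtain ⟨s, hs⟩ := hleft a ha
  obtain ⟨t, ht⟩ := hleft (-(s * a)) (neg_mem (Ideal.mul_mem_left _ _ ha))
  have hs' : 1 - -(s * a) = s := by
    rw [mul_sub, mul_one, sub_eq_iff_eq_add] at hs
    rw [sub_neg_eq_add]
    exact hs.symm
  rw [hs'] at ht
  have : t = 1 - a := by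
    calc t = t * (s * (1 - a)) := by rw [hs, mul_one]
      _ = 1 - a := by rw [← mul_assoc, ht, one_mul]
  rw [this] at ht
  exact ⟨⟨1 - a, s, ht, hs⟩, rfl⟩

/-- Amitsur: the Jacobson radical of a prime noetherian algebra of countable dimension over an
uncountable field vanishes. -/
theorem IsPrimeRing.jacobson_eq_bot {R : Type u} [Ring R] [Algebra k R] [Uncountable k]
    [IsNoetherianRing R] (h : IsPrimeRing R) (hR : Module.rank k R ≤ ℵ₀) :
    Ideal.jacobson (⊥ : Ideal R) = ⊥ := by
  have := h.nontrivial
  by_contra hne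
  obtain ⟨a, haJ, ha⟩ := Submodule.exists_mem_ne_zero_of_ne_bot hne
  obtain ⟨x, hx⟩ := h.exists_not_isNilpotent a ha
  have hb : a * x ∈ Ideal.jacobson (⊥ : Ideal R) := Ideal.mul_mem_right _ _ haJ
  set b := a * x
  have hsmul : ∀ c : k, c • b ∈ Ideal.jacobson (⊥ : Ideal R) := fun c => by
    rw [Algebra.smul_def]
    exact Ideal.mul_mem_left _ _ hb
  obtain ⟨p, hp, hpb⟩ := isAlgebraic_of_isUnit_sub hR b fun c hc => by
    have h1 := (isUnit_one_sub_of_mem_jacobson (hsmul c⁻¹)).mul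
      ((isUnit_iff_ne_zero.2 (neg_ne_zero.2 hc)).map (algebraMap k R))
    convert h1 using 1
    rw [sub_mul, one_mul, ← Algebra.commutes, ← Algebra.smul_def, smul_smul, map_neg]
    simp [hc, sub_eq_add_neg, add_comm]
  obtain ⟨q, hq, hq0⟩ := p.exists_eq_pow_rootMultiplicity_mul_and_not_dvd hp 0
  rw [C_0, sub_zero, X_dvd_iff] at hq0
  rw [hq, C_0, sub_zero, map_mul, map_pow, aeval_X] at hpb
  -- `q(b)` is the sum of the nonzero constant `q(0)` and an element of the radical
  have hunit : IsUnit (aeval b q) := by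
    have h1 : aeval b q = algebraMap k R (q.coeff 0) * (1 - -((q.coeff 0)⁻¹ • (aeval b q.divX * b))) := by
      conv_lhs => rw [← divX_mul_X_add q]
      rw [map_add, map_mul, aeval_X, aeval_C, sub_neg_eq_add, mul_add, mul_one, ← Algebra.smul_def,
        smul_smul, mul_inv_cancel₀ hq0, one_smul, add_comm]
    rw [h1]
    refine ((isUnit_iff_ne_zero.2 hq0).map _).mul (isUnit_one_sub_of_mem_jacobson (neg_mem ?_))
    rw [Algebra.smul_def]
    exact Ideal.mul_mem_left _ _ (Ideal.mul_mem_left _ _ hb)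
  exact hx ⟨_, hunit.mul_left_eq_zero.1 hpb⟩

end CountableDimension

/-! ### Locally closed primes are primitive -/

section Opposite

variable {A : Type u} [Ring A]

/-- A two-sided ideal, seen as an ideal of the opposite ring. -/
def opIdeal (I : Ideal A) [I.IsTwoSided] : Ideal Aᵐᵒᵖ where
  carrier := {x | x.unop ∈ I}
  add_mem' hx hy := I.add_mem hx hy
  zero_mem' := I.zero_mem
  smul_mem' c _ hx := I.mul_mem_right c.unop hx

@[simp] theorem mem_opIdeal {I : Ideal A} [I.IsTwoSided] {x : Aᵐᵒᵖ} :
    x ∈ opIdeal I ↔ x.unop ∈ I := Iff.rfl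

instance (I : Ideal A) [I.IsTwoSided] : (opIdeal I).IsTwoSided :=
  ⟨fun {_} b ha => I.mul_mem_left b.unop ha⟩

/-- A two-sided ideal of the opposite ring, seen as an ideal of the ring itself. -/
def unopIdeal (I : Ideal Aᵐᵒᵖ) [I.IsTwoSided] : Ideal A where
  carrier := {x | MulOpposite.op x ∈ I}
  add_mem' hx hy := I.add_mem hx hy
  zero_mem' := I.zero_mem
  smul_mem' c _ hx := I.mul_mem_right (MulOpposite.op c) hx

instance (I : Ideal Aᵐᵒᵖ) [I.IsTwoSided] : (unopIdeal I).IsTwoSided :=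
  ⟨fun {_} b ha => I.mul_mem_left (MulOpposite.op b) ha⟩

theorem IsPrimeIdeal.opIdeal {P : Ideal A} [P.IsTwoSided] (hP : IsPrimeIdeal P) :
    IsPrimeIdeal (opIdeal P) := by
  refine .of_mem_or_mem inferInstance ?_ fun a b hab => ?_
  · rw [Ideal.ne_top_iff_one]
    exact (Ideal.ne_top_iff_one P).1 hP.ne_top
  · rw [or_comm]
    refine hP.mem_or_mem (a := b.unop) (b := a.unop) fun x => ?_
    simpa [mul_assoc] using hab (MulOpposite.op x)

theorem IsPrimeIdeal.unopIdeal {P : Ideal Aᵐᵒᵖ} [P.IsTwoSided] (hP : IsPrimeIdeal P) :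
    IsPrimeIdeal (unopIdeal P) := by
  refine .of_mem_or_mem inferInstance ?_ fun a b hab => ?_
  · rw [Ideal.ne_top_iff_one]
    exact (Ideal.ne_top_iff_one P).1 hP.ne_top
  · rw [or_comm]
    refine hP.mem_or_mem (a := MulOpposite.op b) (b := MulOpposite.op a) fun x => ?_
    have := hab x.unop
    change MulOpposite.op (a * x.unop * b) ∈ P at this
    simpa [mul_assoc] using this

end Opposite

section LocallyClosed

open Cardinal

variable {k : Type v} [Field k] [Uncountable k] {A : Type u} [Ring A] [Algebra k A]

/-- If the primes strictly above `P` all contain an ideal `I` not contained in `P`, then `P` is left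
primitive: otherwise `I` would annihilate all simple `A ⧸ P`-modules, and the Jacobson radical
of `A ⧸ P` vanishes. -/
theorem isLeftPrimitive_of_forall_le [IsNoetherianRing A] (hA : Module.rank k A ≤ ℵ₀)
    (P : PrimeSpec A) (I : Ideal A) (hI : ¬ I ≤ P.ideal)
    (h : ∀ Q : PrimeSpec A, P < Q → I ≤ Q.ideal) : IsLeftPrimitive P.ideal := by
  by_contra hprim
  have hjac : P.ideal.jacobson = P.ideal := by
    have := isNoetherianRing_quotient P.ideal
    have h1 := P.isPrime.isPrimeRing_quotient.jacobson_eq_bot (k := k)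
      (rank_quotient_le hA P.ideal)
    have h2 := Ideal.comap_jacobson_of_surjective (f := Ideal.Quotient.mk P.ideal)
      Ideal.Quotient.mk_surjective (K := ⊥)
    rw [h1, ← RingHom.ker_eq_comap_bot, Ideal.mk_ker] at h2
    exact h2.symm
  refine hI ?_
  rw [← hjac]
  refine le_sInf ?_
  rintro m ⟨hPm, hm⟩
  have hsimple : IsSimpleModule A (A ⧸ m) := isSimpleModule_iff_isCoatom.2 hm.out
  let N : Ideal A :=
    { carrier := {a | ∀ y : A ⧸ m, a • y = 0}
      add_mem' := fun ha hb y => by rw [add_smul, ha, hb, add_zero]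
      zero_mem' := fun y => zero_smul _ y
      smul_mem' := fun c a ha y => by rw [smul_eq_mul, mul_smul, ha, smul_zero] }
  have hN2 : N.IsTwoSided := ⟨fun {a} b ha y => by rw [mul_smul]; exact ha _⟩
  have hmem : ∀ a, a ∈ N ↔ ∀ y : A ⧸ m, a • y = 0 := fun a => Iff.rfl
  have hNm : N ≤ m := fun a ha => by
    have := ha (Submodule.Quotient.mk 1)
    rwa [← Submodule.Quotient.mk_smul, Submodule.Quotient.mk_eq_zero, smul_eq_mul, mul_one] at this
  have hPN : P.ideal ≤ N := by
    intro a ha y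
    obtain ⟨b, rfl⟩ := Submodule.Quotient.mk_surjective _ y
    rw [← Submodule.Quotient.mk_smul, Submodule.Quotient.mk_eq_zero]
    exact hPm (P.ideal.mul_mem_right b ha)
  have hNprime : IsPrimeIdeal N := by
    refine .of_mem_or_mem hN2 (fun htop => hm.ne_top (top_le_iff.1 (htop ▸ hNm))) fun a b hab => ?_
    by_contra! hne
    obtain ⟨y, hy⟩ := not_forall.1 hne.2
    refine hne.1 fun y' => ?_
    -- `b • y` generates the simple module
    obtain ⟨x, rfl⟩ := (IsSimpleModule.toSpanSingleton_surjective A hy) y'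
    simpa [mul_smul] using hab x y
  rcases (show P ≤ ⟨N, hNprime⟩ from hPN).lt_or_eq with hlt | heq
  · exact (h _ hlt).trans hNm
  · refine absurd ⟨A ⧸ m, inferInstance, inferInstance, hsimple, fun a => ?_⟩ hprim
    rw [← hmem, heq]

theorem isRightPrimitive_of_forall_le [IsNoetherianRing Aᵐᵒᵖ] (hA : Module.rank k A ≤ ℵ₀)
    (P : PrimeSpec A) (I : Ideal A) [I.IsTwoSided] (hI : ¬ I ≤ P.ideal)
    (h : ∀ Q : PrimeSpec A, P < Q → I ≤ Q.ideal) : IsRightPrimitive P.ideal := by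
  have hrank : Module.rank k Aᵐᵒᵖ ≤ ℵ₀ := by
    rwa [← (MulOpposite.opLinearEquiv k : A ≃ₗ[k] Aᵐᵒᵖ).rank_eq]
  obtain ⟨M, i₁, i₂, hM, hann⟩ := isLeftPrimitive_of_forall_le hrank ⟨opIdeal P.ideal, P.isPrime.opIdeal⟩
    (opIdeal I) (fun hle => hI fun a ha => hle (show MulOpposite.op a ∈ opIdeal I from ha))
    (fun Q hQ a ha => by
      have hlt : P < ⟨unopIdeal Q.ideal, Q.isPrime.unopIdeal⟩ := by
        refine lt_of_le_of_ne (fun x hx => ?_ : P.ideal ≤ unopIdeal Q.ideal) fun heq => ?_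
        · exact hQ.le (show MulOpposite.op x ∈ opIdeal P.ideal from hx)
        · refine hQ.ne (PrimeSpec.ext ?_)
          rw [heq]
          rfl
      exact h _ hlt ha)
  exact ⟨M, i₁, i₂, hM, fun a => hann (MulOpposite.op a)⟩

end LocallyClosed

/-! ### Primitive primes are rational -/

section Primitive

open Cardinal Polynomial

variable {k : Type v} [Field k] {A : Type u} [Ring A] [Algebra k A]

/-- Let `A → Q` have kernel the annihilator of the simple module `M`. A central element `z` of `Q`
with a denominator in `A` acts on `M` by an endomorphism. -/
theorem exists_end_of_central {Q : Type w} [Ring Q] (j : A →+* Q) (M : Type u)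
    [AddCommGroup M] [Module A M] [IsSimpleModule A M]
    (hM : ∀ a, j a = 0 ↔ ∀ m : M, a • m = 0) (z : Q) (hz : ∀ q, z * q = q * z) (t b : A)
    (ht : IsUnit (j t)) (hb : z * j t = j b) :
    ∃ f : Module.End A M, ∀ r r' : A, j r' = z * j r → ∀ m : M, r' • m = f (r • m) := by
  have hnt := IsSimpleModule.nontrivial A M
  let I : Ideal A :=
    { carrier := {r | ∃ r', j r' = z * j r}
      add_mem' := by
        rintro r s ⟨r', hr⟩ ⟨s', hs⟩
        exact ⟨r' + s', by rw [map_add, map_add, mul_add, hr, hs]⟩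
      zero_mem' := ⟨0, by simp⟩
      smul_mem' := by
        rintro c r ⟨r', hr⟩
        exact ⟨c * r', by rw [smul_eq_mul, map_mul, map_mul, hr, ← mul_assoc, ← hz, mul_assoc]⟩ }
  have htI : t ∈ I := ⟨b, hb.symm⟩
  have hQ : Nontrivial Q := by
    obtain ⟨m, hm⟩ := exists_ne (0 : M)
    refine nontrivial_of_ne (j 1) 0 fun h => hm ?_
    simpa using (hM 1).1 h m
  obtain ⟨m₀, hm₀⟩ : ∃ m₀ : M, t • m₀ ≠ 0 := by
    by_contra! hall
    exact ht.ne_zero ((hM t).2 hall)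
  have huniq : ∀ r s, j r = j s → ∀ m : M, r • m = s • m := by
    intro r s h m
    rw [← sub_eq_zero, ← sub_smul]
    exact (hM _).1 (by rw [map_sub, h, sub_self]) m
  choose g hg using fun r : I => r.2
  let π : I →ₗ[A] M := (LinearMap.toSpanSingleton A M m₀).comp I.subtype
  have hπ : ∀ r : I, π r = (r : A) • m₀ := fun r => rfl
  let G : I →ₗ[A] M :=
    { toFun := fun r => g r • m₀
      map_add' := fun r s => by
        rw [← add_smul]
        exact huniq _ _ (by
          rw [map_add, hg, hg, hg, Submodule.coe_add, map_add, mul_add]) m₀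
      map_smul' := fun c r => by
        rw [RingHom.id_apply, ← mul_smul]
        exact huniq _ _ (by
          rw [map_mul, hg, hg, Submodule.coe_smul, smul_eq_mul, map_mul, ← mul_assoc, hz (j c),
            mul_assoc]) m₀ }
  have hG : ∀ r : I, G r = g r • m₀ := fun r => rfl
  have hsurj : Function.Surjective π := by
    refine (LinearMap.surjective_or_eq_zero π).resolve_right fun h => hm₀ ?_
    rw [← hπ ⟨t, htI⟩, h, LinearMap.zero_apply]
  have hker : LinearMap.ker π ≤ LinearMap.ker G := by
    intro r hr
    rw [LinearMap.mem_ker, hπ] at hr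
    rw [LinearMap.mem_ker, hG]
    by_contra hne
    -- the nonzero vector `g r • m₀` would be killed by `I`, hence `t` would kill `M`
    have hkill : ∀ m : M, t • m = 0 := by
      intro m
      obtain ⟨c, rfl⟩ := IsSimpleModule.toSpanSingleton_surjective A hne m
      rw [LinearMap.toSpanSingleton_apply, ← mul_smul, ← mul_smul]
      have : j (t * c * g r) = j (b * c * r) := by
        rw [map_mul, map_mul, hg, map_mul, map_mul, ← hb, ← mul_assoc, ← hz]
        simp only [mul_assoc]
      rw [huniq _ _ this, mul_smul, hr, smul_zero]
    exact ht.ne_zero ((hM t).2 hkill)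
  let e := π.quotKerEquivOfSurjective hsurj
  let f : Module.End A M := ((LinearMap.ker π).liftQ G hker).comp e.symm.toLinearMap
  have hf : ∀ r : I, f (π r) = G r := by
    intro r
    have : e.symm (π r) = Submodule.Quotient.mk r := by
      rw [LinearEquiv.symm_apply_eq]
      rfl
    simp only [f, LinearMap.comp_apply, LinearEquiv.coe_coe, this]
    exact Submodule.liftQ_apply _ _ _
  refine ⟨f, fun r r' hr m => ?_⟩
  obtain ⟨s, rfl⟩ := hsurj m
  have h1 := hf (r • s)
  rw [map_smul, hG] at h1
  rw [h1, hπ, ← mul_smul]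
  exact huniq _ _ (by
    rw [hg, Submodule.coe_smul, smul_eq_mul, map_mul, map_mul, hr, mul_assoc]) m₀

variable [Uncountable k]

theorem Module.End.isAlgebraic_of_isSimpleModule (hA : Module.rank k A ≤ ℵ₀) (M : Type u)
    [AddCommGroup M] [Module A M] [Module k M] [IsScalarTower k A M] [SMulCommClass A k M]
    [IsSimpleModule A M] (f : Module.End A M) : IsAlgebraic k f := by
  have hnt := IsSimpleModule.nontrivial A M
  obtain ⟨m, hm⟩ := exists_ne (0 : M)
  have hM : Module.rank k M ≤ ℵ₀ := by
    refine (LinearMap.rank_le_of_surjective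
      ((LinearMap.toSpanSingleton A M m).restrictScalars k) ?_).trans hA
    exact IsSimpleModule.toSpanSingleton_surjective A hm
  have hE : Module.rank k (Module.End A M) ≤ ℵ₀ := by
    let ev : Module.End A M →ₗ[k] M :=
      { toFun := fun f => f m
        map_add' := fun _ _ => rfl
        map_smul' := fun _ _ => rfl }
    refine (LinearMap.rank_le_of_injective ev ?_).trans hM
    rw [injective_iff_map_eq_zero]
    intro f hf
    refine f.bijective_or_eq_zero.resolve_left fun hbij => hm (hbij.1 ?_)
    rw [map_zero]
    exact hf
  by_cases hc : ∃ c : k, f = algebraMap k _ c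
  · obtain ⟨c, rfl⟩ := hc
    exact isAlgebraic_algebraMap c
  · refine isAlgebraic_of_isUnit_sub hE f fun c _ => ?_
    rw [Module.End.isUnit_iff]
    refine (LinearMap.bijective_or_eq_zero _).resolve_right fun h0 => hc ⟨c, ?_⟩
    rwa [sub_eq_zero] at h0

theorem isAlgebraic_of_central {Q : Type w} [Ring Q] [Algebra k Q] (j : A →ₐ[k] Q)
    (hA : Module.rank k A ≤ ℵ₀) (M : Type u) [AddCommGroup M] [Module A M] [IsSimpleModule A M]
    (hM : ∀ a, j a = 0 ↔ ∀ m : M, a • m = 0) (z : Q) (hz : ∀ q, z * q = q * z) (t b : A)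
    (ht : IsUnit (j t)) (hb : z * j t = j b) : IsAlgebraic k z := by
  obtain ⟨f, hf⟩ := exists_end_of_central (j : A →+* Q) M hM z hz t b ht hb
  let _ : Module k M := Module.compHom M (algebraMap k A)
  have hsm : ∀ (c : k) (m : M), c • m = algebraMap k A c • m := fun _ _ => rfl
  have : IsScalarTower k A M := ⟨fun c a m => by rw [hsm, Algebra.smul_def, mul_smul]⟩
  have : SMulCommClass A k M := ⟨fun a c m => by
    rw [hsm, hsm, ← mul_smul, ← mul_smul, Algebra.commutes]⟩
  obtain ⟨p, hp, hpf⟩ := Module.End.isAlgebraic_of_isSimpleModule hA M f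
  refine ⟨p, hp, ?_⟩
  set n := p.natDegree
  have hcomm : ∀ q, Commute z q := hz
  let s : ℕ → A := fun e => b ^ e * t ^ (n - e)
  have hs : ∀ e ≤ n, j (s e) = z ^ e * j t ^ n := by
    intro e he
    rw [map_mul, map_pow, map_pow, ← hb, (hcomm _).mul_pow, mul_assoc, ← pow_add,
      Nat.add_sub_cancel' he]
  have hact : ∀ e ≤ n, ∀ m : M, s e • m = (f ^ e) (t ^ n • m) := by
    intro e he m
    induction e with
    | zero => simp [s]
    | succ e ih =>
      rw [hf (s e) (s (e + 1)) ?_ m, ih (by omega), pow_succ']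
      · rfl
      · change j (s (e + 1)) = z * j (s e)
        rw [hs _ he, hs e (by omega), pow_succ', mul_assoc]
  have hsum : j (∑ e ∈ Finset.range (n + 1), p.coeff e • s e) = 0 := by
    rw [hM]
    intro m
    have h1 := congrArg (fun g : Module.End A M => g (t ^ n • m)) hpf
    simp only [aeval_eq_sum_range, LinearMap.zero_apply] at h1
    rw [← h1, LinearMap.sum_apply, Finset.sum_smul]
    refine Finset.sum_congr rfl fun e he => ?_
    rw [smul_assoc, hact e (by simpa [Nat.lt_succ_iff] using he)]
    rfl
  have h2 : aeval z p * j t ^ n = 0 := by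
    rw [← hsum, aeval_eq_sum_range, Finset.sum_mul, map_sum]
    refine Finset.sum_congr rfl fun e he => ?_
    rw [map_smul, hs e (by simpa [Nat.lt_succ_iff] using he), smul_mul_assoc]
  exact (ht.pow n).mul_left_eq_zero.1 h2

theorem isRational_of_isLeftPrimitive [IsNoetherianRing A] [IsNoetherianRing Aᵐᵒᵖ]
    (hA : Module.rank k A ≤ ℵ₀) (P : PrimeSpec A) (h : IsLeftPrimitive P.ideal) :
    IsRational k P := by
  obtain ⟨M, _, _, hM, hann⟩ := h
  have := isNoetherianRing_quotient P.ideal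
  have := isNoetherianRing_quotient_op P.ideal
  obtain ⟨Q, _, _, i, hi⟩ := P.isPrime.isPrimeRing_quotient.exists_isClassicalQuotientRing (k := k)
  refine ⟨Q, _, _, i, hi, ⟨fun z => ?_⟩⟩
  obtain ⟨b, s, hs, hb⟩ := hi.right_fraction z
  obtain ⟨b, rfl⟩ := Ideal.Quotient.mk_surjective b
  obtain ⟨s, rfl⟩ := Ideal.Quotient.mk_surjective s
  have hz := isAlgebraic_of_central (i.comp (Ideal.Quotient.mkₐ k P.ideal)) hA M (fun a => by
    rw [← hann, AlgHom.comp_apply, map_eq_zero_iff _ hi.injective]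
    exact Ideal.Quotient.eq_zero_iff_mem) z.1
    (fun q => (Subalgebra.mem_center_iff.1 z.2 q).symm) s b (hi.isUnit _ hs) hb
  exact (isAlgebraic_algHom_iff (Subalgebra.val _) Subtype.val_injective).1 hz

theorem isRational_of_isRightPrimitive [IsNoetherianRing A] [IsNoetherianRing Aᵐᵒᵖ]
    (hA : Module.rank k A ≤ ℵ₀) (P : PrimeSpec A) (h : IsRightPrimitive P.ideal) :
    IsRational k P := by
  obtain ⟨M, _, _, hM, hann⟩ := h
  have := isNoetherianRing_quotient P.ideal
  have := isNoetherianRing_quotient_op P.ideal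
  have hrank : Module.rank k Aᵐᵒᵖ ≤ ℵ₀ := by
    rwa [← (MulOpposite.opLinearEquiv k : A ≃ₗ[k] Aᵐᵒᵖ).rank_eq]
  obtain ⟨Q, _, _, i, hi⟩ := P.isPrime.isPrimeRing_quotient.exists_isClassicalQuotientRing (k := k)
  refine ⟨Q, _, _, i, hi, ⟨fun z => ?_⟩⟩
  obtain ⟨b, s, hs, hb⟩ := hi.left_fraction z
  obtain ⟨b, rfl⟩ := Ideal.Quotient.mk_surjective b
  obtain ⟨s, rfl⟩ := Ideal.Quotient.mk_surjective s
  obtain ⟨p, hp, hpz⟩ := isAlgebraic_of_central (i.comp (Ideal.Quotient.mkₐ k P.ideal)).op hrank M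
    (fun a => by
      rw [← MulOpposite.op_unop a, ← hann, ← Ideal.Quotient.eq_zero_iff_mem,
        ← map_eq_zero_iff _ hi.injective]
      exact MulOpposite.op_eq_zero_iff _) (MulOpposite.op z.1)
    (fun q => MulOpposite.unop_injective (Subalgebra.mem_center_iff.1 z.2 q.unop))
    (MulOpposite.op s) (MulOpposite.op b) (hi.isUnit _ hs).op (congrArg MulOpposite.op hb)
  refine ⟨p, hp, Subtype.ext ?_⟩
  have h1 := congrArg MulOpposite.unop hpz
  rw [aeval_eq_sum_range] at h1 ⊢
  simpa using h1

end Primitive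

/-! ### Rational primes have countably many primes minimal above them -/

section Rational

open Cardinal

variable {k : Type v} [Field k] {R Q : Type u} [Ring R] [Algebra k R] [Ring Q] [Algebra k Q]

theorem IsClassicalQuotientRing.mem_center_of_commute {i : R →ₐ[k] Q}
    (hi : IsClassicalQuotientRing i) (z : Q) (hz : ∀ r, z * i r = i r * z) :
    z ∈ Subalgebra.center k Q := by
  rw [Subalgebra.mem_center_iff]
  intro q
  obtain ⟨b, s, hs, hq⟩ := hi.right_fraction q
  refine (hi.isUnit s hs).mul_right_cancel ?_
  rw [mul_assoc, hz, ← mul_assoc, hq, mul_assoc, hq, hz]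

/-- Martindale: if `a x p = p x a` for all `x` in the prime noetherian ring `R` and `a ≠ 0`, then
`p = z a` for a central element `z` of the quotient ring. -/
theorem IsClassicalQuotientRing.exists_center_mul_eq [IsNoetherianRing R] (h : IsPrimeRing R)
    {i : R →ₐ[k] Q} (hi : IsClassicalQuotientRing i) {a p : R} (ha : a ≠ 0)
    (hap : ∀ x, a * x * p = p * x * a) : ∃ z ∈ Subalgebra.center k Q, z * i a = i p := by
  let I : Ideal R :=
    { carrier := {c | ∃ c', ∀ w, c' * w * a = c * w * p}
      add_mem' := by
        rintro c d ⟨c', hc⟩ ⟨d', hd⟩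
        exact ⟨c' + d', fun w => by simp only [add_mul, hc, hd]⟩
      zero_mem' := ⟨0, by simp⟩
      smul_mem' := by
        rintro x c ⟨c', hc⟩
        exact ⟨x * c', fun w => by rw [smul_eq_mul, mul_assoc, mul_assoc, ← mul_assoc c', hc]
                                   simp only [mul_assoc]⟩ }
  have hI2 : I.IsTwoSided := ⟨by
    rintro c y ⟨c', hc⟩
    exact ⟨c' * y, fun w => by rw [mul_assoc c', hc, ← mul_assoc]⟩⟩
  have haI : a ∈ I := ⟨p, fun w => (hap w).symm⟩
  obtain ⟨c, ⟨c', hc⟩, hcr⟩ := h.exists_isRegular I fun hbot => ha (by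
    rw [hbot] at haI
    simpa using haI)
  obtain ⟨u, hu⟩ := hi.isUnit c hcr
  have key : ∀ w, ((u⁻¹ : Qˣ) : Q) * i c' * i w * i a = i w * i p := by
    intro w
    have := congrArg i (hc w)
    simp only [map_mul] at this
    rw [mul_assoc, mul_assoc, ← mul_assoc (i c'), this, ← hu, mul_assoc, ← mul_assoc,
      Units.inv_mul, one_mul]
  refine ⟨((u⁻¹ : Qˣ) : Q) * i c', ?_, by simpa using key 1⟩
  set z := ((u⁻¹ : Qˣ) : Q) * i c'
  refine hi.mem_center_of_commute z fun w => ?_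
  obtain ⟨b, s, hs, hb⟩ := hi.left_fraction (z * i w - i w * z)
  rw [← sub_eq_zero]
  refine (hi.isUnit s hs).mul_right_eq_zero.1 ?_
  rw [hb, map_eq_zero_iff _ hi.injective]
  refine (h.eq_zero_or b a fun v => hi.injective ?_).resolve_right ha
  rw [map_mul, map_mul, ← hb, map_zero, mul_assoc, mul_assoc]
  have : (z * i w - i w * z) * (i v * i a) = 0 := by
    rw [sub_mul, ← mul_assoc, mul_assoc z, ← map_mul, key, ← mul_assoc, mul_assoc (i w) z,
      mul_assoc, mul_assoc, ← mul_assoc z, key, map_mul, mul_assoc, sub_self]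
  rw [this, mul_zero]

theorem IsClassicalQuotientRing.center_isDomain (h : IsPrimeRing R) {i : R →ₐ[k] Q}
    (hi : IsClassicalQuotientRing i) : IsDomain (Subalgebra.center k Q) := by
  have := h.nontrivial
  have : Nontrivial Q := hi.injective.nontrivial
  have : NoZeroDivisors (Subalgebra.center k Q) := by
    refine ⟨fun {x y} hxy => ?_⟩
    obtain ⟨a, s, hs, ha⟩ := hi.left_fraction x.1
    obtain ⟨b, t, ht, hb⟩ := hi.right_fraction y.1
    have hxy' : x.1 * y.1 = 0 := congrArg Subtype.val hxy
    have hcomm := Subalgebra.mem_center_iff.1 y.2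
    have hab : ∀ w, a * w * b = 0 := fun w => hi.injective (by
      rw [map_mul, map_mul, ← ha, ← hb, map_zero]
      calc i s * x.1 * i w * (y.1 * i t) = i s * x.1 * (i w * y.1) * i t := by
            simp only [mul_assoc]
        _ = i s * (x.1 * y.1) * i w * i t := by rw [hcomm (i w)]; simp only [mul_assoc]
        _ = 0 := by rw [hxy', mul_zero, zero_mul, zero_mul])
    rcases h.eq_zero_or a b hab with h0 | h0
    · left
      rw [h0, map_zero] at ha
      exact Subtype.ext ((hi.isUnit s hs).mul_right_eq_zero.1 ha)
    · right
      rw [h0, map_zero] at hb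
      exact Subtype.ext ((hi.isUnit t ht).mul_left_eq_zero.1 hb)
  exact NoZeroDivisors.to_isDomain _

/-- Finitely many central elements of the quotient ring have a common denominator. -/
theorem IsClassicalQuotientRing.exists_common_denominator {i : R →ₐ[k] Q}
    (hi : IsClassicalQuotientRing i) (s : Finset (Subalgebra.center k Q)) :
    ∃ t : R, IsRegular t ∧ ∀ z ∈ s, ∃ r, z.1 * i t = i r := by
  classical
  induction s using Finset.induction_on with
  | empty => exact ⟨1, isRegular_one, by simp⟩
  | insert z s _ ih =>
    obtain ⟨t, ht, hts⟩ := ih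
    obtain ⟨b, t', ht', hb⟩ := hi.right_fraction z.1
    refine ⟨t' * t, ht'.mul ht, fun y hy => ?_⟩
    rcases Finset.mem_insert.1 hy with rfl | hy
    · exact ⟨b * t, by rw [map_mul, map_mul, ← mul_assoc, hb]⟩
    · obtain ⟨r, hr⟩ := hts y hy
      refine ⟨t' * r, ?_⟩
      rw [map_mul, map_mul, ← hr, ← mul_assoc, ← mul_assoc, Subalgebra.mem_center_iff.1 y.2]

end Rational

section Rational

open Cardinal

theorem exists_mem_adjoin_mul_eq_one {k : Type v} [Field k] {Z : Type w} [CommRing Z] [IsDomain Z]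
    [Algebra k Z] {z : Z} (hz : IsAlgebraic k z) (h0 : z ≠ 0) :
    ∃ y ∈ Algebra.adjoin k {z}, z * y = 1 := by
  have hint : Algebra.IsIntegral k (Algebra.adjoin k {z}) :=
    Algebra.IsIntegral.adjoin (by simpa using hz.isIntegral)
  have hfield : IsField (Algebra.adjoin k {z}) :=
    isField_of_isIntegral_of_isField' (Field.toIsField k)
  obtain ⟨y, hy⟩ := hfield.mul_inv_cancel (a := ⟨z, Algebra.self_mem_adjoin_singleton k z⟩)
    fun h => h0 (congrArg Subtype.val h)
  exact ⟨y, y.2, congrArg Subtype.val hy⟩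

variable {k : Type v} [Field k] {R Q : Type u} [Ring R] [Algebra k R] [Ring Q] [Algebra k Q]

/-- The nonzero elements of `V ∩ I` that are central multiples of `v ∈ V` are detected by a single
nonzero element `v t`, because the multipliers arising from the finite-dimensional space `V` generate
a finite extension field of `k`, which has a common denominator `t`. -/
theorem IsClassicalQuotientRing.exists_mem_of_center_mul (h : IsPrimeRing R) {i : R →ₐ[k] Q}
    (hi : IsClassicalQuotientRing i) (halg : Algebra.IsAlgebraic k (Subalgebra.center k Q))
    (V : Submodule k R) [FiniteDimensional k V] (v : R) (hv : v ≠ 0) :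
    ∃ t : R, t ≠ 0 ∧ ∀ I : Ideal R, I.IsTwoSided →
      (∃ p ∈ I, p ∈ V ∧ p ≠ 0 ∧ ∃ z ∈ Subalgebra.center k Q, z * i v = i p) → t ∈ I := by
  have hdom := hi.center_isDomain h
  -- a central element is determined by its product with `i v`
  have hcancel : ∀ z : Subalgebra.center k Q, z.1 * i v = 0 → z = 0 := by
    intro z hz
    obtain ⟨b, s, hs, hb⟩ := hi.left_fraction z.1
    have hb0 : b = 0 := by
      refine (h.eq_zero_or b v fun w => hi.injective ?_).resolve_right hv
      rw [map_mul, map_mul, ← hb, map_zero, mul_assoc (i s), ← Subalgebra.mem_center_iff.1 z.2,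
        mul_assoc, mul_assoc, hz, mul_zero, mul_zero]
    rw [hb0, map_zero] at hb
    exact Subtype.ext ((hi.isUnit s hs).mul_right_eq_zero.1 hb)
  let L : Submodule k (Subalgebra.center k Q) :=
    { carrier := {z | ∃ p ∈ V, z.1 * i v = i p}
      add_mem' := by
        rintro y z ⟨p, hp, hy⟩ ⟨q, hq, hz⟩
        exact ⟨p + q, V.add_mem hp hq, by
          rw [map_add, ← hy, ← hz, ← add_mul]
          rfl⟩
      zero_mem' := ⟨0, V.zero_mem, by simp⟩
      smul_mem' := by
        rintro c z ⟨p, hp, hz⟩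
        exact ⟨c • p, V.smul_mem c hp, by
          rw [map_smul, ← hz, ← smul_mul_assoc]
          rfl⟩ }
  choose g hgV hg using fun z : L => z.2
  have hfin : FiniteDimensional k L := by
    let G : L →ₗ[k] V :=
      { toFun := fun z => ⟨g z, hgV z⟩
        map_add' := fun y z => Subtype.ext (hi.injective (by
          rw [Submodule.coe_add, map_add, ← hg, ← hg, ← hg, ← add_mul]
          rfl))
        map_smul' := fun c z => Subtype.ext (hi.injective (by
          rw [RingHom.id_apply, Submodule.coe_smul, map_smul, ← hg, ← hg, ← smul_mul_assoc]
          rfl)) }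
    refine FiniteDimensional.of_injective G ?_
    rw [injective_iff_map_eq_zero]
    intro z hz
    have h0 : g z = 0 := congrArg Subtype.val hz
    refine Subtype.ext (hcancel z.1 ?_)
    rw [hg, h0, map_zero]
  obtain ⟨s, hs⟩ := (Submodule.fg_iff_finiteDimensional L).2 hfin
  let C := Algebra.adjoin k (s : Set (Subalgebra.center k Q))
  have hC : (Subalgebra.toSubmodule C).FG :=
    fg_adjoin_of_finite s.finite_toSet fun x _ => (halg.isAlgebraic x).isIntegral
  have hLC : ∀ z ∈ L, z ∈ C := by
    intro z hz
    rw [← hs] at hz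
    exact Algebra.span_le_adjoin k _ hz
  obtain ⟨s', hs'⟩ := hC
  obtain ⟨t, ht, hts⟩ := hi.exists_common_denominator s'
  have hden : ∀ z ∈ C, ∃ r, z.1 * i t = i r := by
    intro z hzC
    have hz : z ∈ Submodule.span k (s' : Set (Subalgebra.center k Q)) := by
      rw [hs']
      exact hzC
    clear hzC
    induction hz using Submodule.span_induction with
    | mem z hz => exact hts z hz
    | zero => exact ⟨0, by simp⟩
    | add y z _ _ hy hz =>
      obtain ⟨a, ha⟩ := hy
      obtain ⟨b, hb⟩ := hz
      exact ⟨a + b, by rw [map_add, ← ha, ← hb, ← add_mul]; rfl⟩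
    | smul c z _ hz =>
      obtain ⟨a, ha⟩ := hz
      exact ⟨c • a, by rw [map_smul, ← ha, ← smul_mul_assoc]; rfl⟩
  refine ⟨v * t, fun h0 => hv (ht.right (by simpa using h0)), ?_⟩
  rintro I hI ⟨p, hpI, hpV, hp0, z, hz, hzp⟩
  have hzL : (⟨z, hz⟩ : Subalgebra.center k Q) ∈ L := ⟨p, hpV, hzp⟩
  have hz0 : (⟨z, hz⟩ : Subalgebra.center k Q) ≠ 0 := by
    intro h0
    have hz0 : z = 0 := congrArg Subtype.val h0
    rw [hz0, zero_mul] at hzp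
    exact hp0 (hi.injective (by rw [← hzp, map_zero]))
  obtain ⟨y, hyC, hy⟩ := exists_mem_adjoin_mul_eq_one (halg.isAlgebraic ⟨z, hz⟩) hz0
  have hy' : z * y.1 = 1 := congrArg Subtype.val hy
  obtain ⟨r, hr⟩ := hden y (Algebra.adjoin_le (Set.singleton_subset_iff.2 (hLC _ hzL)) hyC)
  have : p * r = v * t := by
    apply hi.injective
    rw [map_mul, map_mul, ← hr, ← hzp, ← Subalgebra.mem_center_iff.1 hz, mul_assoc, ← mul_assoc z,
      hy', one_mul]
  rw [← this]
  exact I.mul_mem_right r hpI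

/-- If the center of the quotient ring is algebraic, countably many nonzero elements suffice to
detect all two-sided ideals which meet a given finite-dimensional subspace `V`. The proof is by
induction on the dimension: for `v ∈ V` the maps `p ↦ v x p - p x v` kill `v`, and an element `p`
killed by all of them is a central multiple of `v`. -/
theorem IsClassicalQuotientRing.exists_countable_of_finrank [IsNoetherianRing R]
    (h : IsPrimeRing R) {i : R →ₐ[k] Q} (hi : IsClassicalQuotientRing i)
    (halg : Algebra.IsAlgebraic k (Subalgebra.center k Q)) (X : Set R) (hX : X.Countable)
    (hspan : Submodule.span k X = ⊤) (n : ℕ) (V : Submodule k R) [FiniteDimensional k V]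
    (hV : Module.finrank k V = n) :
    ∃ T : Set R, T.Countable ∧ (0 : R) ∉ T ∧ ∀ I : Ideal R, I.IsTwoSided →
      (∃ p ∈ I, p ∈ V ∧ p ≠ 0) → ∃ t ∈ T, t ∈ I := by
  induction n using Nat.strong_induction_on generalizing V with
  | _ n ih =>
  by_cases hbot : V = ⊥
  · refine ⟨∅, Set.countable_empty, by simp, ?_⟩
    rintro I - ⟨p, -, hp, hp0⟩
    rw [hbot] at hp
    exact absurd hp hp0
  obtain ⟨v, hvV, hv⟩ := Submodule.exists_mem_ne_zero_of_ne_bot hbot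
  obtain ⟨t, ht, htI⟩ := hi.exists_mem_of_center_mul h halg V v hv
  let θ : R → R →ₗ[k] R := fun x =>
    LinearMap.mulLeft k (v * x) - LinearMap.mulRight k (x * v)
  have hθ : ∀ x p, θ x p = v * x * p - p * (x * v) := fun x p => rfl
  have hlt : ∀ x, Module.finrank k (V.map (θ x)) < n := by
    intro x
    have h1 := LinearMap.finrank_range_add_finrank_ker ((θ x).domRestrict V)
    rw [LinearMap.range_domRestrict, hV] at h1
    have h2 : 0 < Module.finrank k (LinearMap.ker ((θ x).domRestrict V)) := by
      refine Nat.pos_of_ne_zero fun h0 => hv ?_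
      have h3 : (⟨v, hvV⟩ : V) ∈ LinearMap.ker ((θ x).domRestrict V) := by
        rw [LinearMap.mem_ker]
        change v * x * v - v * (x * v) = 0
        rw [mul_assoc, sub_self]
      rw [Submodule.finrank_eq_zero.1 h0] at h3
      exact congrArg Subtype.val ((Submodule.mem_bot k).1 h3)
    omega
  choose T hTc hT0 hT using fun x => ih _ (hlt x) (V.map (θ x)) rfl
  refine ⟨{t} ∪ ⋃ x ∈ X, T x, (Set.countable_singleton t).union (hX.biUnion fun x _ => hTc x),
    ?_, ?_⟩
  · simp only [Set.mem_union, Set.mem_singleton_iff, Set.mem_iUnion, not_or, not_exists]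
    exact ⟨ht.symm, fun x _ => hT0 x⟩
  · rintro I hI ⟨p, hpI, hpV, hp0⟩
    by_cases hall : ∀ x ∈ X, θ x p = 0
    · refine ⟨t, Or.inl rfl, htI I hI ⟨p, hpI, hpV, hp0, ?_⟩⟩
      refine hi.exists_center_mul_eq h hv fun x => ?_
      have hx : x ∈ Submodule.span k X := hspan ▸ Submodule.mem_top
      rw [← sub_eq_zero, mul_assoc p]
      induction hx using Submodule.span_induction with
      | mem x hx => exact hall x hx
      | zero => simp
      | add x y _ _ hx hy =>
        rw [mul_add, add_mul, add_mul, mul_add, add_sub_add_comm, hx, hy, add_zero]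
      | smul c x _ hx =>
        rw [mul_smul_comm, smul_mul_assoc, smul_mul_assoc, mul_smul_comm, ← smul_sub, hx, smul_zero]
    · push Not at hall
      obtain ⟨x, hxX, hx⟩ := hall
      have hmem : θ x p ∈ I := by
        rw [hθ]
        exact I.sub_mem (I.mul_mem_left _ hpI) (I.mul_mem_right _ hpI)
      obtain ⟨t', ht', ht'I⟩ := hT x I hI ⟨θ x p, hmem, ⟨p, hpV, rfl⟩, hx⟩
      exact ⟨t', Or.inr (Set.mem_biUnion hxX ht'), ht'I⟩

/-- If the center of the quotient ring of a prime noetherian algebra of countable dimension is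
algebraic over the base field, then some countable set of nonzero elements meets every nonzero
two-sided ideal. -/
theorem IsClassicalQuotientRing.exists_countable_meeting [IsNoetherianRing R]
    (h : IsPrimeRing R) {i : R →ₐ[k] Q} (hi : IsClassicalQuotientRing i)
    (halg : Algebra.IsAlgebraic k (Subalgebra.center k Q)) (hR : Module.rank k R ≤ ℵ₀) :
    ∃ T : Set R, T.Countable ∧ (0 : R) ∉ T ∧ ∀ I : Ideal R, I.IsTwoSided → I ≠ ⊥ →
      ∃ t ∈ T, t ∈ I := by
  let b := Module.Basis.ofVectorSpace k R
  have hX : (Set.range b).Countable := by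
    rw [← Cardinal.le_aleph0_iff_set_countable, Cardinal.mk_range_eq b b.injective]
    rwa [b.mk_eq_rank'']
  have hcount : Countable (Set.range b) := hX.to_subtype
  have key : ∀ s : Finset (Set.range b), ∃ T : Set R, T.Countable ∧ (0 : R) ∉ T ∧
      ∀ I : Ideal R, I.IsTwoSided →
        (∃ p ∈ I, p ∈ Submodule.span k (Subtype.val '' (s : Set (Set.range b))) ∧ p ≠ 0) →
        ∃ t ∈ T, t ∈ I := fun s => by
    have := FiniteDimensional.span_of_finite k (s.finite_toSet.image Subtype.val)
    exact hi.exists_countable_of_finrank h halg (Set.range b) hX b.span_eq _ _ rfl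
  choose T hTc hT0 hT using key
  refine ⟨⋃ s, T s, Set.countable_iUnion hTc, by simpa using hT0, fun I hI hI0 => ?_⟩
  obtain ⟨p, hpI, hp0⟩ := Submodule.exists_mem_ne_zero_of_ne_bot hI0
  obtain ⟨s, hsub, hps⟩ := Submodule.mem_span_finite_of_mem_span
    (show p ∈ Submodule.span k (Set.range b) from b.span_eq ▸ Submodule.mem_top)
  classical
  obtain ⟨t, ht, htI⟩ := hT (s.subtype (· ∈ Set.range b)) I hI ⟨p, hpI, by
    convert hps using 2
    ext x
    simp only [Set.mem_image, Finset.mem_coe, Finset.mem_subtype]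
    exact ⟨fun ⟨y, hy, hyx⟩ => hyx ▸ hy, fun hx => ⟨⟨x, hsub hx⟩, hx, rfl⟩⟩, hp0⟩
  exact ⟨t, Set.mem_iUnion.2 ⟨_, ht⟩, htI⟩

theorem finite_primesAbove_of_mem [IsNoetherianRing R] (P : PrimeSpec R) (t : R)
    (ht : t ∉ P.ideal) : {Q ∈ primesAbove P | t ∈ Q.ideal}.Finite := by
  let I : Ideal R := sInf {J | J.IsTwoSided ∧ t ∈ J}
  have hI : I.IsTwoSided := ⟨fun {a} b ha => by
    rw [Submodule.mem_sInf] at ha ⊢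
    intro J hJ
    have := hJ.1
    exact Ideal.mul_mem_right b J (ha J hJ)⟩
  have htI : t ∈ I := Submodule.mem_sInf.2 fun J hJ => hJ.2
  refine (finite_primesAbove_of_le P I fun h => ht (h htI)).subset ?_
  rintro Q ⟨hQ, htQ⟩
  exact ⟨hQ, sInf_le ⟨inferInstance, htQ⟩⟩

theorem IsRational.countable_primesAbove [IsNoetherianRing R] (hR : Module.rank k R ≤ ℵ₀)
    {P : PrimeSpec R} (hP : IsRational k P) : (primesAbove P).Countable := by
  obtain ⟨Q, _, _, i, hi, halg⟩ := hP
  have := isNoetherianRing_quotient P.ideal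
  obtain ⟨T, hTc, hT0, hT⟩ := hi.exists_countable_meeting P.isPrime.isPrimeRing_quotient halg
    (rank_quotient_le hR P.ideal)
  refine Set.Countable.mono (s₂ := ⋃ t ∈ T, {Q ∈ primesAbove P | t.out ∈ Q.ideal}) ?_
    (hTc.biUnion fun t ht => (finite_primesAbove_of_mem P _ fun hmem => hT0 ?_).countable)
  · intro Q' hQ'
    have hle : P.ideal ≤ Q'.ideal := hQ'.1.le
    have h2 : (Q'.ideal.map (Ideal.Quotient.mk P.ideal)).IsTwoSided := by
      refine ⟨fun {a} b ha => ?_⟩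
      rw [Ideal.mem_map_iff_of_surjective _ Ideal.Quotient.mk_surjective] at ha ⊢
      obtain ⟨a, ha, rfl⟩ := ha
      obtain ⟨b, rfl⟩ := Ideal.Quotient.mk_surjective b
      exact ⟨a * b, Q'.ideal.mul_mem_right b ha, map_mul _ _ _⟩
    obtain ⟨t, ht, htQ⟩ := hT _ h2 fun hbot => hQ'.1.not_ge (show Q'.ideal ≤ P.ideal by
      rw [← Ideal.mk_ker (I := P.ideal)]
      exact Ideal.map_eq_bot_iff_le_ker _ |>.1 hbot)
    refine Set.mem_biUnion ht ⟨hQ', ?_⟩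
    obtain ⟨a, ha, hat⟩ := (Ideal.mem_map_iff_of_surjective _ Ideal.Quotient.mk_surjective).1 htQ
    have h3 : t.out - a ∈ P.ideal := by
      rw [← Ideal.Quotient.eq_zero_iff_mem, map_sub, hat, sub_eq_zero]
      exact Quotient.out_eq _
    simpa using add_mem (hle h3) ha
  · rwa [← Ideal.Quotient.eq_zero_iff_mem.2 hmem, show Ideal.Quotient.mk P.ideal t.out = t from
      Quotient.out_eq _]

end Rational

/-! ### Multilinear identities -/

section Multilinear

variable {k : Type v} [Field k]

/-- The inclusion-exclusion sum over the sets containing a proper subset vanishes. -/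
theorem sum_neg_one_pow_card_of_ne_univ {ι : Type*} [Fintype ι] [DecidableEq ι] {R : Finset ι}
    {a : ι} (ha : a ∉ R) :
    ∑ T : Finset ι, (if R ⊆ T then (-1 : k) ^ T.card else 0) = 0 := by
  refine Finset.sum_involution (fun T _ => if a ∈ T then T.erase a else insert a T) ?_ ?_ ?_ ?_
  · intro T _
    by_cases haT : a ∈ T
    · have h1 : R ⊆ T.erase a ↔ R ⊆ T := by
        rw [Finset.subset_erase]
        exact and_iff_left ha
      have h2 := Finset.card_erase_add_one haT
      simp only [haT, if_true, h1]
      split_ifs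
      · rw [← h2, pow_succ]
        ring
      · simp
    · have h1 : R ⊆ insert a T ↔ R ⊆ T := Finset.subset_insert_iff_of_notMem ha
      simp only [haT, if_false, h1]
      split_ifs
      · rw [Finset.card_insert_of_notMem haT, pow_succ]
        ring
      · simp
  · intro T _ _
    by_cases haT : a ∈ T
    · simp [haT]
    · simp [haT]
  · intro T _
    exact Finset.mem_univ _
  · intro T _
    by_cases haT : a ∈ T
    · simp [haT, Finset.insert_erase]
    · simp [haT]

/-- Evaluating a word on sums of the `y j` and forming the inclusion-exclusion sum over the sets of
summands leaves only the terms in which all `y j` occur. -/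
theorem sum_neg_one_pow_card_smul_prod {D : Type*} [Ring D] [Algebra k D] {d m : ℕ}
    (W : Fin d → ℕ) (U : Fin m → ℕ) (y : Fin d → D) :
    ∑ T : Finset (Fin d), (-1 : k) ^ T.card •
      (List.ofFn fun p => ∑ j ∈ T with W j = U p, y j).prod =
    ∑ π : Fin m → Fin d, if W ∘ π = U then
      (∑ T : Finset (Fin d), (if Finset.univ.image π ⊆ T then (-1 : k) ^ T.card else 0)) •
        (List.ofFn fun p => y (π p)).prod else 0 := by
  have h1 : ∀ T : Finset (Fin d), (List.ofFn fun p => ∑ j ∈ T with W j = U p, y j).prod =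
      ∑ π : Fin m → Fin d, if Finset.univ.image π ⊆ T ∧ W ∘ π = U then
        (List.ofFn fun p => y (π p)).prod else 0 := by
    intro T
    have := (MultilinearMap.mkPiAlgebraFin k m D).map_sum_finset (fun _ j => y j)
      (fun p => T.filter fun j => W j = U p)
    simp only [MultilinearMap.mkPiAlgebraFin_apply] at this
    rw [this, ← Finset.sum_filter]
    refine Finset.sum_congr ?_ fun _ _ => rfl
    ext π
    simp only [Fintype.mem_piFinset, Finset.mem_filter, Finset.mem_univ, true_and,
      Finset.image_subset_iff, forall_true_left, funext_iff, Function.comp_apply, forall_and]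
  simp only [h1, Finset.smul_sum]
  rw [Finset.sum_comm]
  refine Finset.sum_congr rfl fun π _ => ?_
  by_cases hπ : W ∘ π = U
  · simp only [hπ, and_true, if_true, Finset.sum_smul]
    refine Finset.sum_congr rfl fun T _ => ?_
    split_ifs <;> simp
  · simp [hπ]

theorem sum_neg_one_pow_card_smul_word {D : Type*} [Ring D] [Algebra k D] {d : ℕ}
    (W : Fin d → ℕ) (u : List ℕ) (hu : u.length ≤ d) (y : Fin d → D) :
    ∑ T : Finset (Fin d), (-1 : k) ^ T.card • (u.map fun i => ∑ j ∈ T with W j = i, y j).prod =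
    (-1 : k) ^ d • ∑ π : Equiv.Perm (Fin d), if List.ofFn (W ∘ π) = u then
      (List.ofFn fun p => y (π p)).prod else 0 := by
  obtain ⟨m, hm⟩ : ∃ m, m = u.length := ⟨_, rfl⟩
  obtain ⟨U, rfl⟩ : ∃ U : Fin m → ℕ, u = List.ofFn U := ⟨fun p => u.get (p.cast hm), by
    subst hm
    exact (List.ofFn_get u).symm⟩
  simp only [List.map_ofFn]
  have h0 := sum_neg_one_pow_card_smul_prod (k := k) W U y
  refine h0.trans ?_
  rw [List.length_ofFn] at hu
  rcases hu.lt_or_eq with hlt | rfl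
  · -- a map from fewer than `d` positions misses some index
    rw [Finset.sum_eq_zero, Finset.sum_eq_zero, smul_zero]
    · intro π _
      rw [if_neg]
      intro h
      have := congrArg List.length h
      simp only [List.length_ofFn] at this
      omega
    · intro π _
      split_ifs with hπ
      · obtain ⟨a, ha⟩ : ∃ a, a ∉ Finset.univ.image π := by
          by_contra! hall
          have h2 := Finset.card_le_card (show Finset.univ ⊆ Finset.univ.image π from
            fun a _ => hall a)
          have h3 := Finset.card_image_le (s := Finset.univ) (f := π)
          simp at h2 h3
          omega
        rw [sum_neg_one_pow_card_of_ne_univ ha, zero_smul]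
      · rfl
  · rw [Finset.smul_sum]
    symm
    refine Finset.sum_of_injOn (fun π : Equiv.Perm (Fin m) => (π : Fin m → Fin m)) ?_ ?_ ?_ ?_
    · exact fun π _ σ _ h => Equiv.coe_fn_injective h
    · simp
    · intro π _ hπ
      split_ifs with hW
      · obtain ⟨a, ha⟩ : ∃ a, a ∉ Finset.univ.image π := by
          by_contra! hall
          have hs : Function.Surjective π := fun a => by simpa using hall a
          exact hπ ⟨Equiv.ofBijective π (Finite.surjective_iff_bijective.1 hs), by simp, rfl⟩
        rw [sum_neg_one_pow_card_of_ne_univ ha, zero_smul]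
      · rfl
    · intro π _
      have h1 : Finset.univ.image (π : Fin m → Fin m) = Finset.univ :=
        Finset.image_univ_equiv π
      simp only [List.ofFn_inj, h1, Finset.univ_subset_iff, Finset.sum_ite_eq', Finset.mem_univ,
        if_true, Finset.card_univ, Fintype.card_fin, smul_ite, smul_zero]

theorem freeAlgebra_lift_eq_sum {D : Type*} [Ring D] [Algebra k D] (x : ℕ → D)
    (f : FreeAlgebra k ℕ) :
    FreeAlgebra.lift k x f = (FreeAlgebra.equivMonoidAlgebraFreeMonoid f).coeff.sum
      fun u c => c • ((FreeMonoid.toList u).map x).prod := by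
  have h1 : FreeAlgebra.lift k x = (MonoidAlgebra.lift k D (FreeMonoid ℕ) (FreeMonoid.lift x)).comp
      (FreeAlgebra.equivMonoidAlgebraFreeMonoid (R := k) (X := ℕ)).toAlgHom := by
    ext i
    simp [FreeAlgebra.equivMonoidAlgebraFreeMonoid]
  rw [h1]
  refine (MonoidAlgebra.lift_apply (R := k) (FreeMonoid.lift x)
    (FreeAlgebra.equivMonoidAlgebraFreeMonoid f)).trans (Finsupp.sum_congr fun u _ => ?_)
  rw [FreeMonoid.lift_apply]

/-- Every PI algebra satisfies a multilinear identity with nonzero leading coefficient. -/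
theorem IsPI.exists_multilinear {D : Type u} [Ring D] [Algebra k D] (h : IsPI k D) :
    ∃ (d : ℕ) (c : Equiv.Perm (Fin d) → k), c 1 ≠ 0 ∧
      ∀ y : Fin d → D, ∑ π, c π • (List.ofFn fun p => y (π p)).prod = 0 := by
  classical
  obtain ⟨f, hf, hid⟩ := h
  set F : FreeMonoid ℕ →₀ k := (FreeAlgebra.equivMonoidAlgebraFreeMonoid f).coeff with hF
  have hF0 : F ≠ 0 := by
    intro h0
    refine hf (FreeAlgebra.equivMonoidAlgebraFreeMonoid.injective ?_)
    rw [map_zero]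
    exact MonoidAlgebra.coeff_injective h0
  -- a word of maximal length in the support of the given identity
  obtain ⟨w, hw, hmax⟩ := Finset.exists_max_image F.support (fun u => (FreeMonoid.toList u).length)
    (Finsupp.support_nonempty_iff.2 hF0)
  obtain ⟨d, hd⟩ : ∃ d, d = (FreeMonoid.toList w).length := ⟨_, rfl⟩
  obtain ⟨W, hW⟩ : ∃ W : Fin d → ℕ, FreeMonoid.toList w = List.ofFn W :=
    ⟨fun p => (FreeMonoid.toList w).get (p.cast hd), by
      subst hd
      exact (List.ofFn_get _).symm⟩
  have hlen : ∀ u ∈ F.support, (FreeMonoid.toList u).length ≤ d := fun u hu => hd ▸ hmax u hu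
  refine ⟨d, fun π => F (FreeMonoid.ofList (List.ofFn (W ∘ π))), ?_, fun y => ?_⟩
  · change F (FreeMonoid.ofList (List.ofFn (W ∘ (1 : Equiv.Perm (Fin d))))) ≠ 0
    rw [Equiv.Perm.coe_one, Function.comp_id, ← hW, FreeMonoid.ofList_toList]
    exact Finsupp.mem_support_iff.1 hw
  have h1 : ∑ T : Finset (Fin d), (-1 : k) ^ T.card •
      FreeAlgebra.lift k (fun i => ∑ j ∈ T with W j = i, y j) f = 0 :=
    Finset.sum_eq_zero fun T _ => by rw [hid, smul_zero]
  simp only [freeAlgebra_lift_eq_sum, ← hF, Finsupp.sum, Finset.smul_sum] at h1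
  rw [Finset.sum_comm] at h1
  have h2 : ∀ u ∈ F.support, ∑ T : Finset (Fin d), (-1 : k) ^ T.card • F u •
      ((FreeMonoid.toList u).map fun i => ∑ j ∈ T with W j = i, y j).prod =
      (-1 : k) ^ d • ∑ π : Equiv.Perm (Fin d),
        if FreeMonoid.ofList (List.ofFn (W ∘ π)) = u then
          F u • (List.ofFn fun p => y (π p)).prod else 0 := by
    intro u hu
    have h3 := sum_neg_one_pow_card_smul_word (k := k) W (FreeMonoid.toList u) (hlen u hu) y
    simp only [smul_comm _ (F u), ← Finset.smul_sum]
    rw [h3, smul_comm, Finset.smul_sum]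
    congr 1
    refine Finset.sum_congr rfl fun π _ => ?_
    rw [smul_ite, smul_zero]
    exact if_congr Iff.rfl rfl rfl
  rw [Finset.sum_congr rfl h2, ← Finset.smul_sum, Finset.sum_comm] at h1
  have h4 := (smul_eq_zero.1 h1).resolve_left (pow_ne_zero d (neg_ne_zero.2 one_ne_zero))
  rw [← h4]
  refine Finset.sum_congr rfl fun π _ => ?_
  rw [Finset.sum_ite_eq]
  split_ifs with hmem
  · rfl
  · change F (FreeMonoid.ofList (List.ofFn (W ∘ π))) • _ = _
    rw [Finsupp.notMem_support_iff.1 hmem, zero_smul]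

end Multilinear

/-! ### Kaplansky's theorem for division rings -/

section Kaplansky

variable {k : Type v} [Field k]

/-- A multilinear identity of `D` also holds on the span of products `l * ρ d`, where the `l` commute
with each other and with the image of `D`. -/
theorem multilinear_identity_span {D W : Type*} [Ring D] [Algebra k D] [Ring W] [Algebra k W]
    (ρ : D →ₐ[k] W) (Λ : Submonoid W) (hΛ : ∀ l ∈ Λ, ∀ l' ∈ Λ, Commute l l')
    (hρ : ∀ l ∈ Λ, ∀ x, Commute l (ρ x)) {d : ℕ} (c : Equiv.Perm (Fin d) → k)
    (hid : ∀ y : Fin d → D, ∑ π, c π • (List.ofFn fun p => y (π p)).prod = 0)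
    (e : Fin d → W) (he : ∀ p, e p ∈ Submodule.span k {w | ∃ l ∈ Λ, ∃ x, w = l * ρ x}) :
    ∑ π, c π • (List.ofFn fun p => e (π p)).prod = 0 := by
  classical
  let M : MultilinearMap k (fun _ : Fin d => W) W :=
    ∑ π : Equiv.Perm (Fin d), c π • (MultilinearMap.mkPiAlgebraFin k d W).domDomCongr π
  have hM : ∀ e, M e = ∑ π, c π • (List.ofFn fun p => e (π p)).prod := by
    intro e
    simp [M]
  have hprod : ∀ (n : ℕ) (l : Fin n → W) (x : Fin n → D), (∀ p, l p ∈ Λ) →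
      (List.ofFn fun p => l p * ρ (x p)).prod = (List.ofFn l).prod * ρ (List.ofFn x).prod := by
    intro n
    induction n with
    | zero => simp
    | succ n ih =>
      intro l x hl
      have hmem : (List.ofFn fun p : Fin n => l p.succ).prod ∈ Λ :=
        Λ.list_prod_mem fun w hw => by
          obtain ⟨p, rfl⟩ := (List.mem_ofFn' _ _).1 hw
          exact hl _
      rw [List.ofFn_succ, List.prod_cons, ih _ _ fun p => hl _, List.ofFn_succ, List.prod_cons,
        List.ofFn_succ, List.prod_cons, map_mul, mul_assoc, mul_assoc, ← mul_assoc (ρ (x 0)),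
        ← (hρ _ hmem _).eq, mul_assoc]
  have hcomm : ∀ (l : Fin d → W) (π : Equiv.Perm (Fin d)), (∀ p, l p ∈ Λ) →
      (List.ofFn fun p => l (π p)).prod = (List.ofFn l).prod := by
    intro l π hl
    refine List.Perm.prod_eq' ?_ ?_
    · have := Equiv.Perm.ofFn_comp_perm π l
      exact this
    · refine List.pairwise_iff_forall_sublist.2 fun {a b} hab => ?_
      have h1 := hab.subset
      obtain ⟨p, rfl⟩ := (List.mem_ofFn' _ _).1 (h1 (by simp : a ∈ [a, b]))
      obtain ⟨q, rfl⟩ := (List.mem_ofFn' _ _).1 (h1 (by simp : b ∈ [_, b]))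
      exact hΛ _ (hl _) _ (hl _)
  have hpure : ∀ e : Fin d → W, (∀ p, ∃ l ∈ Λ, ∃ x, e p = l * ρ x) → M e = 0 := by
    intro e he
    choose l hl x hx using he
    obtain rfl : e = fun p => l p * ρ (x p) := funext hx
    rw [hM]
    have h1 : ∀ π : Equiv.Perm (Fin d), c π • (List.ofFn fun p => l (π p) * ρ (x (π p))).prod =
        (List.ofFn l).prod * ρ (c π • (List.ofFn fun p => x (π p)).prod) := by
      intro π
      rw [hprod d (fun p => l (π p)) (fun p => x (π p)) fun p => hl _, hcomm l π hl, map_smul,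
        mul_smul_comm]
    rw [Finset.sum_congr rfl fun π _ => h1 π, ← Finset.mul_sum, ← map_sum, hid, map_zero, mul_zero]
  -- by multilinearity the arguments are extended to the span one after the other
  have hstep : ∀ s : Finset (Fin d), ∀ e : Fin d → W,
      (∀ p ∈ s, e p ∈ Submodule.span k {w | ∃ l ∈ Λ, ∃ x, w = l * ρ x}) →
      (∀ p ∉ s, ∃ l ∈ Λ, ∃ x, e p = l * ρ x) → M e = 0 := by
    intro s
    induction s using Finset.induction_on with
    | empty => exact fun e _ h => hpure e fun p => h p (Finset.notMem_empty p)
    | insert a s ha ih =>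
      intro e h1 h2
      have h3 : ∀ w ∈ Submodule.span k {w | ∃ l ∈ Λ, ∃ x, w = l * ρ x},
          M (Function.update e a w) = 0 := by
        intro w hw
        induction hw using Submodule.span_induction with
        | mem w hw =>
          refine ih _ (fun p hp => ?_) fun p hp => ?_
          · rw [Function.update_of_ne (by rintro rfl; exact ha hp)]
            exact h1 p (Finset.mem_insert_of_mem hp)
          · by_cases hpa : p = a
            · subst hpa
              rw [Function.update_self]
              exact hw
            · rw [Function.update_of_ne hpa]
              exact h2 p (by simp [hpa, hp])
        | zero => rw [MultilinearMap.map_update_zero]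
        | add w w' _ _ hw hw' => rw [MultilinearMap.map_update_add, hw, hw', add_zero]
        | smul r w _ hw => rw [MultilinearMap.map_update_smul, hw, smul_zero]
      have := h3 (e a) (h1 a (Finset.mem_insert_self _ _))
      rwa [Function.update_eq_self] at this
  rw [← hM]
  exact hstep Finset.univ e (fun p _ => he p) fun p hp => absurd (Finset.mem_univ p) hp

/-- For elements `d i` of a division ring linearly independent over the center, `∑ c i x d i`
vanishes for all `x` only if all `c i` vanish. -/
theorem eq_zero_of_sum_mul_mul_eq_zero {D : Type*} [DivisionRing D] {ι : Type*} [Fintype ι]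
    (b : ι → D) (hb : LinearIndependent (Subring.center D) b) (c : ι → D)
    (hc : ∀ x, ∑ i, c i * x * b i = 0) : ∀ i, c i = 0 := by
  classical
  obtain ⟨n, hn⟩ : ∃ n, (Finset.univ.filter fun i => c i ≠ 0).card = n := ⟨_, rfl⟩
  induction n using Nat.strong_induction_on generalizing c with
  | _ n ih =>
  by_contra! hne
  obtain ⟨i₀, hi₀⟩ := hne
  let c' : ι → D := fun i => (c i₀)⁻¹ * c i
  have hc' : ∀ x, ∑ i, c' i * x * b i = 0 := by
    intro x
    have := congrArg ((c i₀)⁻¹ * ·) (hc x)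
    simpa [Finset.mul_sum, mul_assoc, c'] using this
  have hc'0 : c' i₀ = 1 := inv_mul_cancel₀ hi₀
  have hcent : ∀ i, c' i ∈ Subring.center D := by
    intro i
    rw [Subring.mem_center_iff]
    intro y
    rw [← sub_eq_zero]
    refine ih _ ?_ (fun i => y * c' i - c' i * y) (fun x => ?_) rfl i
    · rw [← hn]
      refine Finset.card_lt_card (Finset.ssubset_iff_of_subset ?_ |>.2 ⟨i₀, by simpa using hi₀, ?_⟩)
      · intro i hi
        simp only [Finset.mem_filter, Finset.mem_univ, true_and] at hi ⊢
        intro h0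
        simp [c', h0] at hi
      · simp [hc'0]
    · have h1 := congrArg (y * ·) (hc' x)
      have h2 := hc' (y * x)
      simp only [Finset.mul_sum, mul_zero] at h1
      simp only [sub_mul, Finset.sum_sub_distrib]
      simp only [mul_assoc] at h1 h2 ⊢
      rw [h1, h2, sub_zero]
  have h1 := Fintype.linearIndependent_iff.1 hb (fun i => ⟨c' i, hcent i⟩) (by
    have := hc' 1
    simpa [Subring.smul_def] using this) i₀
  rw [Subtype.ext_iff] at h1
  simp [hc'0] at h1

end Kaplansky

section Kaplansky

variable {k : Type v} [Field k]

/-- A maximal commutative subalgebra of `D`, described as a self-centralizing subalgebra. -/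
theorem exists_self_centralizing (k : Type v) [Field k] (D : Type u) [Ring D] [Algebra k D] :
    ∃ L : Subalgebra k D, (∀ x ∈ L, ∀ y ∈ L, x * y = y * x) ∧
      ∀ x, (∀ y ∈ L, y * x = x * y) → x ∈ L := by
  obtain ⟨S, hS⟩ := zorn_subset {S : Set D | ∀ x ∈ S, ∀ y ∈ S, x * y = y * x} (by
    intro c hc hchain
    refine ⟨⋃₀ c, ?_, fun s hs => Set.subset_sUnion_of_mem hs⟩
    rintro x ⟨s, hs, hxs⟩ y ⟨t, ht, hyt⟩
    rcases hchain.total hs ht with h | h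
    · exact hc ht x (h hxs) y hyt
    · exact hc hs x hxs y (h hyt))
  have hmem : ∀ x, (∀ y ∈ S, y * x = x * y) → x ∈ S := by
    intro x hx
    have h1 : insert x S ∈ {S : Set D | ∀ x ∈ S, ∀ y ∈ S, x * y = y * x} := by
      rintro y (rfl | hy) z (rfl | hz)
      · rfl
      · exact (hx z hz).symm
      · exact hx y hy
      · exact hS.1 y hy z hz
    exact hS.2 h1 (Set.subset_insert x S) (Set.mem_insert x S)
  have hL : ∀ x, x ∈ Subalgebra.centralizer k S ↔ x ∈ S := fun x => by
    rw [Subalgebra.mem_centralizer_iff]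
    exact ⟨hmem x, fun hx y hy => hS.1 y hy x hx⟩
  refine ⟨Subalgebra.centralizer k S, fun x hx y hy => ?_, fun x hx => (hL x).2 (hmem x ?_)⟩
  · exact hS.1 x ((hL x).1 hx) y ((hL y).1 hy)
  · exact fun y hy => hx y ((hL y).2 hy)

variable {D : Type u} [DivisionRing D] [Algebra k D]

/-- Density of the ring generated by the left multiplications with elements of a self-centralizing
subalgebra `L` and all right multiplications: it contains, up to finitely many vectors, every
`L`-linear map. -/
theorem exists_span_mul_apply_eq (L : Subalgebra k D)
    (hself : ∀ x, (∀ y ∈ L, y * x = x * y) → x ∈ L) (f : D →ₗ[L] D) (s : Finset D) :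
    ∃ e ∈ Submodule.span k {w : Module.End k D | ∃ l ∈ L, ∃ x,
      w = LinearMap.mulLeft k l * LinearMap.mulRight k x}, ∀ y ∈ s, f y = e y := by
  let P : Submonoid (Module.End k D) :=
    { carrier := {w | ∃ l ∈ L, ∃ x, w = LinearMap.mulLeft k l * LinearMap.mulRight k x}
      one_mem' := ⟨1, L.one_mem, 1, by ext; simp⟩
      mul_mem' := by
        rintro _ _ ⟨l, hl, x, rfl⟩ ⟨l', hl', x', rfl⟩
        exact ⟨l * l', L.mul_mem hl hl', x' * x, by ext; simp [mul_assoc]⟩ }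
  let E : Subalgebra k (Module.End k D) := Algebra.adjoin k (P : Set (Module.End k D))
  have hPE : ∀ l ∈ L, ∀ x, LinearMap.mulLeft k l * LinearMap.mulRight k x ∈ E := fun l hl x =>
    Algebra.subset_adjoin ⟨l, hl, x, rfl⟩
  have hsimple : IsSimpleModule E D := by
    rw [isSimpleModule_iff_toSpanSingleton_surjective]
    refine ⟨inferInstance, fun x hx y => ⟨⟨_, hPE 1 L.one_mem (x⁻¹ * y)⟩, ?_⟩⟩
    change 1 * (x * (x⁻¹ * y)) = y
    rw [one_mul, mul_inv_cancel_left₀ hx]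
  have hend : ∀ φ : Module.End E D, φ 1 ∈ L ∧ ∀ x, φ x = φ 1 * x := by
    intro φ
    have h1 : ∀ x, φ x = φ 1 * x := by
      intro x
      have := φ.map_smul ⟨_, hPE 1 L.one_mem x⟩ 1
      change φ (1 * (1 * x)) = 1 * (φ 1 * x) at this
      simpa using this
    refine ⟨hself _ fun l hl => ?_, h1⟩
    have := φ.map_smul ⟨_, hPE l hl 1⟩ 1
    change φ (l * (1 * 1)) = l * (φ 1 * 1) at this
    rw [mul_one, mul_one, mul_one, h1] at this
    exact this.symm
  let F : Module.End (Module.End E D) D :=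
    { toFun := f
      map_add' := f.map_add
      map_smul' := fun φ x => by
        rw [RingHom.id_apply, Module.End.smul_def, Module.End.smul_def, (hend φ).2,
          (hend φ).2 (f x)]
        exact f.map_smul ⟨φ 1, (hend φ).1⟩ x }
  obtain ⟨e, he⟩ := jacobson_density (R := E) (M := D) F s
  refine ⟨e.1, ?_, he⟩
  have h2 : e.1 ∈ Subalgebra.toSubmodule E := e.2
  rw [Algebra.adjoin_eq_span, Submonoid.closure_eq] at h2
  exact h2

/-- If `e p` maps `v p` to `v (p + 1)` and kills the other `v q`, then a product of the `e p` is
nonzero on `v q` only if it is taken over consecutive indices beginning at `q`. -/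
theorem list_prod_shift_apply {W : Type*} [AddCommGroup W] [Module k W] {d : ℕ}
    (v : Fin (d + 1) → W) (hv : ∀ q, v q ≠ 0) (e : Fin d → Module.End k W)
    (he : ∀ p q, e p (v q) = if q = p.castSucc then v p.succ else 0) (l : List (Fin d))
    (q : Fin (d + 1)) :
    ((l.map fun p => MulOpposite.op (e p)).prod.unop (v q) = 0 ↔
      l.map Fin.val ≠ List.range' q l.length) := by
  induction l generalizing q with
  | nil => simpa using hv q
  | cons p l ih =>
    rw [List.map_cons, List.prod_cons, MulOpposite.unop_mul, MulOpposite.unop_op,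
      Module.End.mul_apply, he]
    split_ifs with h
    · rw [ih, h]
      simp [List.range'_succ]
    · rw [map_zero, List.map_cons, List.length_cons, List.range'_succ]
      refine iff_of_true rfl fun h' => h ?_
      exact Fin.ext (List.cons.inj h').1.symm

/-- A division ring `D` with a multilinear identity of degree `d` has dimension at most `d` over a
self-centralizing subalgebra `L`: from `d + 1` independent vectors one obtains shifts `f p`, and by
density the identity holds for them, although it has a single nonzero term on the first vector. -/
theorem false_of_multilinear_identity (L : Subalgebra k D)
    (hcomm : ∀ x ∈ L, ∀ y ∈ L, x * y = y * x) (hself : ∀ x, (∀ y ∈ L, y * x = x * y) → x ∈ L)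
    {d : ℕ} (c : Equiv.Perm (Fin d) → k) (hc : c 1 ≠ 0)
    (hid : ∀ y : Fin d → D, ∑ π, c π • (List.ofFn fun p => y (π p)).prod = 0)
    (v : Fin (d + 1) → D) (f : Fin d → D →ₗ[L] D) (hv : ∀ q, v q ≠ 0)
    (hf : ∀ p q, f p (v q) = if q = p.castSucc then v p.succ else 0) : False := by
  classical
  choose e he hef using fun p =>
    exists_span_mul_apply_eq L hself (f p) (Finset.univ.image v)
  have hev : ∀ p q, e p (v q) = if q = p.castSucc then v p.succ else 0 := fun p q => by
    rw [← hef p _ (Finset.mem_image_of_mem v (Finset.mem_univ q)), hf]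
  let ρ : D →ₐ[k] (Module.End k D)ᵐᵒᵖ :=
    { toFun := fun x => MulOpposite.op (LinearMap.mulRight k x)
      map_one' := by simp; rfl
      map_zero' := by simp
      map_add' := fun x y => MulOpposite.unop_injective (by ext; simp [mul_add])
      map_mul' := fun x y => MulOpposite.unop_injective (by ext; simp [mul_assoc])
      commutes' := fun r => MulOpposite.unop_injective (by
        ext
        simp [Algebra.algebraMap_eq_smul_one]) }
  have hρ : ∀ x, ρ x = MulOpposite.op (LinearMap.mulRight k x) := fun x => rfl
  let Λ : Submonoid (Module.End k D)ᵐᵒᵖ :=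
    { carrier := {w | ∃ l ∈ L, w = MulOpposite.op (LinearMap.mulLeft k l)}
      one_mem' := ⟨1, L.one_mem, by simp; rfl⟩
      mul_mem' := by
        rintro _ _ ⟨l, hl, rfl⟩ ⟨l', hl', rfl⟩
        exact ⟨l' * l, L.mul_mem hl' hl, MulOpposite.unop_injective (by ext; simp)⟩ }
  have key := multilinear_identity_span ρ Λ (by
      rintro _ ⟨l, hl, rfl⟩ _ ⟨l', hl', rfl⟩
      refine MulOpposite.unop_injective (LinearMap.ext fun x => ?_)
      simp [← mul_assoc, hcomm l hl l' hl']) (by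
      rintro _ ⟨l, hl, rfl⟩ x
      refine MulOpposite.unop_injective (LinearMap.ext fun y => ?_)
      simp [hρ, mul_assoc]) c hid (fun p => MulOpposite.op (e p)) (by
      intro p
      have h1 := he p
      change MulOpposite.op (e p) ∈ _
      generalize e p = w at h1 ⊢
      induction h1 using Submodule.span_induction with
      | mem w hw =>
        obtain ⟨l, hl, x, rfl⟩ := hw
        refine Submodule.subset_span ⟨_, ⟨l, hl, rfl⟩, x, ?_⟩
        exact MulOpposite.unop_injective (by ext; simp [hρ, mul_assoc])
      | zero => exact Submodule.zero_mem _
      | add w w' _ _ h h' => exact Submodule.add_mem _ h h'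
      | smul r w _ h => exact Submodule.smul_mem _ r h)
  have h0 := congrArg (fun w : (Module.End k D)ᵐᵒᵖ => w.unop (v 0)) key
  have hterm : ∀ π : Equiv.Perm (Fin d),
      (List.ofFn fun p => MulOpposite.op (e (π p))).prod.unop (v 0) = 0 ↔ π ≠ 1 := by
    intro π
    have h1 := list_prod_shift_apply v hv e hev (List.ofFn π) 0
    rw [List.map_ofFn, List.map_ofFn, List.length_ofFn] at h1
    refine h1.trans (not_congr ?_)
    rw [show List.range' (0 : Fin (d + 1)) d = List.ofFn (Fin.val : Fin d → ℕ) by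
      rw [Fin.val_zero, ← List.range_eq_range']
      exact (List.ext_get (by simp) fun n _ _ => by simp), List.ofFn_inj]
    constructor
    · intro h
      ext p
      exact congrFun h p
    · rintro rfl
      rfl
  rw [Finset.unop_sum, LinearMap.sum_apply, Finset.sum_eq_single 1] at h0
  · rw [MulOpposite.unop_smul, LinearMap.smul_apply] at h0
    have h2 := (smul_eq_zero.1 h0).resolve_left hc
    exact ((hterm 1).1 h2) rfl
  · intro π _ hπ
    rw [MulOpposite.unop_smul, LinearMap.smul_apply, (hterm π).2 hπ, smul_zero]
  · simp

/-- Kaplansky: a division ring satisfying a polynomial identity is a finite module over its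
center. -/
theorem IsPI.exists_finite_center (h : IsPI k D) :
    ∃ (m : ℕ) (b : Fin m → D), ∀ x, ∃ c : Fin m → D,
      (∀ i, c i ∈ Subring.center D) ∧ x = ∑ i, c i * b i := by
  obtain ⟨d, c, hc, hid⟩ := h.exists_multilinear
  obtain ⟨L, hcomm, hself⟩ := exists_self_centralizing k D
  have hdiv : ∀ a : L, IsUnit a ∨ a = 0 := by
    intro a
    by_cases ha : a = 0
    · exact Or.inr ha
    · have ha' : (a : D) ≠ 0 := fun h0 => ha (Subtype.ext h0)
      have hinv : (a : D)⁻¹ ∈ L := hself _ fun y hy => by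
        rw [← mul_right_inj' ha', ← mul_assoc, hcomm a a.2 y hy, mul_assoc, mul_inv_cancel₀ ha',
          mul_one, mul_inv_cancel_left₀ ha']
      exact Or.inl ⟨⟨a, ⟨_, hinv⟩, Subtype.ext (mul_inv_cancel₀ ha'),
        Subtype.ext (inv_mul_cancel₀ ha')⟩, rfl⟩
  let _ : DivisionRing L := DivisionRing.ofIsUnitOrEqZero hdiv
  have hrank : Module.rank L D ≤ d := by
    refine rank_le fun s hs => ?_
    by_contra! hlt
    let g : Fin (d + 1) → s := fun q => s.equivFin.symm (Fin.castLE hlt q)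
    have hg : Function.Injective g := s.equivFin.symm.injective.comp (Fin.castLE_injective _)
    have hv : LinearIndependent L fun q => (g q : D) := hs.comp g hg
    have hext : ∀ p : Fin d, ∃ f : D →ₗ[L] D, ∀ q,
        f (g q) = if q = p.castSucc then (g p.succ : D) else 0 := by
      intro p
      let B := Module.Basis.span hv
      obtain ⟨f, hf⟩ := LinearMap.exists_extend
        (B.constr ℕ fun q => if q = p.castSucc then (g p.succ : D) else 0)
      refine ⟨f, fun q => ?_⟩
      have h1 := congrArg (fun φ => φ (B q)) hf
      simp only [LinearMap.comp_apply, Module.Basis.constr_basis, Submodule.subtype_apply] at h1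
      rw [← h1, Module.Basis.span_apply]
    choose f hf using hext
    exact false_of_multilinear_identity L hcomm hself c hc hid (fun q => (g q : D)) f
      (fun q => hv.ne_zero q) hf
  have hfin : Module.Finite L D :=
    Module.rank_lt_aleph0_iff.1 (hrank.trans_lt (Cardinal.natCast_lt_aleph0))
  let B := Module.finBasis L D
  set n := Module.finrank L D
  have hrank' : Module.rank (Subring.center D) D ≤ (n * n : ℕ) := by
    refine rank_le fun s hs => ?_
    have hli : LinearIndependent L fun (b : s) (j : Fin n) => B j * (b : D) := by
      rw [Fintype.linearIndependent_iff]
      intro l hl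
      have h1 := eq_zero_of_sum_mul_mul_eq_zero (fun b : s => (b : D)) hs (fun b => (l b : D)) ?_
      · exact fun b => Subtype.ext (h1 b)
      · intro x
        rw [← B.sum_repr x]
        have h2 : ∀ j, ∑ b, (l b : D) * (B j * (b : D)) = 0 := by
          intro j
          have := congrFun hl j
          simpa [Subalgebra.smul_def] using this
        simp only [Finset.mul_sum, Finset.sum_mul]
        rw [Finset.sum_comm]
        refine Finset.sum_eq_zero fun j _ => ?_
        have h3 := congrArg ((B.repr x j : D) * ·) (h2 j)
        simp only [Finset.mul_sum, mul_zero] at h3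
        rw [← h3]
        refine Finset.sum_congr rfl fun b _ => ?_
        rw [Subalgebra.smul_def, smul_eq_mul, ← mul_assoc, hcomm _ (l b).2 _ (B.repr x j).2]
        simp only [mul_assoc]
    have h4 := hli.fintype_card_le_finrank
    rwa [Fintype.card_coe, Module.finrank_pi_fintype, Finset.sum_const, Finset.card_univ,
      Fintype.card_fin, smul_eq_mul] at h4
  have hfin' : Module.Finite (Subring.center D) D :=
    Module.rank_lt_aleph0_iff.1 (hrank'.trans_lt (Cardinal.natCast_lt_aleph0))
  let B' := Module.finBasis (Subring.center D) D
  refine ⟨_, B', fun x => ⟨fun i => B'.repr x i, fun i => (B'.repr x i).2, ?_⟩⟩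
  conv_lhs => rw [← B'.sum_repr x]
  rfl

end Kaplansky

/-! ### Graded division rings -/

section GradedDivisionRing

variable {k : Type v} [Field k] {S : Type u} [Ring S] [Algebra k S] {𝒮 : ℤ → Submodule k S}
  [GradedAlgebra 𝒮]

open DirectSum

theorem coe_decompose_mul_of_left_mem {x : S} {i : ℤ} (hx : x ∈ 𝒮 i) (y : S) (j : ℤ) :
    (decompose 𝒮 (x * y) j : S) = x * (decompose 𝒮 y (j - i) : S) := by
  have := coe_decompose_mul_add_of_left_mem 𝒮 (j := j - i) (b := y) hx
  rwa [add_sub_cancel] at this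

theorem coe_decompose_mul_of_right_mem {y : S} {i : ℤ} (x : S) (hy : y ∈ 𝒮 i) (j : ℤ) :
    (decompose 𝒮 (x * y) j : S) = (decompose 𝒮 x (j - i) : S) * y := by
  have := coe_decompose_mul_add_of_right_mem 𝒮 (i := j - i) (a := x) hy
  rwa [sub_add_cancel] at this

theorem eq_of_forall_decompose_eq {x y : S}
    (h : ∀ i, (decompose 𝒮 x i : S) = decompose 𝒮 y i) : x = y := by
  apply (decompose 𝒮).injective
  ext i
  exact h i

theorem exists_homogeneous_inverse {x : S} {i : ℤ} (hx : x ∈ 𝒮 i) (hu : IsUnit x) :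
    ∃ y ∈ 𝒮 (-i), x * y = 1 ∧ y * x = 1 := by
  obtain ⟨⟨x, y, h1, h2⟩, rfl⟩ := hu
  dsimp only at *
  have h := coe_decompose_mul_of_left_mem hx y 0
  rw [h1, decompose_of_mem_same _ SetLike.GradedOne.one_mem, zero_sub] at h
  have hy : (decompose 𝒮 y (-i) : S) = y := by
    calc (decompose 𝒮 y (-i) : S) = y * (x * (decompose 𝒮 y (-i) : S)) := by
            rw [← mul_assoc, h2, one_mul]
      _ = y := by rw [← h, mul_one]
  exact ⟨y, hy ▸ (decompose 𝒮 y (-i)).2, h1, h2⟩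

theorem IsGradedDivisionRing.exists_inverse (hS : IsGradedDivisionRing 𝒮) {x : S} {i : ℤ}
    (hx : x ∈ 𝒮 i) (h0 : x ≠ 0) : ∃ y ∈ 𝒮 (-i), x * y = 1 ∧ y * x = 1 :=
  exists_homogeneous_inverse hx (hS.isUnit x ⟨i, hx⟩ h0)

theorem commute_of_forall_homogeneous {x : S} (h : ∀ i, ∀ y ∈ 𝒮 i, y * x = x * y) (y : S) :
    y * x = x * y := by
  classical
  rw [← sum_support_decompose 𝒮 y, Finset.sum_mul, Finset.mul_sum]
  exact Finset.sum_congr rfl fun i _ => h i _ (decompose 𝒮 y i).2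

/-- A nonzero proper ideal of a graded division ring contains an element all of whose components
are central, with lowest component `1` in degree `0` and highest component in a positive degree:
an element of minimal support, normalized, is unchanged by conjugation by homogeneous units. -/
theorem IsGradedDivisionRing.exists_central_components (hS : IsGradedDivisionRing 𝒮)
    (J : Ideal S) [J.IsTwoSided] (hJ0 : J ≠ ⊥) (hJ1 : J ≠ ⊤) :
    ∃ f ∈ J, ∃ m : ℕ, 0 < m ∧ (decompose 𝒮 f 0 : S) = 1 ∧ (decompose 𝒮 f m : S) ≠ 0 ∧
      (∀ i : ℤ, i < 0 ∨ m < i → (decompose 𝒮 f i : S) = 0) ∧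
      ∀ (i : ℤ) (y : S), y * (decompose 𝒮 f i : S) = (decompose 𝒮 f i : S) * y := by
  classical
  have := hS.nontrivial
  have hex : ∃ n, ∃ f ∈ J, f ≠ 0 ∧ (decompose 𝒮 f).support.card = n := by
    obtain ⟨f, hf, h0⟩ := Submodule.exists_mem_ne_zero_of_ne_bot hJ0
    exact ⟨_, f, hf, h0, rfl⟩
  obtain ⟨f, hfJ, hf0, hcard⟩ := Nat.find_spec hex
  have hmin : ∀ g ∈ J, (decompose 𝒮 g).support.card < (decompose 𝒮 f).support.card → g = 0 := by
    intro g hg hlt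
    by_contra h0
    exact Nat.find_min hex (hcard ▸ hlt) ⟨g, hg, h0, rfl⟩
  have hne : (decompose 𝒮 f).support.Nonempty := by
    rw [Finset.nonempty_iff_ne_empty, ne_eq, DFinsupp.support_eq_empty]
    exact fun h => hf0 ((decompose 𝒮).injective (h.trans (decompose_zero 𝒮).symm))
  set s := (decompose 𝒮 f).support with hs
  have hmem : ∀ i, i ∈ s ↔ (decompose 𝒮 f i : S) ≠ 0 := by
    intro i
    rw [hs, DFinsupp.mem_support_iff]
    simp
  obtain ⟨y, hy, h1, h2⟩ := hS.exists_inverse (decompose 𝒮 f (s.min' hne)).2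
    ((hmem _).1 (s.min'_mem hne))
  set g := y * f with hg
  have hgJ : g ∈ J := J.mul_mem_left _ hfJ
  have hgi : ∀ i, (decompose 𝒮 g i : S) = y * (decompose 𝒮 f (i + s.min' hne) : S) := by
    intro i
    rw [hg, coe_decompose_mul_of_left_mem hy, sub_neg_eq_add]
  have hg0 : (decompose 𝒮 g 0 : S) = 1 := by rw [hgi, zero_add, h2]
  have hgn : ∀ i, (decompose 𝒮 g i : S) = 0 ↔ i + s.min' hne ∉ s := by
    intro i
    rw [hmem, not_not, hgi]
    refine ⟨fun h => ?_, fun h => by rw [h, mul_zero]⟩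
    rw [← one_mul (decompose 𝒮 f _ : S), ← h1, mul_assoc, h, mul_zero]
  have hgmem : ∀ i, i ∈ (decompose 𝒮 g).support ↔ (decompose 𝒮 g i : S) ≠ 0 := by
    intro i
    rw [DFinsupp.mem_support_iff]
    simp
  have hgs : (decompose 𝒮 g).support.card = s.card := by
    refine Finset.card_bij (fun i _ => i + s.min' hne) (fun i hi => ?_) (fun i _ j _ h => ?_)
      (fun j hj => ⟨j - s.min' hne, ?_, ?_⟩)
    · rw [hgmem, ne_eq, hgn, not_not] at hi
      exact hi
    · simpa using h
    · rw [hgmem, ne_eq, hgn, not_not, sub_add_cancel]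
      exact hj
    · simp
  have hcen : ∀ (i : ℤ) (x : S), x * (decompose 𝒮 g i : S) = (decompose 𝒮 g i : S) * x := by
    intro i x
    refine commute_of_forall_homogeneous (𝒮 := 𝒮) (fun d x hx => ?_) x
    by_cases hx0 : x = 0
    · simp [hx0]
    obtain ⟨x', hx', e1, e2⟩ := hS.exists_inverse hx hx0
    have hhi : ∀ i, (decompose 𝒮 (x * g * x' - g) i : S)
        = x * (decompose 𝒮 g i : S) * x' - (decompose 𝒮 g i : S) := by
      intro i
      rw [decompose_sub, DirectSum.sub_apply, AddSubgroupClass.coe_sub,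
        coe_decompose_mul_of_right_mem _ hx', coe_decompose_mul_of_left_mem hx,
        show i - -d - d = i by ring]
    have hz : x * g * x' - g = 0 := by
      refine hmin _ (sub_mem (J.mul_mem_right _ (J.mul_mem_left _ hgJ)) hgJ) ?_
      rw [← hgs]
      refine Finset.card_lt_card ⟨fun i hi => ?_, fun h => ?_⟩
      · rw [hgmem]
        intro h0
        rw [DFinsupp.mem_support_iff] at hi
        apply hi
        ext
        rw [hhi, h0]
        simp
      · have h0 : (0 : ℤ) ∈ (decompose 𝒮 g).support := by
          rw [hgmem, hg0]
          exact one_ne_zero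
        have := h h0
        rw [DFinsupp.mem_support_iff] at this
        apply this
        ext
        rw [hhi, hg0, mul_one, e1]
        simp
    have := hhi i
    rw [hz] at this
    simp only [decompose_zero, DirectSum.zero_apply, ZeroMemClass.coe_zero] at this
    rw [← sub_eq_zero.1 this.symm, mul_assoc _ x' x, e2, mul_one,
      sub_eq_zero.1 this.symm]
  refine ⟨g, hgJ, (s.max' hne - s.min' hne).toNat, ?_, hg0, ?_, ?_, hcen⟩
  · by_contra hle
    have hle : s.max' hne ≤ s.min' hne := by simpa using hle
    refine hJ1 (Ideal.eq_top_of_isUnit_mem _ hgJ ?_)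
    have : g = 1 := by
      refine eq_of_forall_decompose_eq (𝒮 := 𝒮) fun i => ?_
      by_cases hi : i = 0
      · rw [hi, hg0, decompose_of_mem_same _ SetLike.GradedOne.one_mem]
      · rw [decompose_of_mem_ne 𝒮 SetLike.GradedOne.one_mem (Ne.symm hi), hgn]
        intro h
        have h3 := s.min'_le _ h
        have h4 := s.le_max' _ h
        omega
    rw [this]
    exact isUnit_one
  · have := s.min'_le _ (s.max'_mem hne)
    rw [ne_eq, hgn, not_not, Int.toNat_of_nonneg (by omega), sub_add_cancel]
    exact s.max'_mem hne
  · intro i hi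
    rw [hgn]
    intro h
    have h3 := s.min'_le _ h
    have h4 := s.le_max' _ h
    omega

end GradedDivisionRing

section GradedDivisionRing

variable {k : Type v} [Field k] {S : Type u} [Ring S] [Algebra k S] {𝒮 : ℤ → Submodule k S}
  [GradedAlgebra 𝒮]

open DirectSum

/-- A field is finite over the field of fixed points of a finite group of automorphisms. -/
theorem exists_finite_fixedPoints {F : Type*} [Field F] (H : Subgroup (F ≃+* F)) [Finite H] :
    ∃ (t : ℕ) (b : Fin t → F), ∀ x, ∃ c : Fin t → F,
      (∀ i, ∀ σ ∈ H, σ (c i) = c i) ∧ x = ∑ i, c i * b i := by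
  let B := Module.finBasis (FixedPoints.subfield H F) F
  refine ⟨_, B, fun x => ⟨fun i => B.repr x i, fun i σ hσ => (B.repr x i).2 ⟨σ, hσ⟩, ?_⟩⟩
  conv_lhs => rw [← B.sum_repr x]
  rfl

/-- Conjugation by a homogeneous unit, as an automorphism of the degree zero part. -/
def conjGradeZero {y y' : S} {d : ℤ} (hy : y ∈ 𝒮 d) (hy' : y' ∈ 𝒮 (-d)) (h1 : y * y' = 1)
    (h2 : y' * y = 1) :
    SetLike.GradeZero.subalgebra 𝒮 ≃+* SetLike.GradeZero.subalgebra 𝒮 where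
  toFun x := ⟨y * x * y', by
    have := SetLike.mul_mem_graded (SetLike.mul_mem_graded hy x.2) hy'
    rwa [add_zero, add_neg_cancel] at this⟩
  invFun x := ⟨y' * x * y, by
    have := SetLike.mul_mem_graded (SetLike.mul_mem_graded hy' x.2) hy
    rwa [add_zero, neg_add_cancel] at this⟩
  left_inv x := by
    ext
    change y' * (y * x * y') * y = x
    rw [mul_assoc, mul_assoc _ y' y, h2, mul_one, ← mul_assoc, h2, one_mul]
  right_inv x := by
    ext
    change y * (y' * x * y) * y' = x
    rw [mul_assoc, mul_assoc _ y y', h1, mul_one, ← mul_assoc, h1, one_mul]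
  map_mul' x x' := by
    ext
    change y * (x * x') * y' = y * x * y' * (y * x' * y')
    rw [mul_assoc (y * (x : S)), ← mul_assoc y', ← mul_assoc y', h2, one_mul]
    simp only [mul_assoc]
  map_add' x x' := by
    ext
    change y * (x + x') * y' = y * x * y' + y * x' * y'
    rw [mul_add, add_mul]

variable (𝒮) in
/-- The central elements of degree zero of a graded algebra. -/
def centralGradeZero : Subalgebra k S :=
  SetLike.GradeZero.subalgebra 𝒮 ⊓ Subalgebra.center k S

/-- If the degree zero part is PI and there is a central unit of positive degree, then the degree
zero part is finite over the field of central elements of degree zero. By Kaplansky's theorem it is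
finite over its own center `F`; conjugation by a homogeneous unit induces an automorphism of `F`
that depends only on the degree modulo the degree of the central unit, and the elements of `F` fixed
by these finitely many automorphisms are central. -/
theorem IsGradedDivisionRing.exists_finite_gradeZero (hS : IsGradedDivisionRing 𝒮)
    (hPI : IsPI k (SetLike.GradeZero.subalgebra 𝒮)) {z : S} {m : ℕ} (hm : 0 < m)
    (hz : z ∈ 𝒮 m) (hz0 : z ≠ 0) (hzc : ∀ y, y * z = z * y) :
    ∃ (t : ℕ) (b : Fin t → S), ∀ x ∈ 𝒮 0,
      x ∈ Submodule.span (centralGradeZero 𝒮) (Set.range b) := by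
  have := hS.nontrivial
  have hunit : ∀ a : SetLike.GradeZero.subalgebra 𝒮, IsUnit a ∨ a = 0 := by
    intro a
    by_cases ha : a = 0
    · exact Or.inr ha
    · obtain ⟨y, hy, h1, h2⟩ := hS.exists_inverse a.2 (fun h => ha (Subtype.ext h))
      rw [neg_zero] at hy
      exact Or.inl ⟨⟨a, ⟨y, hy⟩, Subtype.ext h1, Subtype.ext h2⟩, rfl⟩
  let _ : DivisionRing (SetLike.GradeZero.subalgebra 𝒮) := DivisionRing.ofIsUnitOrEqZero hunit
  obtain ⟨p, b, hb⟩ := hPI.exists_finite_center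
  let F := Subring.center (SetLike.GradeZero.subalgebra 𝒮)
  let H : Subgroup (F ≃+* F) :=
    { carrier := {σ | ∃ d : ℤ, ∃ y ∈ 𝒮 d, y ≠ 0 ∧
        ∀ c : F, ((σ c : SetLike.GradeZero.subalgebra 𝒮) : S) * y
          = y * ((c : SetLike.GradeZero.subalgebra 𝒮) : S)}
      mul_mem' := by
        rintro σ τ ⟨d, y, hy, hy0, h⟩ ⟨d', y', hy', hy0', h'⟩
        refine ⟨d + d', y * y', SetLike.mul_mem_graded hy hy', ?_, fun c => ?_⟩
        · exact ((hS.isUnit y ⟨d, hy⟩ hy0).mul (hS.isUnit y' ⟨d', hy'⟩ hy0')).ne_zero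
        · rw [RingAut.mul_apply, ← mul_assoc, h, mul_assoc, h', mul_assoc]
      one_mem' := ⟨0, 1, SetLike.GradedOne.one_mem, one_ne_zero, fun c => by simp⟩
      inv_mem' := by
        rintro σ ⟨d, y, hy, hy0, h⟩
        obtain ⟨y', hy', h1, h2⟩ := hS.exists_inverse hy hy0
        refine ⟨-d, y', hy', fun h0 => ?_, fun c => ?_⟩
        · rw [h0, mul_zero] at h1
          exact zero_ne_one h1
        · have := h (σ⁻¹ c)
          rw [show σ (σ⁻¹ c) = c from σ.apply_symm_apply c] at this
          calc (((σ⁻¹ c : F) : SetLike.GradeZero.subalgebra 𝒮) : S) * y'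
              = y' * (y * (((σ⁻¹ c : F) : SetLike.GradeZero.subalgebra 𝒮) : S)) * y' := by
                rw [← mul_assoc, h2, one_mul]
            _ = y' * ((c : SetLike.GradeZero.subalgebra 𝒮) : S) := by
                rw [← this, mul_assoc, mul_assoc _ y, h1, mul_one] }
  have : Finite H := by
    have hch : ∀ σ : H, ∃ d : ℤ, ∃ y ∈ 𝒮 d, y ≠ 0 ∧
        ∀ c : F, (((σ : F ≃+* F) c : SetLike.GradeZero.subalgebra 𝒮) : S) * y
          = y * ((c : SetLike.GradeZero.subalgebra 𝒮) : S) := fun σ => σ.2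
    choose δ y hyd hy0 hy using hch
    have : NeZero m := ⟨hm.ne'⟩
    obtain ⟨zi, hzi, hz1, hz2⟩ := hS.exists_inverse hz hz0
    have hzic : ∀ y, y * zi = zi * y := by
      intro y
      calc y * zi = zi * (z * y) * zi := by rw [← mul_assoc zi, hz2, one_mul]
        _ = zi * y := by rw [← hzc, mul_assoc, mul_assoc y, hz1, mul_one]
    -- two units whose degrees differ by `m` times a natural number induce the same automorphism
    have key : ∀ σ τ : H, ∀ j : ℕ, δ σ = δ τ + m * j → σ = τ := by
      intro σ τ j hj
      obtain ⟨y', hy', h1, h2⟩ := hS.exists_inverse (hyd τ) (hy0 τ)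
      have hzj : zi ^ j ∈ 𝒮 (-(m * j)) := by
        have := SetLike.pow_mem_graded j hzi
        convert this using 2
        simp [mul_comm]
      have hu : y' * y σ * zi ^ j ∈ 𝒮 0 := by
        have := SetLike.mul_mem_graded (SetLike.mul_mem_graded hy' (hyd σ)) hzj
        convert this using 2
        rw [hj]
        ring
      have hcomm : ∀ x : S, x * zi ^ j = zi ^ j * x := fun x =>
        ((show Commute x zi from hzic x).pow_right j)
      have hinv : zi ^ j * z ^ j = 1 := by
        rw [← (show Commute zi z from hz2.trans hz1.symm).mul_pow, hz2, one_pow]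
      refine Subtype.ext (RingEquiv.ext fun c => Subtype.ext (Subtype.ext ?_))
      have hc : ((c : SetLike.GradeZero.subalgebra 𝒮) : S) * (y' * y σ * zi ^ j)
          = y' * y σ * zi ^ j * ((c : SetLike.GradeZero.subalgebra 𝒮) : S) :=
        congrArg Subtype.val (Subring.mem_center_iff.1 c.2 ⟨_, hu⟩).symm
      obtain ⟨q, hq1⟩ := (hS.isUnit _ ⟨_, hyd σ⟩ (hy0 σ)).exists_right_inv
      have hstep : y σ * ((c : SetLike.GradeZero.subalgebra 𝒮) : S)
          = (((τ : F ≃+* F) c : SetLike.GradeZero.subalgebra 𝒮) : S) * y σ := by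
        have e1 : y τ * (y' * y σ * zi ^ j) = y σ * zi ^ j := by
          rw [← mul_assoc, ← mul_assoc, h1, one_mul]
        have e2 : (((τ : F ≃+* F) c : SetLike.GradeZero.subalgebra 𝒮) : S) * (y σ * zi ^ j)
            = y σ * zi ^ j * ((c : SetLike.GradeZero.subalgebra 𝒮) : S) := by
          rw [← e1, ← mul_assoc, hy, mul_assoc (y τ), hc, ← mul_assoc]
        calc y σ * ((c : SetLike.GradeZero.subalgebra 𝒮) : S)
            = y σ * zi ^ j * ((c : SetLike.GradeZero.subalgebra 𝒮) : S) * z ^ j := by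
              rw [mul_assoc (y σ), ← hcomm, mul_assoc, mul_assoc, hinv, mul_one]
          _ = _ := by rw [← e2, mul_assoc, mul_assoc, hinv, mul_one]
      rw [← hy] at hstep
      calc (((σ : F ≃+* F) c : SetLike.GradeZero.subalgebra 𝒮) : S)
          = (((σ : F ≃+* F) c : SetLike.GradeZero.subalgebra 𝒮) : S) * y σ * q := by
            rw [mul_assoc, hq1, mul_one]
        _ = _ := by rw [hstep, mul_assoc, hq1, mul_one]
    refine Finite.of_injective (fun σ : H => (δ σ : ZMod m)) fun σ τ h => ?_
    obtain ⟨j, hj⟩ := (ZMod.intCast_eq_intCast_iff_dvd_sub _ _ _).1 h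
    rcases Int.eq_nat_or_neg j with ⟨n, rfl | rfl⟩
    · exact (key τ σ n (by linarith)).symm
    · exact key σ τ n (by linarith)
  obtain ⟨q, b', hb'⟩ := exists_finite_fixedPoints H
  have hfix : ∀ c : F, (∀ σ ∈ H, σ c = c) →
      ((c : SetLike.GradeZero.subalgebra 𝒮) : S) ∈ centralGradeZero 𝒮 := by
    intro c hc
    refine ⟨(c : SetLike.GradeZero.subalgebra 𝒮).2, Subalgebra.mem_center_iff.2 fun x => ?_⟩
    refine commute_of_forall_homogeneous (𝒮 := 𝒮) (fun d y hy => ?_) x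
    by_cases hy0 : y = 0
    · simp [hy0]
    obtain ⟨y', hy', h1, h2⟩ := hS.exists_inverse hy hy0
    let σ : F ≃+* F := Subring.centerCongr (conjGradeZero hy hy' h1 h2)
    have hσ : ∀ c : F, ((σ c : SetLike.GradeZero.subalgebra 𝒮) : S) * y
          = y * ((c : SetLike.GradeZero.subalgebra 𝒮) : S) := by
      intro c
      change y * ((c : SetLike.GradeZero.subalgebra 𝒮) : S) * y' * y = _
      rw [mul_assoc, h2, mul_one]
    have := hσ c
    rw [hc σ ⟨d, y, hy, hy0, hσ⟩] at this
    exact this.symm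
  refine ⟨q * p, fun i => ((b' (finProdFinEquiv.symm i).1 : SetLike.GradeZero.subalgebra 𝒮) : S)
    * (b (finProdFinEquiv.symm i).2 : S), fun x hx => ?_⟩
  obtain ⟨c, hc, hxc⟩ := hb ⟨x, hx⟩
  have hx' : x = ∑ i, ((c i : SetLike.GradeZero.subalgebra 𝒮) : S) * (b i : S) := by
    have := congrArg Subtype.val hxc
    simpa using this
  rw [hx']
  refine Submodule.sum_mem _ fun i _ => ?_
  obtain ⟨c', hc', hcc⟩ := hb' ⟨c i, hc i⟩
  have : ((c i : SetLike.GradeZero.subalgebra 𝒮) : S)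
      = ∑ j, ((c' j : SetLike.GradeZero.subalgebra 𝒮) : S) * (b' j : SetLike.GradeZero.subalgebra 𝒮)
      := by
    have := congrArg (fun x : F => ((x : SetLike.GradeZero.subalgebra 𝒮) : S)) hcc
    simpa using this
  rw [this, Finset.sum_mul]
  refine Submodule.sum_mem _ fun j _ => ?_
  have hmem := Submodule.smul_mem (Submodule.span (centralGradeZero 𝒮) (Set.range fun i =>
    ((b' (finProdFinEquiv.symm i).1 : SetLike.GradeZero.subalgebra 𝒮) : S)
    * (b (finProdFinEquiv.symm i).2 : S))) ⟨_, hfix (c' j) (hc' j)⟩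
    (Submodule.subset_span ⟨finProdFinEquiv (j, i), rfl⟩)
  simpa [Subalgebra.smul_def, mul_assoc] using hmem

/-- Modulo a nonzero proper ideal, a graded division ring with PI degree zero part is finite over
its field of central elements of degree zero. -/
theorem IsGradedDivisionRing.exists_finite_quotient (hS : IsGradedDivisionRing 𝒮)
    (hPI : IsPI k (SetLike.GradeZero.subalgebra 𝒮)) (J : Ideal S) [J.IsTwoSided] (hJ0 : J ≠ ⊥)
    (hJ1 : J ≠ ⊤) :
    ∃ (t : ℕ) (b : Fin t → S), ∀ x, ∃ y ∈ Submodule.span (centralGradeZero 𝒮) (Set.range b),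
      x - y ∈ J := by
  classical
  obtain ⟨f, hf, m, hm, hf0, hfm, hfi, hfc⟩ := hS.exists_central_components J hJ0 hJ1
  obtain ⟨t, b, hb⟩ := hS.exists_finite_gradeZero hPI hm (decompose 𝒮 f m).2 hfm (hfc m)
  have hu : ∀ r : ℤ, ∃ u : S, ∀ x ∈ 𝒮 r, ∃ c ∈ 𝒮 0, x = c * u := by
    intro r
    by_cases h : ∃ u ∈ 𝒮 r, u ≠ 0
    · obtain ⟨u, hu, hu0⟩ := h
      obtain ⟨u', hu', h1, h2⟩ := hS.exists_inverse hu hu0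
      refine ⟨u, fun x hx => ⟨x * u', ?_, by rw [mul_assoc, h2, mul_one]⟩⟩
      have := SetLike.mul_mem_graded hx hu'
      rwa [add_neg_cancel] at this
    · push Not at h
      exact ⟨0, fun x hx => ⟨0, zero_mem _, by rw [h x hx, zero_mul]⟩⟩
  choose u hu using hu
  let c : Fin (t * m) → S := fun i =>
    b (finProdFinEquiv.symm i).1 * u ((finProdFinEquiv.symm i).2 : ℕ)
  let V : Submodule (centralGradeZero 𝒮) S := Submodule.span _ (Set.range c) ⊔
    J.restrictScalars (centralGradeZero 𝒮)
  have hJV : ∀ x ∈ J, x ∈ V := fun x hx => Submodule.mem_sup_right hx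
  have hbase : ∀ r : ℕ, r < m → ∀ x ∈ 𝒮 r, x ∈ V := by
    intro r hr x hx
    obtain ⟨a, ha, rfl⟩ := hu r x hx
    refine Submodule.mem_sup_left ?_
    have := hb a ha
    clear hx ha
    induction this using Submodule.span_induction with
    | mem x hx =>
      obtain ⟨i, rfl⟩ := hx
      exact Submodule.subset_span ⟨finProdFinEquiv (i, ⟨r, hr⟩), by simp only [c, Equiv.symm_apply_apply]⟩
    | zero => simp
    | add x y _ _ hx hy => rw [add_mul]; exact add_mem hx hy
    | smul a x _ hx => rw [smul_mul_assoc]; exact Submodule.smul_mem _ _ hx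
  -- multiplying `f` by homogeneous elements moves the window of degrees in either direction
  have hstep : ∀ n : ℕ, ∀ r : ℤ, -n ≤ r → r < m + n → ∀ x ∈ 𝒮 r, x ∈ V := by
    intro n
    induction n with
    | zero =>
      intro r h1 h2 x hx
      lift r to ℕ using by simpa using h1
      exact hbase r (by simpa using h2) x hx
    | succ n ih =>
      intro r h1 h2 x hx
      push_cast at h1 h2
      have hcomp : ∀ y : S, y * f ∈ J := fun y => J.mul_mem_left _ hf
      have hsum : ∀ y : S, y * f = ∑ i ∈ (decompose 𝒮 f).support, y * (decompose 𝒮 f i : S) := by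
        intro y
        rw [← Finset.mul_sum, sum_support_decompose]
      have hrange : ∀ i ∈ (decompose 𝒮 f).support, 0 ≤ i ∧ i ≤ m := by
        intro i hi
        by_contra hcon
        rw [DFinsupp.mem_support_iff] at hi
        exact hi (Subtype.ext (hfi i (by omega)))
      by_cases hlow : r = -n - 1
      · have h0 : (0 : ℤ) ∈ (decompose 𝒮 f).support := by
          rw [DFinsupp.mem_support_iff]
          intro h
          have := hS.nontrivial
          rw [h] at hf0
          exact zero_ne_one hf0
        have hx' := hsum x
        rw [← Finset.add_sum_erase _ _ h0, hf0, mul_one, ← sub_eq_iff_eq_add] at hx'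
        rw [← hx']
        refine sub_mem (hJV _ (hcomp x)) (sum_mem fun i hi => ?_)
        rw [Finset.mem_erase] at hi
        have hr := hrange i hi.2
        have hi0 := hi.1
        exact ih (r + i) (by omega) (by omega) _ (SetLike.mul_mem_graded hx (decompose 𝒮 f i).2)
      by_cases hhigh : r = m + n
      · have h0 : (m : ℤ) ∈ (decompose 𝒮 f).support := by
          rw [DFinsupp.mem_support_iff]
          intro h
          exact hfm (by rw [h]; rfl)
        obtain ⟨y', hy', e1, e2⟩ := hS.exists_inverse (decompose 𝒮 f m).2 hfm
        have hx' := hsum (x * y')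
        rw [← Finset.add_sum_erase _ _ h0, mul_assoc x y' (decompose 𝒮 f m : S), e2, mul_one,
          ← sub_eq_iff_eq_add] at hx'
        rw [← hx']
        refine sub_mem (hJV _ (hcomp _)) (sum_mem fun i hi => ?_)
        rw [Finset.mem_erase] at hi
        have hr := hrange i hi.2
        have hi0 := hi.1
        exact ih (r + -m + i) (by omega) (by omega) _
          (SetLike.mul_mem_graded (SetLike.mul_mem_graded hx hy') (decompose 𝒮 f i).2)
      · exact ih r (by omega) (by omega) x hx
  refine ⟨_, c, fun x => ?_⟩
  have hxV : x ∈ V := by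
    rw [← sum_support_decompose 𝒮 x]
    refine sum_mem fun i _ => hstep i.natAbs i ?_ ?_ _ (decompose 𝒮 x i).2
    · omega
    · omega
  obtain ⟨y, hy, j, hj, rfl⟩ := Submodule.mem_sup.1 hxV
  exact ⟨y, hy, by simpa using hj⟩

end GradedDivisionRing

/-! ### The largest homogeneous ideal inside a prime -/

section HomogeneousCore

open DirectSum

variable {k : Type v} [Field k] {A : Type u} [Ring A] [Algebra k A] (𝒜 : ℤ → Submodule k A)
  [GradedAlgebra 𝒜]

theorem mem_homogeneousCore_iff {I : Ideal A} {x : A} :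
    x ∈ (I.homogeneousCore 𝒜).toIdeal ↔ ∀ i, (decompose 𝒜 x i : A) ∈ I := by
  classical
  constructor
  · intro h i
    exact Ideal.toIdeal_homogeneousCore_le 𝒜 I ((I.homogeneousCore 𝒜).isHomogeneous i h)
  · intro h
    rw [← sum_support_decompose 𝒜 x]
    exact sum_mem fun i _ => Ideal.mem_homogeneousCore_of_homogeneous_of_mem
      ⟨i, (decompose 𝒜 x i).2⟩ (h i)

theorem coe_decompose_mul_eq_sum [∀ i (x : 𝒜 i), Decidable (x ≠ 0)] (x y : A) (j : ℤ) :
    (decompose 𝒜 (x * y) j : A)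
      = ∑ i ∈ (decompose 𝒜 x).support, (decompose 𝒜 x i : A) * (decompose 𝒜 y (j - i) : A) := by
  conv_lhs => rw [← sum_support_decompose 𝒜 x, Finset.sum_mul, decompose_sum,
    DFinsupp.finsetSum_apply, AddSubmonoidClass.coe_finsetSum]
  exact Finset.sum_congr rfl fun i _ => coe_decompose_mul_of_left_mem (decompose 𝒜 x i).2 y j

theorem isTwoSided_homogeneousCore (I : Ideal A) [I.IsTwoSided] :
    (I.homogeneousCore 𝒜).toIdeal.IsTwoSided := by
  classical
  refine ⟨fun {a} b ha => ?_⟩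
  rw [mem_homogeneousCore_iff] at ha ⊢
  intro j
  rw [coe_decompose_mul_eq_sum]
  exact sum_mem fun i _ => I.mul_mem_right _ (ha i)

/-- The homogeneous prime `P*`, generated by the homogeneous elements of the prime `P`. -/
def homogeneousPart (P : PrimeSpec A) : HSpec 𝒜 where
  ideal := (P.ideal.homogeneousCore 𝒜).toIdeal
  isHomogeneous := (P.ideal.homogeneousCore 𝒜).isHomogeneous
  isPrime := by
    classical
    refine IsPrimeIdeal.of_mem_or_mem (isTwoSided_homogeneousCore 𝒜 P.ideal)
      (fun h => P.isPrime.ne_top (top_le_iff.1 (h ▸ Ideal.toIdeal_homogeneousCore_le 𝒜 P.ideal)))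
      fun a b hab => ?_
    by_contra hcon
    push Not at hcon
    -- compare the highest components of `a` and `b` outside `P`
    have hmax : ∀ a, a ∉ (P.ideal.homogeneousCore 𝒜).toIdeal →
        ∃ i : ℤ, (decompose 𝒜 a i : A) ∉ P.ideal ∧ ∀ j, i < j → (decompose 𝒜 a j : A) ∈ P.ideal := by
      intro a ha
      rw [mem_homogeneousCore_iff] at ha
      push Not at ha
      obtain ⟨i, hi⟩ := ha
      let s := (decompose 𝒜 a).support.filter fun i => (decompose 𝒜 a i : A) ∉ P.ideal
      have hs : ∀ j, (decompose 𝒜 a j : A) ∉ P.ideal → j ∈ s := by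
        intro j hj
        refine Finset.mem_filter.2 ⟨?_, hj⟩
        rw [DFinsupp.mem_support_iff]
        intro h
        exact hj (by rw [h]; exact zero_mem _)
      refine ⟨s.max' ⟨i, hs i hi⟩, (Finset.mem_filter.1 (s.max'_mem ⟨i, hs i hi⟩)).2, fun j hj => ?_⟩
      by_contra h
      exact absurd (s.le_max' j (hs j h)) (not_le.2 hj)
    obtain ⟨i, hi, hi'⟩ := hmax a hcon.1
    obtain ⟨j, hj, hj'⟩ := hmax b hcon.2
    have hhom : ∀ d, ∀ x ∈ 𝒜 d, (decompose 𝒜 a i : A) * x * (decompose 𝒜 b j : A) ∈ P.ideal := by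
      intro d x hx
      have h := (mem_homogeneousCore_iff 𝒜).1 (hab x) (i + d + j)
      rw [mul_assoc, coe_decompose_mul_eq_sum] at h
      have hterm : ∀ l, (decompose 𝒜 (x * b) (i + d + j - l) : A)
          = x * (decompose 𝒜 b (i + j - l) : A) := by
        intro l
        rw [coe_decompose_mul_of_left_mem hx, show i + d + j - l - d = i + j - l by ring]
      have hsupp : i ∈ (decompose 𝒜 a).support := by
        rw [DFinsupp.mem_support_iff]
        intro h
        exact hi (by rw [h]; exact zero_mem _)
      rw [← Finset.add_sum_erase _ _ hsupp] at h
      have hrest : ∑ l ∈ (decompose 𝒜 a).support.erase i, (decompose 𝒜 a l : A)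
          * (decompose 𝒜 (x * b) (i + d + j - l) : A) ∈ P.ideal := by
        refine sum_mem fun l hl => ?_
        rw [hterm]
        rcases lt_or_gt_of_ne (Finset.ne_of_mem_erase hl) with hlt | hlt
        · exact P.ideal.mul_mem_left _ (P.ideal.mul_mem_left _ (hj' _ (by omega)))
        · exact P.ideal.mul_mem_right _ (hi' _ hlt)
      have h2 := (Submodule.add_mem_iff_left _ hrest).1 h
      rw [hterm, add_sub_cancel_left, ← mul_assoc] at h2
      exact h2
    have hall : ∀ x, (decompose 𝒜 a i : A) * x * (decompose 𝒜 b j : A) ∈ P.ideal := fun x => by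
      rw [← sum_support_decompose 𝒜 x, Finset.mul_sum, Finset.sum_mul]
      exact sum_mem fun d _ => hhom d _ (decompose 𝒜 x d).2
    rcases P.isPrime.mem_or_mem hall with h | h
    · exact hi h
    · exact hj h

theorem homogeneousPart_le (P : PrimeSpec A) : (homogeneousPart 𝒜 P).toPrimeSpec ≤ P :=
  Ideal.toIdeal_homogeneousCore_le 𝒜 P.ideal

theorem homogeneousPart_mono {P Q : PrimeSpec A} (h : P ≤ Q) :
    homogeneousPart 𝒜 P ≤ homogeneousPart 𝒜 Q :=
  Ideal.homogeneousCore_mono 𝒜 (show P.ideal ≤ Q.ideal from h)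

theorem homogeneousPart_toPrimeSpec (P : HSpec 𝒜) : homogeneousPart 𝒜 P.toPrimeSpec = P :=
  HSpec.ext P.isHomogeneous.toIdeal_homogeneousCore_eq_self

end HomogeneousCore

/-! ### Graded localizations to matrix rings over graded division rings -/

section MatrixLocalization

variable {k : Type v} [Field k] {A : Type u} [Ring A] [Algebra k A]

/-- `φ : A → M_n(S)` exhibits the matrix ring over the graded division ring `S`, graded with shifts
`d`, as the graded quotient ring of `A ⧸ H`. -/
structure IsMatrixLocalization (𝒜 : ℤ → Submodule k A) (H : Ideal A) {S : Type u} [Ring S]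
    [Algebra k S] (𝒮 : ℤ → Submodule k S) [GradedAlgebra 𝒮] {n : ℕ} (d : Fin n → ℤ)
    (φ : A →ₐ[k] Matrix (Fin n) (Fin n) S) : Prop where
  isGradedDivisionRing : IsGradedDivisionRing 𝒮
  isPI : IsPI k (SetLike.GradeZero.subalgebra 𝒮)
  ker : ∀ a, φ a = 0 ↔ a ∈ H
  map_mem : ∀ m, ∀ a ∈ 𝒜 m, ∀ i j, φ a i j ∈ 𝒮 (m + d i - d j)
  right_fraction : ∀ q, ∃ a s, SetLike.IsHomogeneousElem 𝒜 s ∧ IsUnit (φ s) ∧ q * φ s = φ a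
  left_fraction : ∀ q, ∃ a s, SetLike.IsHomogeneousElem 𝒜 s ∧ IsUnit (φ s) ∧ φ s * q = φ a

theorem exists_isMatrixLocalization (𝒜 : ℤ → Submodule k A) [GradedAlgebra 𝒜] (H : Ideal A)
    [H.IsTwoSided] (h : IsBirationallyPI (quotientGrading 𝒜 H)) :
    ∃ (S : Type u) (_ : Ring S) (_ : Algebra k S) (𝒮 : ℤ → Submodule k S) (_ : GradedAlgebra 𝒮)
      (n : ℕ) (d : Fin n → ℤ) (φ : A →ₐ[k] Matrix (Fin n) (Fin n) S),
      IsMatrixLocalization 𝒜 H 𝒮 d φ := by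
  obtain ⟨Q, _, _, 𝒬, _, i, S, _, _, 𝒮, _, n, d, e, hi, hS, he, hPI⟩ := h
  have hlift : ∀ s : A ⧸ H, SetLike.IsHomogeneousElem (quotientGrading 𝒜 H) s →
      ∃ s', SetLike.IsHomogeneousElem 𝒜 s' ∧ Ideal.Quotient.mkₐ k H s' = s := by
    rintro _ ⟨m, s, hs, rfl⟩
    exact ⟨s, ⟨m, hs⟩, rfl⟩
  refine ⟨S, _, _, 𝒮, _, n, d, (e.toAlgHom.comp i).comp (Ideal.Quotient.mkₐ k H), hS, hPI, ?_, ?_,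
    ?_, ?_⟩
  · intro a
    change e (i (Ideal.Quotient.mk H a)) = 0 ↔ _
    rw [EmbeddingLike.map_eq_zero_iff, map_eq_zero_iff _ hi.injective,
      Ideal.Quotient.eq_zero_iff_mem]
  · intro m a ha
    exact (he m _).1 (hi.map_mem m _ ⟨a, ha, rfl⟩)
  · intro q
    obtain ⟨b, s, hs, hr, h⟩ := hi.right_fraction (e.symm q)
    obtain ⟨s', hs', rfl⟩ := hlift s hs
    obtain ⟨b', rfl⟩ := Ideal.Quotient.mk_surjective b
    refine ⟨b', s', hs', (hi.isUnit _ hs hr).map e, ?_⟩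
    have := congrArg e h
    rwa [map_mul, AlgEquiv.apply_symm_apply] at this
  · intro q
    obtain ⟨b, s, hs, hr, h⟩ := hi.left_fraction (e.symm q)
    obtain ⟨s', hs', rfl⟩ := hlift s hs
    obtain ⟨b', rfl⟩ := Ideal.Quotient.mk_surjective b
    refine ⟨b', s', hs', (hi.isUnit _ hs hr).map e, ?_⟩
    have := congrArg e h
    rwa [map_mul, AlgEquiv.apply_symm_apply] at this

namespace IsMatrixLocalization

variable {𝒜 : ℤ → Submodule k A} {H : Ideal A} {S : Type u} [Ring S]
    [Algebra k S] {𝒮 : ℤ → Submodule k S} [GradedAlgebra 𝒮] {n : ℕ} {d : Fin n → ℤ}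
    {φ : A →ₐ[k] Matrix (Fin n) (Fin n) S}

/-- `x` is a right fraction with numerator in `I` and homogeneous denominator. -/
def IsFractionOf (𝒜 : ℤ → Submodule k A) (φ : A →ₐ[k] Matrix (Fin n) (Fin n) S) (I : Ideal A)
    (x : Matrix (Fin n) (Fin n) S) : Prop :=
  ∃ s, SetLike.IsHomogeneousElem 𝒜 s ∧ IsUnit (φ s) ∧ ∃ a ∈ I, x * φ s = φ a

variable {I : Ideal A}

theorem isFractionOf_mul_right [I.IsTwoSided] (h : IsMatrixLocalization 𝒜 H 𝒮 d φ)
    {x : Matrix (Fin n) (Fin n) S} (hx : IsFractionOf 𝒜 φ I x) (q : Matrix (Fin n) (Fin n) S) :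
    IsFractionOf 𝒜 φ I (x * q) := by
  obtain ⟨s, hs, hsu, a, ha, hxa⟩ := hx
  obtain ⟨v, h1, h2⟩ := isUnit_iff_exists.1 hsu
  obtain ⟨b, r, hr, hru, e⟩ := h.right_fraction (v * q)
  refine ⟨r, hr, hru, a * b, I.mul_mem_right _ ha, ?_⟩
  rw [map_mul, ← hxa, ← e, mul_assoc x, mul_assoc x, mul_assoc _ q, ← mul_assoc (φ s), h1, one_mul]

theorem isFractionOf_map_mul {x : Matrix (Fin n) (Fin n) S} (hx : IsFractionOf 𝒜 φ I x) (b : A) :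
    IsFractionOf 𝒜 φ I (φ b * x) := by
  obtain ⟨s, hs, hsu, a, ha, hxa⟩ := hx
  exact ⟨s, hs, hsu, b * a, I.mul_mem_left _ ha, by rw [mul_assoc, hxa, map_mul]⟩

variable [GradedAlgebra 𝒜]

theorem isFractionOf_map {a : A} (ha : a ∈ I) : IsFractionOf 𝒜 φ I (φ a) :=
  ⟨1, ⟨0, SetLike.GradedOne.one_mem⟩, by simp, a, ha, by simp⟩

/-- Two fractions have a common denominator. -/
theorem exists_common_multiple (h : IsMatrixLocalization 𝒜 H 𝒮 d φ) {s t : A}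
    (hs : SetLike.IsHomogeneousElem 𝒜 s) (htu : IsUnit (φ t)) :
    ∃ r a, SetLike.IsHomogeneousElem 𝒜 (s * r) ∧ IsUnit (φ r) ∧ φ (s * r) = φ (t * a) := by
  obtain ⟨v, h1, h2⟩ := isUnit_iff_exists.1 htu
  obtain ⟨a, r, hr, hru, e⟩ := h.right_fraction (v * φ s)
  refine ⟨r, a, hs.mul hr, hru, ?_⟩
  rw [map_mul, map_mul, ← e, mul_assoc, ← mul_assoc (φ t), h1, one_mul]

theorem isFractionOf_add [I.IsTwoSided] (h : IsMatrixLocalization 𝒜 H 𝒮 d φ)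
    {x y : Matrix (Fin n) (Fin n) S} (hx : IsFractionOf 𝒜 φ I x) (hy : IsFractionOf 𝒜 φ I y) :
    IsFractionOf 𝒜 φ I (x + y) := by
  obtain ⟨s, hs, hsu, a, ha, hxa⟩ := hx
  obtain ⟨t, ht, htu, b, hb, hyb⟩ := hy
  obtain ⟨r, c, hr, hru, e⟩ := h.exists_common_multiple hs htu
  refine ⟨s * r, hr, by rw [map_mul]; exact hsu.mul hru, a * r + b * c,
    add_mem (I.mul_mem_right _ ha) (I.mul_mem_right _ hb), ?_⟩
  rw [add_mul, map_add, map_mul φ a, map_mul φ b, ← hxa, ← hyb]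
  nth_rewrite 2 [e]
  rw [map_mul, map_mul, mul_assoc, mul_assoc]

/-- Fractions with numerator in a two-sided ideal are stable under left multiplication by inverses
of denominators: the right ideals of the `a` such that `φ t ^ m * φ a` is such a fraction form an
ascending chain, which is stationary. -/
theorem isFractionOf_inv_mul [I.IsTwoSided] [IsNoetherianRing Aᵐᵒᵖ]
    (h : IsMatrixLocalization 𝒜 H 𝒮 d φ) {x : Matrix (Fin n) (Fin n) S}
    (hx : IsFractionOf 𝒜 φ I x) {t : A} {v : Matrix (Fin n) (Fin n) S} (h1 : φ t * v = 1)
    (h2 : v * φ t = 1) : IsFractionOf 𝒜 φ I (v * x) := by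
  let R : ℕ →o Ideal Aᵐᵒᵖ :=
    { toFun := fun m =>
        { carrier := {a | IsFractionOf 𝒜 φ I (φ t ^ m * φ a.unop)}
          zero_mem' := by
            change IsFractionOf 𝒜 φ I (φ t ^ m * φ 0)
            rw [map_zero, mul_zero, ← map_zero φ]
            exact isFractionOf_map (zero_mem _)
          add_mem' := fun {a b} ha hb => by
            change IsFractionOf 𝒜 φ I (φ t ^ m * φ (a.unop + b.unop))
            rw [map_add, mul_add]
            exact h.isFractionOf_add ha hb
          smul_mem' := fun c a ha => by
            change IsFractionOf 𝒜 φ I (φ t ^ m * φ (a.unop * c.unop))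
            rw [map_mul, ← mul_assoc]
            exact h.isFractionOf_mul_right ha _ }
      monotone' := monotone_nat_of_le_succ fun m a ha => by
        change IsFractionOf 𝒜 φ I (φ t ^ (m + 1) * φ a.unop)
        rw [pow_succ', mul_assoc]
        exact isFractionOf_map_mul ha t }
  obtain ⟨m, hm⟩ := monotone_stabilizes_iff_noetherian.2 ‹IsNoetherianRing Aᵐᵒᵖ› R
  obtain ⟨a, r, hr, hru, e⟩ := h.right_fraction (v ^ (m + 1) * x)
  have hv : ∀ j, φ t ^ j * v ^ j = 1 := by
    intro j
    rw [← (show Commute (φ t) v from h1.trans h2.symm).mul_pow, h1, one_pow]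
  have ha : MulOpposite.op a ∈ R (m + 1) := by
    change IsFractionOf 𝒜 φ I (φ t ^ (m + 1) * φ a)
    rw [← e, ← mul_assoc, ← mul_assoc, hv, one_mul]
    exact h.isFractionOf_mul_right hx _
  rw [← hm (m + 1) (Nat.le_succ m)] at ha
  change IsFractionOf 𝒜 φ I (φ t ^ m * φ a) at ha
  rw [← e, ← mul_assoc, ← mul_assoc, pow_succ, ← mul_assoc, hv, one_mul] at ha
  obtain ⟨w, hw1, hw2⟩ := isUnit_iff_exists.1 hru
  have := h.isFractionOf_mul_right ha w
  rwa [mul_assoc _ (φ r), hw1, mul_one] at this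

/-- The extension of a two-sided ideal `I` of `A` to the matrix ring: the fractions with numerator
in `I`. -/
def extension [IsNoetherianRing Aᵐᵒᵖ] (h : IsMatrixLocalization 𝒜 H 𝒮 d φ) (I : Ideal A)
    [I.IsTwoSided] : Ideal (Matrix (Fin n) (Fin n) S) where
  carrier := {x | IsFractionOf 𝒜 φ I x}
  zero_mem' := by
    have := isFractionOf_map (𝒜 := 𝒜) (φ := φ) (zero_mem I)
    rwa [map_zero] at this
  add_mem' := h.isFractionOf_add
  smul_mem' q x hx := by
    obtain ⟨b, t, ht, htu, e⟩ := h.left_fraction q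
    obtain ⟨v, h1, h2⟩ := isUnit_iff_exists.1 htu
    have := h.isFractionOf_inv_mul (isFractionOf_map_mul hx b) h1 h2
    rwa [← e, ← mul_assoc, ← mul_assoc, h2, one_mul] at this

section Extension

variable [IsNoetherianRing Aᵐᵒᵖ] (h : IsMatrixLocalization 𝒜 H 𝒮 d φ) (I : Ideal A)
    [I.IsTwoSided]

instance : (h.extension I).IsTwoSided := ⟨fun b ha => h.isFractionOf_mul_right ha b⟩

theorem map_mem_extension {a : A} (ha : a ∈ I) : φ a ∈ h.extension I := isFractionOf_map ha

end Extension

theorem exists_common_denominator {P : Ideal A} [P.IsTwoSided]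
    (h : IsMatrixLocalization 𝒜 H 𝒮 d φ) (hHP : H ≤ P) (F : Finset A)
    (hF : ∀ a ∈ F, IsFractionOf 𝒜 φ P (φ a)) :
    ∃ s, SetLike.IsHomogeneousElem 𝒜 s ∧ IsUnit (φ s) ∧ ∀ a ∈ F, a * s ∈ P := by
  classical
  have hker : ∀ a b, φ a = φ b → b ∈ P → a ∈ P := by
    intro a b hab hb
    have : a - b ∈ H := by rw [← h.ker, map_sub, hab, sub_self]
    rw [← sub_add_cancel a b]
    exact add_mem (hHP this) hb
  induction F using Finset.induction_on with
  | empty => exact ⟨1, ⟨0, SetLike.GradedOne.one_mem⟩, by simp, by simp⟩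
  | insert x F _ ih =>
    obtain ⟨s, hs, hsu, hsF⟩ := ih fun a ha => hF a (Finset.mem_insert_of_mem ha)
    obtain ⟨t, ht, htu, b, hb, e⟩ := hF x (Finset.mem_insert_self _ _)
    obtain ⟨r, c, hr, hru, e'⟩ := h.exists_common_multiple hs htu
    refine ⟨s * r, hr, by rw [map_mul]; exact hsu.mul hru, fun a ha => ?_⟩
    rcases Finset.mem_insert.1 ha with rfl | ha
    · refine hker _ (b * c) ?_ (P.mul_mem_right _ hb)
      rw [map_mul, e', map_mul, ← mul_assoc, e, map_mul]
    · rw [← mul_assoc]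
      exact P.mul_mem_right _ (hsF a ha)

/-- A prime that contains `H` but no homogeneous element invertible in the matrix ring is the
contraction of its extension. -/
theorem mem_of_map_mem_extension [IsNoetherianRing A] [IsNoetherianRing Aᵐᵒᵖ]
    (h : IsMatrixLocalization 𝒜 H 𝒮 d φ) (P : PrimeSpec A) (hHP : H ≤ P.ideal)
    (hP : ∀ s, SetLike.IsHomogeneousElem 𝒜 s → IsUnit (φ s) → s ∉ P.ideal) {a : A}
    (ha : φ a ∈ h.extension P.ideal) : a ∈ P.ideal := by
  let Z : Ideal A := (h.extension P.ideal).comap φ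
  obtain ⟨F, hF⟩ := IsNoetherian.noetherian Z
  obtain ⟨s, hs, hsu, hsF⟩ := h.exists_common_denominator hHP F fun z hz =>
    show z ∈ Z from hF ▸ Submodule.subset_span hz
  have hZs : ∀ z ∈ Z, z * s ∈ P.ideal := by
    intro z hz
    rw [← hF] at hz
    induction hz using Submodule.span_induction with
    | mem x hx => exact hsF x hx
    | zero => simp
    | add x y _ _ hx hy => rw [add_mul]; exact add_mem hx hy
    | smul b x _ hx => rw [smul_eq_mul, mul_assoc]; exact P.ideal.mul_mem_left _ hx
  refine (P.isPrime.mem_or_mem fun x => hZs _ ?_).resolve_right (hP s hs hsu)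
  change φ (a * x) ∈ h.extension P.ideal
  rw [map_mul]
  exact Ideal.mul_mem_right _ _ ha

theorem scalar_mem_of_mem {R : Type*} [Ring R] {n : ℕ} (E : Ideal (Matrix (Fin n) (Fin n) R))
    [E.IsTwoSided] {x : Matrix (Fin n) (Fin n) R} (hx : x ∈ E) (i j : Fin n) (a : R) :
    Matrix.scalar (Fin n) (a * x i j) ∈ E := by
  have : Matrix.scalar (Fin n) (a * x i j)
      = ∑ l, Matrix.single l i a * x * Matrix.single j l 1 := by
    ext p q
    simp [Matrix.single_mul_mul_single, Matrix.sum_apply, Matrix.single_apply,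
      Matrix.diagonal_apply, ite_and]
  rw [this]
  exact sum_mem fun l _ => E.mul_mem_right _ (E.mul_mem_left _ hx)

/-- A homogeneous two-sided ideal that is not contained in `H` contains a homogeneous element which
is invertible in the matrix ring: one of its homogeneous elements has a nonzero, hence invertible,
entry, so its extension is everything. -/
theorem exists_mem_isUnit [IsNoetherianRing Aᵐᵒᵖ] (h : IsMatrixLocalization 𝒜 H 𝒮 d φ)
    (hH : H.IsHomogeneous 𝒜) (I : Ideal A) [I.IsTwoSided] (hI : I.IsHomogeneous 𝒜)
    (hIH : ¬ I ≤ H) : ∃ s ∈ I, SetLike.IsHomogeneousElem 𝒜 s ∧ IsUnit (φ s) := by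
  classical
  obtain ⟨a, haI, haH⟩ := SetLike.not_le_iff_exists.1 hIH
  obtain ⟨m, hm⟩ : ∃ m, (DirectSum.decompose 𝒜 a m : A) ∉ H := by
    by_contra hcon
    push Not at hcon
    apply haH
    rw [← DirectSum.sum_support_decompose 𝒜 a]
    exact sum_mem fun i _ => hcon i
  rw [← h.ker] at hm
  obtain ⟨i, j, hij⟩ : ∃ i j, φ (DirectSum.decompose 𝒜 a m : A) i j ≠ 0 := by
    by_contra hcon
    push Not at hcon
    exact hm (Matrix.ext hcon)
  obtain ⟨c, -, -, hc⟩ := h.isGradedDivisionRing.exists_inverse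
    (h.map_mem m _ (DirectSum.decompose 𝒜 a m).2 i j) hij
  have h1 := scalar_mem_of_mem _ (h.map_mem_extension I (hI m haI)) i j c
  rw [hc, map_one] at h1
  obtain ⟨s, ⟨m', hs⟩, hsu, b, hb, e⟩ := h1
  refine ⟨_, hI m' hb, ⟨m', (DirectSum.decompose 𝒜 b m').2⟩, ?_⟩
  have hbs : b - s ∈ H := by rw [← h.ker, map_sub, ← e, one_mul, sub_self]
  have := hH m' hbs
  rw [DirectSum.decompose_sub, DirectSum.sub_apply, AddSubgroupClass.coe_sub,
    DirectSum.decompose_of_mem_same _ hs, ← h.ker, map_sub, sub_eq_zero] at this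
  rwa [this]

end IsMatrixLocalization
end MatrixLocalization

/-! ### Primes whose factor ring is finite over a field after inverting denominators -/

/-- `A ⧸ P` embeds in an algebra that is finite over a central field and consists of right
fractions with denominators in `T`. -/
def HasFiniteFractions (k : Type v) [Field k] {A : Type u} [Ring A] [Algebra k A] (T : Set A)
    (P : Ideal A) : Prop :=
  ∃ (K : Type u) (_ : Field K) (_ : Algebra k K) (N : Type u) (_ : Ring N) (_ : Algebra k N)
    (_ : Algebra K N) (_ : IsScalarTower k K N) (_ : Module.Finite K N) (j : A →ₐ[k] N),
    (∀ a, j a = 0 ↔ a ∈ P) ∧ ∀ x, ∃ a, ∃ s ∈ T, IsUnit (j s) ∧ x * j s = j a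

theorem moduleFinite_toAlgebra' {K N : Type*} [Field K] [Ring N] (f : K →+* N)
    (hf : ∀ c x, f c * x = x * f c) {ι : Type*} [Fintype ι] (v : ι → N)
    (hv : ∀ x, ∃ c : ι → K, x = ∑ i, f (c i) * v i) :
    @Module.Finite K N _ _ (f.toAlgebra' hf).toModule := by
  let _ := f.toAlgebra' hf
  refine Module.Finite.of_surjective (Fintype.linearCombination K v) fun x => ?_
  obtain ⟨c, rfl⟩ := hv x
  exact ⟨c, rfl⟩

theorem IsGradedDivisionRing.centralGradeZero_exists_inv {k : Type v} [Field k] {S : Type u}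
    [Ring S] [Algebra k S] {𝒮 : ℤ → Submodule k S} [GradedAlgebra 𝒮]
    (hS : IsGradedDivisionRing 𝒮) (a : centralGradeZero 𝒮) (ha : a ≠ 0) :
    ∃ b : centralGradeZero 𝒮, a * b = 1 := by
  obtain ⟨y, hy, h1, h2⟩ := hS.exists_inverse a.2.1 (fun h => ha (Subtype.ext h))
  rw [neg_zero] at hy
  have hc := Subalgebra.mem_center_iff.1 a.2.2
  refine ⟨⟨y, hy, Subalgebra.mem_center_iff.2 fun x => ?_⟩, Subtype.ext h1⟩
  calc x * y = y * (a * x) * y := by rw [← mul_assoc, h2, one_mul]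
    _ = y * x := by rw [← hc, ← mul_assoc, mul_assoc _ (a : S), h1, mul_one]

namespace IsMatrixLocalization

variable {k : Type v} [Field k] {A : Type u} [Ring A] [Algebra k A]
  {𝒜 : ℤ → Submodule k A} {H : Ideal A} {S : Type u} [Ring S]
  [Algebra k S] {𝒮 : ℤ → Submodule k S} [GradedAlgebra 𝒮] {n : ℕ} {d : Fin n → ℤ}
  {φ : A →ₐ[k] Matrix (Fin n) (Fin n) S} [GradedAlgebra 𝒜]

section

variable [IsNoetherianRing Aᵐᵒᵖ]

/-- The ideal of the graded division ring `S` consisting of the scalars in the extension of `I`. -/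
def scalarIdeal (h : IsMatrixLocalization 𝒜 H 𝒮 d φ) (I : Ideal A) [I.IsTwoSided] : Ideal S :=
  (h.extension I).comap (Matrix.scalar (Fin n))

instance (h : IsMatrixLocalization 𝒜 H 𝒮 d φ) (I : Ideal A) [I.IsTwoSided] :
    (h.scalarIdeal I).IsTwoSided := ⟨fun {a} b ha => by
  change Matrix.scalar (Fin n) (a * b) ∈ h.extension I
  rw [map_mul]
  exact Ideal.mul_mem_right _ _ ha⟩

theorem scalarIdeal_ne_bot (h : IsMatrixLocalization 𝒜 H 𝒮 d φ) {I : Ideal A} [I.IsTwoSided]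
    (hIH : ¬ I ≤ H) : h.scalarIdeal I ≠ ⊥ := by
  obtain ⟨a, haI, haH⟩ := SetLike.not_le_iff_exists.1 hIH
  rw [← h.ker] at haH
  obtain ⟨i, j, hij⟩ : ∃ i j, φ a i j ≠ 0 := by
    by_contra hcon
    push Not at hcon
    exact haH (Matrix.ext hcon)
  intro hbot
  apply hij
  have := scalar_mem_of_mem _ (h.map_mem_extension I haI) i j 1
  rw [one_mul] at this
  exact (Submodule.mem_bot S).1 (hbot ▸ this)

variable [IsNoetherianRing A]

theorem scalarIdeal_ne_top (h : IsMatrixLocalization 𝒜 H 𝒮 d φ) (P : PrimeSpec A)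
    (hHP : H ≤ P.ideal)
    (hP : ∀ s, SetLike.IsHomogeneousElem 𝒜 s → IsUnit (φ s) → s ∉ P.ideal) :
    h.scalarIdeal P.ideal ≠ ⊤ := by
  intro htop
  apply P.isPrime.ne_top
  rw [Ideal.eq_top_iff_one]
  refine h.mem_of_map_mem_extension P hHP hP ?_
  have : (1 : S) ∈ h.scalarIdeal P.ideal := htop ▸ Submodule.mem_top
  change Matrix.scalar (Fin n) (1 : S) ∈ h.extension P.ideal at this
  rwa [map_one] at this ⊢

/-- A prime strictly above `H` without homogeneous elements that are invertible in the matrix ring has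
finite fractions: the matrix ring modulo the extension of `P` is finite over the field of central
elements of degree zero of `S`. -/
theorem hasFiniteFractions (h : IsMatrixLocalization 𝒜 H 𝒮 d φ) (P : PrimeSpec A)
    (hHP : H < P.ideal)
    (hP : ∀ s, SetLike.IsHomogeneousElem 𝒜 s → IsUnit (φ s) → s ∉ P.ideal) :
    HasFiniteFractions k {s | SetLike.IsHomogeneousElem 𝒜 s ∧ IsUnit (φ s)} P.ideal := by
  classical
  have hS := h.isGradedDivisionRing
  have := hS.nontrivial
  let K := centralGradeZero 𝒮
  have hKc : ∀ (c : K) (s : S), s * c = c * s := fun c => Subalgebra.mem_center_iff.1 c.2.2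
  let _ : CommRing K := { (inferInstance : Ring K) with
    mul_comm := fun a b => Subtype.ext (hKc b a) }
  let _ : Field K := Field.ofIsUnitOrEqZero fun a => by
    by_cases ha : a = 0
    · exact Or.inr ha
    · obtain ⟨b, hb⟩ := hS.centralGradeZero_exists_inv a ha
      exact Or.inl (IsUnit.of_mul_eq_one b hb)
  let E := h.extension P.ideal
  let q : Matrix (Fin n) (Fin n) S →ₐ[k] Matrix (Fin n) (Fin n) S ⧸ E := Ideal.Quotient.mkₐ k E
  have hq : ∀ x, q x = 0 ↔ x ∈ E := fun x => Ideal.Quotient.eq_zero_iff_mem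
  let f : K →+* Matrix (Fin n) (Fin n) S ⧸ E :=
    (q : Matrix (Fin n) (Fin n) S →+* _).comp ((Matrix.scalar (Fin n)).comp K.val)
  have hfc : ∀ c x, f c * x = x * f c := by
    intro c x
    obtain ⟨x, rfl⟩ := Ideal.Quotient.mk_surjective x
    change q _ * q x = q x * q _
    rw [← map_mul, ← map_mul]
    congr 1
    ext i j
    simp [hKc]
  obtain ⟨t, b, hb⟩ := hS.exists_finite_quotient h.isPI (h.scalarIdeal P.ideal)
    (h.scalarIdeal_ne_bot hHP.not_ge) (h.scalarIdeal_ne_top P hHP.le hP)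
  refine ⟨K, inferInstance, inferInstance, _, inferInstance, inferInstance, f.toAlgebra' hfc, ?_, ?_,
    q.comp φ, ?_, ?_⟩
  · let _ := f.toAlgebra' hfc
    refine IsScalarTower.of_algebraMap_eq fun c => ?_
    change q (algebraMap k _ c) = q (Matrix.scalar (Fin n) (algebraMap k S c))
    congr 1
  · refine moduleFinite_toAlgebra' f hfc (ι := Fin n × Fin n × Fin t)
      (fun i => q (Matrix.single i.1 i.2.1 (b i.2.2))) fun x => ?_
    obtain ⟨x, rfl⟩ := Ideal.Quotient.mk_surjective x
    have hc : ∀ i j, ∃ c : Fin t → K, x i j - ∑ l, (c l : S) * b l ∈ h.scalarIdeal P.ideal := by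
      intro i j
      obtain ⟨y, hy, hxy⟩ := hb (x i j)
      obtain ⟨c, rfl⟩ := (Submodule.mem_span_range_iff_exists_fun _).1 hy
      exact ⟨c, hxy⟩
    choose c hc using hc
    refine ⟨fun i => c i.1 i.2.1 i.2.2, ?_⟩
    have hfq : ∀ i : Fin n × Fin n × Fin t, f (c i.1 i.2.1 i.2.2)
        * q (Matrix.single i.1 i.2.1 (b i.2.2))
        = q (Matrix.single i.1 i.2.1 ((c i.1 i.2.1 i.2.2 : S) * b i.2.2)) := by
      intro i
      change q (Matrix.scalar (Fin n) (c i.1 i.2.1 i.2.2 : S)) * q _ = _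
      rw [← map_mul]
      congr 1
      ext p p'
      simp [Matrix.single_apply]
    rw [Finset.sum_congr rfl fun i _ => hfq i, ← map_sum, ← sub_eq_zero]
    change q x - q _ = 0
    rw [← map_sub, hq]
    have hx : x - ∑ i : Fin n × Fin n × Fin t,
          Matrix.single i.1 i.2.1 ((c i.1 i.2.1 i.2.2 : S) * b i.2.2)
        = ∑ i, ∑ j, Matrix.scalar (Fin n) (x i j - ∑ l, (c i j l : S) * b l)
            * Matrix.single i j 1 := by
      have hsum : ∀ i j, Matrix.scalar (Fin n) (x i j - ∑ l, (c i j l : S) * b l)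
            * Matrix.single i j 1
          = Matrix.single i j (x i j) - ∑ l, Matrix.single i j ((c i j l : S) * b l) := by
        intro i j
        have := map_sum (Matrix.singleAddMonoidHom (α := S) i j) (fun l => (c i j l : S) * b l)
          Finset.univ
        change Matrix.single i j _ = ∑ l, Matrix.single i j _ at this
        rw [← this]
        ext p p'
        simp only [Matrix.scalar_apply, Matrix.diagonal_mul, Matrix.single_apply, Matrix.sub_apply]
        split_ifs <;> simp
      simp only [hsum, Finset.sum_sub_distrib, Fintype.sum_prod_type]
      rw [← Matrix.matrix_eq_sum_single]
    rw [hx]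
    exact sum_mem fun i _ => sum_mem fun j _ => E.mul_mem_right _ (hc i j)
  · intro a
    change q (φ a) = 0 ↔ _
    rw [hq]
    exact ⟨h.mem_of_map_mem_extension P hHP.le hP, h.map_mem_extension P.ideal⟩
  · intro x
    obtain ⟨x, rfl⟩ := Ideal.Quotient.mk_surjective x
    obtain ⟨a, s, hs, hsu, e⟩ := h.right_fraction x
    refine ⟨a, s, ⟨hs, hsu⟩, hsu.map q, ?_⟩
    change q x * q (φ s) = q (φ a)
    rw [← map_mul, e]

end

end IsMatrixLocalization

section FiniteFractions

open scoped Pointwise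

variable {k : Type v} [Field k] {A : Type u} [Ring A] [Algebra k A]

theorem IsPrimeIdeal.exists_isRegular_mk [IsNoetherianRing A] (P : PrimeSpec A) (I : Ideal A)
    [I.IsTwoSided] (hI : ¬ I ≤ P.ideal) :
    ∃ a ∈ I, IsRegular (Ideal.Quotient.mk P.ideal a) := by
  have := isNoetherianRing_quotient P.ideal
  have hmem : ∀ {y}, y ∈ I.map (Ideal.Quotient.mk P.ideal) ↔
      ∃ x ∈ I, Ideal.Quotient.mk P.ideal x = y :=
    Ideal.mem_map_iff_of_surjective _ Ideal.Quotient.mk_surjective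
  have htwo : (I.map (Ideal.Quotient.mk P.ideal)).IsTwoSided := by
    refine ⟨fun {a} b ha => ?_⟩
    obtain ⟨x, hx, rfl⟩ := hmem.1 ha
    obtain ⟨b, rfl⟩ := Ideal.Quotient.mk_surjective b
    exact hmem.2 ⟨x * b, I.mul_mem_right _ hx, map_mul _ _ _⟩
  obtain ⟨y, hy, hreg⟩ := P.isPrime.isPrimeRing_quotient.exists_isRegular
    (I.map (Ideal.Quotient.mk P.ideal)) (by
      intro hbot
      refine hI fun x hx => ?_
      rw [← Ideal.Quotient.eq_zero_iff_mem, ← Submodule.mem_bot (A ⧸ P.ideal), ← hbot]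
      exact Ideal.mem_map_of_mem _ hx)
  obtain ⟨x, hx, rfl⟩ := hmem.1 hy
  exact ⟨x, hx, hreg⟩

/-- An element that is regular modulo `P` acts injectively, hence invertibly, on an algebra of
fractions that is finite over a central field. -/
theorem isUnit_of_isRegular_mk {K N : Type u} [Field K] [Ring N] [Algebra k N] [Algebra K N]
    [Module.Finite K N] {P : Ideal A} [P.IsTwoSided] {j : A →ₐ[k] N} (hj : ∀ a, j a = 0 ↔ a ∈ P)
    (hfrac : ∀ x, ∃ a s, IsUnit (j s) ∧ x * j s = j a) {c : A}
    (hc : IsRegular (Ideal.Quotient.mk P c)) : IsUnit (j c) := by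
  have hcancel : ∀ x, j c * x = 0 → x = 0 := by
    intro x hx
    obtain ⟨a, s, hs, e⟩ := hfrac x
    have h1 : j (c * a) = 0 := by rw [map_mul, ← e, ← mul_assoc, hx, zero_mul]
    rw [hj, ← Ideal.Quotient.eq_zero_iff_mem, map_mul] at h1
    have h2 := hc.left (h1.trans (mul_zero _).symm)
    rw [Ideal.Quotient.eq_zero_iff_mem, ← hj, ← e] at h2
    exact hs.mul_left_eq_zero.1 h2
  have hinj : Function.Injective (LinearMap.mulLeft K (j c)) := by
    rw [← LinearMap.ker_eq_bot, LinearMap.ker_eq_bot']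
    exact hcancel
  obtain ⟨y, hy⟩ := LinearMap.injective_iff_surjective.1 hinj 1
  have hy : j c * y = 1 := hy
  refine isUnit_iff_exists.2 ⟨y, hy, ?_⟩
  rw [← sub_eq_zero]
  apply hcancel
  rw [mul_sub, ← mul_assoc, hy, one_mul, mul_one, sub_self]

/-- A prime strictly above a prime with finite fractions contains a denominator. -/
theorem HasFiniteFractions.exists_mem [IsNoetherianRing A] {T : Set A} {P Q : PrimeSpec A}
    (hP : HasFiniteFractions k T P.ideal) (hPQ : P < Q) : ∃ s ∈ T, s ∈ Q.ideal := by
  obtain ⟨K, _, _, N, _, _, _, _, _, j, hj, hfrac⟩ := hP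
  obtain ⟨c, hcQ, hc⟩ := IsPrimeIdeal.exists_isRegular_mk P Q.ideal (not_le_of_gt hPQ)
  have hu := isUnit_of_isRegular_mk (K := K) hj (fun x => by
    obtain ⟨a, s, -, h⟩ := hfrac x
    exact ⟨a, s, h⟩) hc
  obtain ⟨y, h1, h2⟩ := isUnit_iff_exists.1 hu
  obtain ⟨a, s, hsT, -, e⟩ := hfrac y
  refine ⟨s, hsT, ?_⟩
  have : s - c * a ∈ P.ideal := by
    rw [← hj, map_sub, map_mul, ← e, ← mul_assoc, h1, one_mul, sub_self]
  rw [← sub_add_cancel s (c * a)]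
  exact add_mem (hPQ.le this) (Ideal.mul_mem_right _ _ hcQ)

theorem exists_list_forall₂ {α β : Type*} {r : α → β → Prop} {X : Set α} :
    ∀ l : List β, (∀ b ∈ l, ∃ a ∈ X, r a b) → ∃ m : List α, List.Forall₂ r m l ∧ ∀ a ∈ m, a ∈ X
  | [], _ => ⟨[], List.Forall₂.nil, by simp⟩
  | b :: l, h => by
    obtain ⟨a, ha, hab⟩ := h b (by simp)
    obtain ⟨m, hm, hmX⟩ := exists_list_forall₂ l fun b hb => h b (by simp [hb])
    exact ⟨a :: m, List.Forall₂.cons hab hm, by simpa using ⟨ha, hmX⟩⟩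

theorem exists_polynomial_coeff_zero_ne_zero {N : Type*} [Ring N] [Algebra k N] {x : N}
    (hx : IsAlgebraic k x) (hu : IsUnit x) :
    ∃ p : Polynomial k, p.coeff 0 ≠ 0 ∧ Polynomial.aeval x p = 0 := by
  obtain ⟨p, hp0, hp⟩ := hx
  obtain ⟨q, hq, hdvd⟩ := p.exists_eq_pow_rootMultiplicity_mul_and_not_dvd hp0 0
  rw [Polynomial.dvd_iff_isRoot, Polynomial.IsRoot, ← Polynomial.coeff_zero_eq_eval_zero] at hdvd
  refine ⟨q, hdvd, ?_⟩
  rw [hq, map_mul, map_pow, map_zero, sub_zero, Polynomial.aeval_X] at hp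
  exact (hu.pow _).mul_right_eq_zero.1 hp

/-- A prime `P` with finite fractions has no or uncountably many primes minimal above it. If they
are countable in number, choose in each an element invertible in the algebra `N` of fractions, and
let `C` be the subalgebra of the central field `K` generated by the countably many coordinates
involved. The `C`-span `Λ` of a spanning set of `N` is then a ring, and each nonzero `c ∈ C` is
invertible in it, as the ideal of the elements of `A` that `c` divides in `Λ` contains a product of
chosen elements. Since `Λ` has countable dimension over the uncountable field `k`, it follows that
`C`, and then `Λ`, is algebraic over `k`; but the chosen elements are not. -/
theorem HasFiniteFractions.not_countable_primesAbove [Uncountable k] [IsNoetherianRing A]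
    [WellFoundedLT (PrimeSpec A)] (hA : Module.rank k A ≤ Cardinal.aleph0) {T : Set A}
    {P : PrimeSpec A} (hP : HasFiniteFractions k T P.ideal) (hne : (primesAbove P).Nonempty) :
    ¬ (primesAbove P).Countable := by
  intro hcount
  have := hcount.to_subtype
  obtain ⟨K, _, _, N, _, _, _, _, _, j, hj, hfrac⟩ := hP
  have hN : Nontrivial N := by
    refine ⟨1, 0, fun h => P.isPrime.ne_top ?_⟩
    rw [Ideal.eq_top_iff_one, ← hj, map_one, h]
  have hs : ∀ Q : primesAbove P, ∃ s ∈ Q.1.ideal, ∃ t, j s * t = 1 ∧ t * j s = 1 := by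
    intro Q
    obtain ⟨s, hsQ, hs⟩ := IsPrimeIdeal.exists_isRegular_mk P Q.1.ideal (not_le_of_gt Q.2.1)
    refine ⟨s, hsQ, isUnit_iff_exists.1 (isUnit_of_isRegular_mk (K := K) hj (fun x => ?_) hs)⟩
    obtain ⟨a, s, -, h⟩ := hfrac x
    exact ⟨a, s, h⟩
  choose s hsQ t hst hts using hs
  obtain ⟨r, e, he⟩ := Module.Finite.exists_fin (R := K) (M := N)
  have hco : ∀ x : N, ∃ c : Fin r → K, ∑ i, c i • e i = x := fun x =>
    (Submodule.mem_span_range_iff_exists_fun K).1 (he ▸ Submodule.mem_top)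
  choose co hco using hco
  let B := Module.Basis.ofVectorSpace k A
  have hBc : Countable (Module.Basis.ofVectorSpaceIndex k A) := by
    rw [← Cardinal.mk_le_aleph0_iff]
    exact B.mk_eq_rank''.trans_le hA
  let G : Set N := Set.range e * Set.range e ∪ ({1} ∪ (Set.range (fun i => j (B i)) ∪ Set.range t))
  have hG : G.Countable := ((Set.countable_range e).image2 (Set.countable_range e) _).union
    ((Set.countable_singleton 1).union ((Set.countable_range _).union (Set.countable_range t)))
  let X : Set K := ⋃ x ∈ G, Set.range (co x)
  have hX : X.Countable := hG.biUnion fun x _ => Set.countable_range _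
  let C := Algebra.adjoin k X
  let M : Submodule C N := Submodule.span C (Set.range e)
  have hGM : ∀ x ∈ G, x ∈ M := by
    intro x hx
    rw [← hco x]
    refine sum_mem fun i _ => M.smul_mem ⟨co x i, Algebra.subset_adjoin ?_⟩
      (Submodule.subset_span ⟨i, rfl⟩)
    exact Set.mem_biUnion hx ⟨i, rfl⟩
  have hM1 : (1 : N) ∈ M := hGM 1 (Or.inr (Or.inl rfl))
  have hMM : ∀ x y, x ∈ M → y ∈ M → x * y ∈ M := by
    intro x y hx hy
    have h1 : M * M ≤ M := by
      rw [Submodule.span_mul_span]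
      exact Submodule.span_le.2 fun z hz => hGM z (Or.inl hz)
    exact h1 (Submodule.mul_mem_mul hx hy)
  let Λ : Subalgebra C N := M.toSubalgebra hM1 hMM
  have hMk : ∀ (c : k), ∀ x ∈ M, c • x ∈ M := by
    intro c x hx
    rw [← algebraMap_smul C c x]
    exact M.smul_mem _ hx
  have hjM : ∀ a, j a ∈ M := by
    intro a
    have ha := B.mem_span a
    induction ha using Submodule.span_induction with
    | mem x hx =>
      obtain ⟨i, rfl⟩ := hx
      exact hGM _ (Or.inr (Or.inr (Or.inl ⟨i, rfl⟩)))
    | zero => simp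
    | add x y _ _ hx hy => rw [map_add]; exact add_mem hx hy
    | smul c x _ hx => rw [map_smul]; exact hMk c _ hx
  have hcK : ∀ (c : K) (x : N), x * algebraMap K N c = algebraMap K N c * x :=
    fun c x => (Algebra.commutes c x).symm
  have hcM : ∀ c : C, ∀ x ∈ M, algebraMap K N c * x ∈ M := by
    intro c x hx
    have := M.smul_mem c hx
    rwa [Algebra.smul_def] at this
  have hunit : ∀ c : C, c ≠ 0 → ∃ y ∈ M, algebraMap K N c * y = 1 := by
    intro c hc
    have hc0 : (c : K) ≠ 0 := fun h => hc (Subtype.ext h)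
    let I : Ideal A :=
      { carrier := {a | ∃ y ∈ M, j a = algebraMap K N c * y}
        zero_mem' := ⟨0, zero_mem _, by simp⟩
        add_mem' := by
          rintro a b ⟨x, hx, ha⟩ ⟨y, hy, hb⟩
          exact ⟨x + y, add_mem hx hy, by rw [map_add, ha, hb, mul_add]⟩
        smul_mem' := by
          rintro b a ⟨x, hx, ha⟩
          exact ⟨j b * x, hMM _ _ (hjM b) hx, by
            rw [smul_eq_mul, map_mul, ha, ← mul_assoc, hcK, mul_assoc]⟩ }
    have hI2 : I.IsTwoSided := by
      refine ⟨?_⟩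
      rintro a b ⟨x, hx, ha⟩
      exact ⟨x * j b, hMM _ _ hx (hjM b), by rw [map_mul, ha, mul_assoc]⟩
    have hPI : P.ideal ≤ I := fun a ha => ⟨0, zero_mem _, by rw [(hj a).2 ha, mul_zero]⟩
    have hIP : ¬ I ≤ P.ideal := by
      obtain ⟨a, s, -, hsu, ha⟩ := hfrac (algebraMap K N (c : K)⁻¹)
      intro hle
      have : s ∈ P.ideal := hle ⟨j a, hjM a, by
        rw [← ha, ← mul_assoc, ← map_mul, mul_inv_cancel₀ hc0, map_one, one_mul]⟩
      rw [← hj] at this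
      exact hsu.ne_zero this
    obtain ⟨l, hl, hlI⟩ := exists_list_prod_mem I hI2
    obtain ⟨m, hml, hm⟩ : ∃ m : List A, List.Forall₂ (fun a Q => a ∈ PrimeSpec.ideal Q) m l ∧
        ∀ a ∈ m, a ∈ Set.range s := by
      refine exists_list_forall₂ l fun Q hQ => ?_
      have hPQ : P < Q := lt_of_le_not_ge (hPI.trans (hl Q hQ)) fun h => hIP ((hl Q hQ).trans h)
      obtain ⟨Q', hQ', hle⟩ := exists_primesAbove_le hPQ
      exact ⟨s ⟨Q', hQ'⟩, ⟨_, rfl⟩, hle (hsQ ⟨Q', hQ'⟩)⟩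
    have hinv : ∃ y ∈ M, j m.prod * y = 1 := by
      clear hml
      induction m with
      | nil => exact ⟨1, hM1, by simp⟩
      | cons a m ih =>
        obtain ⟨y, hy, h1⟩ := ih fun a ha => hm a (by simp [ha])
        obtain ⟨Q, rfl⟩ := hm a (by simp)
        refine ⟨y * t Q, hMM _ _ hy (hGM _ (Or.inr (Or.inr (Or.inr ⟨Q, rfl⟩)))), ?_⟩
        rw [List.prod_cons, map_mul, mul_assoc, ← mul_assoc (j m.prod), h1, one_mul, hst]
    obtain ⟨y, hy, h1⟩ := hinv
    obtain ⟨x, hx, h2⟩ := hlI m hml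
    exact ⟨x * y, hMM _ _ hx hy, by rw [← mul_assoc, ← h2, h1]⟩
  let Λk : Subalgebra k N := Λ.restrictScalars k
  have hrank : Module.rank k Λk ≤ Cardinal.aleph0 := by
    have hC : Module.rank k C ≤ Cardinal.aleph0 :=
      IsCountablyGenerated.rank_le ⟨_, hX.preimage Subtype.val_injective,
        Algebra.adjoin_adjoin_coe_preimage⟩
    let g : (Fin r → C) →ₗ[k] N := (Fintype.linearCombination C e).restrictScalars k
    have hg : Subalgebra.toSubmodule Λk = LinearMap.range g := by
      ext x
      change x ∈ M ↔ _
      rw [show M = _ from (Fintype.range_linearCombination C e).symm]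
      rfl
    change Module.rank k (Subalgebra.toSubmodule Λk) ≤ _
    rw [hg]
    refine (rank_range_le g).trans ?_
    rw [rank_fun_eq_lift_mul]
    refine (mul_le_mul' (Cardinal.natCast_lt_aleph0 (n := Fintype.card (Fin r))).le
      (Cardinal.lift_le_aleph0.2 hC)).trans ?_
    rw [Cardinal.aleph0_mul_aleph0]
  have halgC : Algebra.IsIntegral k C := by
    refine ⟨fun c => IsAlgebraic.isIntegral ?_⟩
    by_cases hconst : ∃ a : k, algebraMap k C a = c
    · obtain ⟨a, rfl⟩ := hconst
      exact isAlgebraic_algebraMap a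
    have hcΛ : algebraMap K N c ∈ M := by
      have := hcM c 1 hM1
      rwa [mul_one] at this
    let f : Λk →ₐ[k] N := Λk.val
    have hx := isAlgebraic_of_isUnit_sub hrank ⟨algebraMap K N c, hcΛ⟩ fun a _ => by
      obtain ⟨y, hy, h1⟩ := hunit (c - algebraMap k C a) fun h => hconst ⟨a, (sub_eq_zero.1 h).symm⟩
      have h2 : algebraMap K N c - algebraMap k N a = algebraMap K N (c - algebraMap k C a : C) := by
        rw [IsScalarTower.algebraMap_apply k K N, ← map_sub]
        rfl
      refine isUnit_iff_exists.2 ⟨⟨y, hy⟩, Subtype.ext ?_, Subtype.ext ?_⟩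
      · change (algebraMap K N c - algebraMap k N a) * y = 1
        rw [h2, h1]
      · change y * (algebraMap K N c - algebraMap k N a) = 1
        rw [h2, hcK, h1]
    rw [← isAlgebraic_algHom_iff Λk.val Subtype.val_injective] at hx
    have hx : IsAlgebraic k (IsScalarTower.toAlgHom k K N c) := hx
    rw [isAlgebraic_algHom_iff _ (IsScalarTower.toAlgHom k K N).injective] at hx
    exact (isAlgebraic_algHom_iff C.val Subtype.val_injective).1 hx
  obtain ⟨Q, hQ⟩ := hne
  have hint : IsIntegral k (j (s ⟨Q, hQ⟩)) := by
    refine isIntegral_trans (A := C) _ (IsIntegral.of_mem_of_fg Λ ?_ _ (hjM _))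
    change M.FG
    exact Submodule.fg_span (Set.finite_range e)
  obtain ⟨p, hp0, hp⟩ := exists_polynomial_coeff_zero_ne_zero hint.isAlgebraic
    (isUnit_iff_exists.2 ⟨_, hst ⟨Q, hQ⟩, hts _⟩)
  -- the constant term of `p` would lie in `Q`
  have hpQ : Polynomial.aeval (s ⟨Q, hQ⟩) p ∈ Q.ideal := by
    refine hQ.1.le ((hj _).1 ?_)
    rw [← Polynomial.aeval_algHom_apply, hp]
  rw [← Polynomial.divX_mul_X_add p, map_add, map_mul, Polynomial.aeval_X, Polynomial.aeval_C] at hpQ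
  have h1 := (Submodule.add_mem_iff_right _ (Q.ideal.mul_mem_left _ (hsQ ⟨Q, hQ⟩))).1 hpQ
  refine Q.isPrime.ne_top (Ideal.eq_top_of_isUnit_mem _ h1 ?_)
  exact (IsUnit.mk0 _ hp0).map (algebraMap k A)

end FiniteFractions

/-! ### Primes minimal above a homogeneous prime -/

/-- An ideal maximal among the two-sided ideals disjoint from a multiplicative set is prime. -/
theorem exists_prime_disjoint {A : Type u} [Ring A] [IsNoetherianRing A] (I : Ideal A)
    (hI : I.IsTwoSided) (T : Submonoid A) (hIT : ∀ s ∈ T, s ∉ I) :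
    ∃ P : PrimeSpec A, I ≤ P.ideal ∧ ∀ s ∈ T, s ∉ P.ideal := by
  obtain ⟨M, ⟨hM2, hIM, hMT⟩, hmax⟩ := set_has_maximal_iff_noetherian.2 ‹IsNoetherianRing A›
    {J : Ideal A | J.IsTwoSided ∧ I ≤ J ∧ ∀ s ∈ T, s ∉ J} ⟨I, hI, le_rfl, hIT⟩
  refine ⟨⟨M, hM2, fun h => hMT 1 T.one_mem (h ▸ Submodule.mem_top), fun J J' hJ hJ' hle => ?_⟩,
    hIM, hMT⟩
  by_contra hcon
  push Not at hcon
  have key : ∀ J : Ideal A, J.IsTwoSided → ¬ J ≤ M → ∃ s ∈ T, s ∈ M ⊔ J := by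
    intro J hJ hJM
    by_contra hno
    push Not at hno
    exact hmax (M ⊔ J) ⟨isTwoSided_sup hM2 hJ, hIM.trans le_sup_left, hno⟩
      (lt_of_le_of_ne le_sup_left fun h => hJM (h ▸ le_sup_right))
  obtain ⟨s, hsT, hs⟩ := key J hJ hcon.1
  obtain ⟨t, htT, ht⟩ := key J' hJ' hcon.2
  refine hMT _ (T.mul_mem hsT htT) ?_
  obtain ⟨a, ha, b, hb, rfl⟩ := Submodule.mem_sup.1 hs
  obtain ⟨c, hc, e, he, rfl⟩ := Submodule.mem_sup.1 ht
  rw [add_mul, mul_add b]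
  exact add_mem (Ideal.mul_mem_right _ M ha)
    (add_mem (Ideal.mul_mem_left M _ hc) (hle (Ideal.mul_mem_mul hb he)))

/-- If `z` is a homogeneous unit of positive degree and `c ≠ 0` then `z - c` is not invertible: in a
product `(z - c) w` the highest component of `w` is multiplied by `z`, the lowest one by `-c`. -/
theorem IsGradedDivisionRing.sub_algebraMap_mul_ne_one {k : Type v} [Field k] {S : Type u} [Ring S]
    [Algebra k S] {𝒮 : ℤ → Submodule k S} [GradedAlgebra 𝒮] (hS : IsGradedDivisionRing 𝒮) {z : S}
    {m : ℕ} (hm : 0 < m) (hz : z ∈ 𝒮 m) (hz0 : z ≠ 0) {c : k} (hc : c ≠ 0) (w : S) :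
    (z - algebraMap k S c) * w ≠ 1 := by
  classical
  intro h
  have := hS.nontrivial
  have hcomp : ∀ i, (DirectSum.decompose 𝒮 (1 : S) i : S)
      = z * (DirectSum.decompose 𝒮 w (i - m) : S) - c • (DirectSum.decompose 𝒮 w i : S) := by
    intro i
    rw [← h, sub_mul, DirectSum.decompose_sub, DirectSum.sub_apply, AddSubgroupClass.coe_sub,
      coe_decompose_mul_of_left_mem hz, ← Algebra.smul_def, DirectSum.decompose_smul]
    rfl
  have h1 : ∀ i, (DirectSum.decompose 𝒮 (1 : S) i : S) ≠ 0 → i = 0 := by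
    intro i hi
    by_contra hne
    exact hi (DirectSum.decompose_of_mem_ne 𝒮 SetLike.GradedOne.one_mem (Ne.symm hne))
  set s := (DirectSum.decompose 𝒮 w).support with hs
  have hmem : ∀ i, i ∈ s ↔ (DirectSum.decompose 𝒮 w i : S) ≠ 0 := by
    intro i
    rw [hs, DFinsupp.mem_support_iff]
    simp
  have hne : s.Nonempty := by
    rw [Finset.nonempty_iff_ne_empty]
    intro hempty
    have hw : w = 0 := by
      rw [← DirectSum.sum_support_decompose 𝒮 w, ← hs, hempty, Finset.sum_empty]
    rw [hw, mul_zero] at h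
    exact zero_ne_one h
  have hzero : ∀ i, i ∉ s → (DirectSum.decompose 𝒮 w i : S) = 0 := fun i hi =>
    not_not.1 fun h => hi ((hmem i).2 h)
  have hhi : s.max' hne + m = 0 := by
    apply h1
    rw [hcomp, add_sub_cancel_right, hzero (s.max' hne + m), smul_zero, sub_zero]
    · intro h0
      exact (hmem _).1 (s.max'_mem hne) ((hS.isUnit z ⟨m, hz⟩ hz0).mul_right_eq_zero.1 h0)
    · intro hmem
      have := s.le_max' _ hmem
      omega
  have hlo : s.min' hne = 0 := by
    apply h1
    rw [hcomp, hzero (s.min' hne - m), mul_zero, zero_sub, neg_ne_zero]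
    · exact smul_ne_zero hc ((hmem _).1 (s.min'_mem hne))
    · intro hmem
      have := s.min'_le _ hmem
      omega
  have := s.min'_le _ (s.max'_mem hne)
  omega

namespace IsMatrixLocalization

variable {k : Type v} [Field k] {A : Type u} [Ring A] [Algebra k A]
  {𝒜 : ℤ → Submodule k A} [GradedAlgebra 𝒜] {H : HSpec 𝒜} {S : Type u} [Ring S]
  [Algebra k S] {𝒮 : ℤ → Submodule k S} [GradedAlgebra 𝒮] {n : ℕ} {d : Fin n → ℤ}
  {φ : A →ₐ[k] Matrix (Fin n) (Fin n) S}

theorem nontrivial (h : IsMatrixLocalization 𝒜 H.ideal 𝒮 d φ) :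
    Nontrivial (Matrix (Fin n) (Fin n) S) := by
  refine ⟨1, 0, fun h1 => H.isPrime.ne_top ?_⟩
  rw [Ideal.eq_top_iff_one, ← h.ker, map_one, h1]

variable [IsNoetherianRing Aᵐᵒᵖ]

theorem homogeneousPart_eq_iff (h : IsMatrixLocalization 𝒜 H.ideal 𝒮 d φ) {P : PrimeSpec A}
    (hHP : H.toPrimeSpec ≤ P) : homogeneousPart 𝒜 P = H ↔
      ∀ s, SetLike.IsHomogeneousElem 𝒜 s → IsUnit (φ s) → s ∉ P.ideal := by
  constructor
  · intro heq s hs hsu hsP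
    have hsH : s ∈ (homogeneousPart 𝒜 P).ideal :=
      Ideal.mem_homogeneousCore_of_homogeneous_of_mem hs hsP
    rw [heq, ← h.ker] at hsH
    have := h.nontrivial
    exact hsu.ne_zero hsH
  · intro hP
    refine le_antisymm ?_ (homogeneousPart_toPrimeSpec 𝒜 H ▸ homogeneousPart_mono 𝒜 hHP)
    by_contra hle
    obtain ⟨s, hs, hsh, hsu⟩ := h.exists_mem_isUnit H.isHomogeneous _
      (homogeneousPart 𝒜 P).isHomogeneous hle
    exact hP s hsh hsu (homogeneousPart_le 𝒜 P hs)

variable [IsNoetherianRing A]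

/-- If some prime strictly above `H` has homogeneous part `H`, then uncountably many primes are
minimal above `H`: for a central homogeneous unit `z ∈ S` of positive degree, each nonzero
`c ∈ k` gives such a prime containing the contraction of the ideal generated by `z - c`. -/
theorem not_countable_primesAbove [Uncountable k] (h : IsMatrixLocalization 𝒜 H.ideal 𝒮 d φ)
    {P : PrimeSpec A} (hHP : H.toPrimeSpec < P) (hP : homogeneousPart 𝒜 P = H) :
    ¬ (primesAbove H.toPrimeSpec).Countable := by
  have hS := h.isGradedDivisionRing
  have hntr := h.nontrivial
  rw [h.homogeneousPart_eq_iff hHP.le] at hP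
  obtain ⟨f, -, m, hm, -, hz0, -, hzc⟩ := hS.exists_central_components (h.scalarIdeal P.ideal)
    (h.scalarIdeal_ne_bot (not_le_of_gt hHP)) (h.scalarIdeal_ne_top P hHP.le hP)
  have hz := (DirectSum.decompose 𝒮 f m).2
  replace hzc := hzc m
  generalize (DirectSum.decompose 𝒮 f m : S) = z at hz hz0 hzc
  let T : Submonoid A :=
    { carrier := {s | SetLike.IsHomogeneousElem 𝒜 s ∧ IsUnit (φ s)}
      one_mem' := ⟨⟨0, SetLike.GradedOne.one_mem⟩, by simp⟩
      mul_mem' := fun {s t} hs ht => ⟨hs.1.mul ht.1, by rw [map_mul]; exact hs.2.mul ht.2⟩ }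
  let y : k → Matrix (Fin n) (Fin n) S := fun c => Matrix.scalar (Fin n) (z - algebraMap k S c)
  obtain ⟨i⟩ : Nonempty (Fin n) := by
    by_contra hempty
    rw [not_nonempty_iff] at hempty
    exact not_subsingleton (Matrix (Fin n) (Fin n) S) inferInstance
  have hyc : ∀ c x, x * y c = y c * x := by
    intro c x
    ext p q
    simp only [y, Matrix.scalar_apply, Matrix.mul_diagonal, Matrix.diagonal_mul, mul_sub, sub_mul,
      hzc, Algebra.commutes]
  let I : k → Ideal A := fun c =>
    { carrier := {a | ∃ x, φ a = y c * x}
      zero_mem' := ⟨0, by simp⟩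
      add_mem' := by
        rintro a b ⟨x, ha⟩ ⟨x', hb⟩
        exact ⟨x + x', by rw [map_add, ha, hb, mul_add]⟩
      smul_mem' := by
        rintro b a ⟨x, ha⟩
        exact ⟨φ b * x, by rw [smul_eq_mul, map_mul, ha, ← mul_assoc, hyc, mul_assoc]⟩ }
  have hI2 : ∀ c, (I c).IsTwoSided := fun c => ⟨by
    rintro a b ⟨x, ha⟩
    exact ⟨x * φ b, by rw [map_mul, ha, mul_assoc]⟩⟩
  have hy1 : ∀ c, c ≠ 0 → ∀ x, y c * x ≠ 1 := by
    intro c hc x hx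
    refine hS.sub_algebraMap_mul_ne_one hm hz hz0 hc (x i i) ?_
    have := congrFun (congrFun hx i) i
    simpa only [y, Matrix.scalar_apply, Matrix.diagonal_mul, Matrix.one_apply_eq] using this
  have hIT : ∀ c, c ≠ 0 → ∀ s ∈ T, s ∉ I c := by
    rintro c hc s ⟨-, hsu⟩ ⟨x, hx⟩
    obtain ⟨v, h1, -⟩ := isUnit_iff_exists.1 hsu
    exact hy1 c hc (x * v) (by rw [← mul_assoc, ← hx, h1])
  choose M hIM hMT using fun c : {c : k // c ≠ 0} =>
    exists_prime_disjoint (I c) (hI2 c) T (hIT c c.2)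
  have hHM : ∀ c, H.ideal ≤ (M c).ideal := fun c a ha =>
    hIM c ⟨0, by rw [mul_zero]; exact (h.ker a).2 ha⟩
  have hyM : ∀ c, y c ∈ h.extension (M c).ideal := by
    intro c
    obtain ⟨a, s, hs, hsu, e⟩ := h.right_fraction (y c)
    exact ⟨s, hs, hsu, a, hIM c ⟨φ s, e.symm⟩, e⟩
  have hlt : ∀ c, H.toPrimeSpec < M c := by
    intro c
    refine lt_of_le_not_ge (hHM c) fun hle => ?_
    obtain ⟨s, hs, hsu, a, ha, e⟩ := hyM c
    rw [(h.ker a).2 (hle ha)] at e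
    have h0 := hsu.mul_left_eq_zero.1 e
    -- `z = c` is impossible because `c` has degree zero
    have hzc' : z = algebraMap k S c := by
      have := congrFun (congrFun h0 i) i
      simp only [y, Matrix.scalar_apply, Matrix.diagonal_apply_eq] at this
      exact sub_eq_zero.1 this
    have hcm : algebraMap k S c ∈ 𝒮 0 := by
      rw [Algebra.algebraMap_eq_smul_one]
      exact Submodule.smul_mem _ _ SetLike.GradedOne.one_mem
    rw [← hzc'] at hcm
    have h1 := DirectSum.decompose_of_mem_same 𝒮 hz
    rw [DirectSum.decompose_of_mem_ne 𝒮 hcm (by omega)] at h1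
    exact hz0 h1.symm
  have habove : ∀ c, M c ∈ primesAbove H.toPrimeSpec := by
    refine fun c => ⟨hlt c, fun Q hHQ hQM => ?_⟩
    obtain ⟨s, ⟨hs, hsu⟩, hsM⟩ := (h.hasFiniteFractions Q hHQ fun s hs hsu hsQ =>
      hMT c s ⟨hs, hsu⟩ (hQM.le hsQ)).exists_mem hQM
    exact hMT c s ⟨hs, hsu⟩ hsM
  have hinj : Function.Injective fun c => (⟨M c, habove c⟩ : primesAbove H.toPrimeSpec) := by
    intro c c' hcc
    by_contra hne
    have hMM : M c = M c' := congrArg Subtype.val hcc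
    have h1 := hyM c
    have h2 := hyM c'
    rw [← hMM] at h2
    have h3 := sub_mem h2 h1
    have h4 : y c' - y c = algebraMap k _ (c.1 - c'.1) := by
      simp only [y, ← map_sub, sub_sub_sub_cancel_left]
      rfl
    rw [h4] at h3
    have h5 := Ideal.eq_top_of_isUnit_mem _ h3 ((IsUnit.mk0 _ (sub_ne_zero.2 fun h =>
      hne (Subtype.ext h))).map (algebraMap k _))
    refine (M c).isPrime.ne_top ?_
    rw [Ideal.eq_top_iff_one]
    refine h.mem_of_map_mem_extension (M c) (hHM c) (fun s hs hsu => hMT c s ⟨hs, hsu⟩) ?_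
    rw [h5]
    exact Submodule.mem_top
  intro hcount
  have := hcount.to_subtype
  have := hinj.countable
  have hk : (Set.univ : Set k).Countable := by
    have : (({0} : Set k) ∪ {c | c ≠ 0}).Countable :=
      (Set.countable_singleton 0).union (Set.countable_coe_iff.1 ‹Countable {c : k // c ≠ 0}›)
    refine this.mono fun c _ => ?_
    by_cases hc : c = 0
    · exact Or.inl hc
    · exact Or.inr hc
  exact not_countable (Set.countable_univ_iff.1 hk)

end IsMatrixLocalization

/-! ### Primes of factor rings -/

section Factor

variable {A : Type u} [Ring A]

/-- The primes of `A ⧸ I`, as primes of `A`. -/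
def comapMk (I : Ideal A) [I.IsTwoSided] : PrimeSpec (A ⧸ I) ↪o PrimeSpec A where
  toFun Q :=
    { ideal := Q.ideal.comap (Ideal.Quotient.mk I)
      isPrime := IsPrimeIdeal.of_mem_or_mem
        ⟨fun {a} b ha => by
          rw [Ideal.mem_comap, map_mul]
          exact Q.ideal.mul_mem_right _ ha⟩
        (fun h => Q.isPrime.ne_top (Ideal.comap_eq_top_iff.1 h)) fun a b hab =>
        Q.isPrime.mem_or_mem fun x => by
          obtain ⟨x, rfl⟩ := Ideal.Quotient.mk_surjective x
          rw [← map_mul, ← map_mul]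
          exact hab x }
  inj' Q Q' h := PrimeSpec.ext (Ideal.comap_injective_of_surjective _
    Ideal.Quotient.mk_surjective (congrArg PrimeSpec.ideal h))
  map_rel_iff' := Ideal.comap_le_comap_iff_of_surjective _ Ideal.Quotient.mk_surjective _ _

theorem mem_comapMk {I : Ideal A} [I.IsTwoSided] {Q : PrimeSpec (A ⧸ I)} {a : A} :
    a ∈ (comapMk I Q).ideal ↔ Ideal.Quotient.mk I a ∈ Q.ideal := Iff.rfl

theorem mem_range_comapMk {I : Ideal A} [I.IsTwoSided] {Q : PrimeSpec A} :
    Q ∈ Set.range (comapMk I) ↔ I ≤ Q.ideal := by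
  constructor
  · rintro ⟨Q, rfl⟩ a ha
    rw [mem_comapMk, Ideal.Quotient.eq_zero_iff_mem.2 ha]
    exact zero_mem _
  · intro hIQ
    have hmem : ∀ a, Ideal.Quotient.mk I a ∈ Q.ideal.map (Ideal.Quotient.mk I) ↔ a ∈ Q.ideal := by
      intro a
      rw [Ideal.mem_map_iff_of_surjective _ Ideal.Quotient.mk_surjective]
      refine ⟨?_, fun ha => ⟨a, ha, rfl⟩⟩
      rintro ⟨b, hb, hab⟩
      rw [Ideal.Quotient.eq] at hab
      have := sub_mem hb (hIQ hab)
      rwa [sub_sub_cancel] at this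
    refine ⟨⟨Q.ideal.map (Ideal.Quotient.mk I), IsPrimeIdeal.of_mem_or_mem ⟨fun {a} b ha => ?_⟩
      (fun h => Q.isPrime.ne_top ?_) fun a b hab => ?_⟩, PrimeSpec.ext (Ideal.ext hmem)⟩
    · obtain ⟨a, rfl⟩ := Ideal.Quotient.mk_surjective a
      obtain ⟨b, rfl⟩ := Ideal.Quotient.mk_surjective b
      rw [← map_mul, hmem]
      exact Q.ideal.mul_mem_right _ ((hmem a).1 ha)
    · rw [Ideal.eq_top_iff_one, ← hmem, h]
      exact Submodule.mem_top
    · obtain ⟨a, rfl⟩ := Ideal.Quotient.mk_surjective a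
      obtain ⟨b, rfl⟩ := Ideal.Quotient.mk_surjective b
      rw [hmem, hmem]
      refine Q.isPrime.mem_or_mem fun x => ?_
      have := hab (Ideal.Quotient.mk I x)
      rwa [← map_mul, ← map_mul, hmem] at this

theorem comapMk_ideal_eq_iff {I : Ideal A} [I.IsTwoSided] {Q : PrimeSpec (A ⧸ I)} :
    (comapMk I Q).ideal = I ↔ Q.ideal = ⊥ := by
  constructor
  · intro h
    rw [eq_bot_iff]
    intro x hx
    obtain ⟨a, rfl⟩ := Ideal.Quotient.mk_surjective x
    rw [Submodule.mem_bot, Ideal.Quotient.eq_zero_iff_mem]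
    rw [← h]
    exact hx
  · intro h
    ext a
    rw [mem_comapMk, h, Submodule.mem_bot, Ideal.Quotient.eq_zero_iff_mem]

theorem image_setOf_minimal {α β : Type*} [PartialOrder α] [PartialOrder β] (f : α ↪o β) (b : β)
    (hf : ∀ x, x ∈ Set.range f ↔ b ≤ x) :
    f '' {Q | f Q ≠ b ∧ ¬ ∃ Q', f Q' ≠ b ∧ Q' < Q} = {x | b < x ∧ ∀ y, b < y → ¬ y < x} := by
  have hlt : ∀ Q, f Q ≠ b → b < f Q := fun Q h => lt_of_le_of_ne ((hf _).1 ⟨Q, rfl⟩) h.symm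
  ext x
  constructor
  · rintro ⟨Q, ⟨hQ, hmin⟩, rfl⟩
    refine ⟨hlt Q hQ, fun y hy hyQ => hmin ?_⟩
    obtain ⟨Q', rfl⟩ := (hf y).2 hy.le
    exact ⟨Q', hy.ne', f.lt_iff_lt.1 hyQ⟩
  · rintro ⟨hbx, hmin⟩
    obtain ⟨Q, rfl⟩ := (hf x).2 hbx.le
    refine ⟨Q, ⟨hbx.ne', ?_⟩, rfl⟩
    rintro ⟨Q', hQ', hlt'⟩
    exact hmin _ (hlt Q' hQ') (f.lt_iff_lt.2 hlt')

theorem comapMk_image_heightOnePrimes (P : PrimeSpec A) :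
    comapMk P.ideal '' heightOnePrimes (A ⧸ P.ideal) = primesAbove P := by
  have hne : ∀ Q, comapMk P.ideal Q ≠ P ↔ Q.ideal ≠ ⊥ := fun Q =>
    not_congr (PrimeSpec.ext_iff.trans comapMk_ideal_eq_iff)
  have := image_setOf_minimal (comapMk P.ideal) P fun Q => mem_range_comapMk
  simp only [hne] at this
  simp only [heightOnePrimes, bot_lt_iff_ne_bot]
  exact this

end Factor

section GradedFactor

variable {k : Type v} [Field k] {A : Type u} [Ring A] [Algebra k A] {𝒜 : ℤ → Submodule k A}
  [GradedAlgebra 𝒜]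

theorem decompose_quotient_mk (H : HSpec 𝒜) (a : A) (i : ℤ) :
    (DirectSum.decompose (quotientGrading 𝒜 H.ideal) (Ideal.Quotient.mk H.ideal a) i : A ⧸ H.ideal)
      = Ideal.Quotient.mk H.ideal (DirectSum.decompose 𝒜 a i : A) := by
  classical
  have hmem : ∀ j, ∀ x ∈ 𝒜 j, Ideal.Quotient.mk H.ideal x ∈ quotientGrading 𝒜 H.ideal j :=
    fun j x hx => ⟨x, hx, rfl⟩
  refine DirectSum.Decomposition.inductionOn 𝒜 (motive := fun a =>
    (DirectSum.decompose (quotientGrading 𝒜 H.ideal) (Ideal.Quotient.mk H.ideal a) i : A ⧸ H.ideal)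
      = Ideal.Quotient.mk H.ideal (DirectSum.decompose 𝒜 a i : A)) (by simp) (fun {j} x => ?_)
    (fun x y hx hy => ?_) a
  · by_cases h : j = i
    · subst h
      rw [DirectSum.decompose_of_mem_same _ (hmem j _ x.2), DirectSum.decompose_of_mem_same _ x.2]
    · rw [DirectSum.decompose_of_mem_ne _ (hmem j _ x.2) h, DirectSum.decompose_of_mem_ne _ x.2 h,
        map_zero]
  · rw [map_add, DirectSum.decompose_add, DirectSum.decompose_add, DirectSum.add_apply,
      DirectSum.add_apply, Submodule.coe_add, Submodule.coe_add, map_add, hx, hy]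

/-- The homogeneous primes of `A ⧸ H`, as homogeneous primes of `A`. -/
def hComapMk (H : HSpec 𝒜) : HSpec (quotientGrading 𝒜 H.ideal) ↪o HSpec 𝒜 where
  toFun Q :=
    { toPrimeSpec := comapMk H.ideal Q.toPrimeSpec
      isHomogeneous := fun i a ha => by
        rw [mem_comapMk, ← decompose_quotient_mk]
        exact Q.isHomogeneous i ha }
  inj' Q Q' h := HSpec.ext (congrArg PrimeSpec.ideal
    ((comapMk H.ideal).injective (congrArg HSpec.toPrimeSpec h)))
  map_rel_iff' := (comapMk H.ideal).le_iff_le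

theorem mem_range_hComapMk {H Q : HSpec 𝒜} : Q ∈ Set.range (hComapMk H) ↔ H ≤ Q := by
  constructor
  · rintro ⟨Q, rfl⟩
    exact mem_range_comapMk.1 ⟨Q.toPrimeSpec, rfl⟩
  · intro h
    obtain ⟨Q', hQ'⟩ := (mem_range_comapMk (I := H.ideal) (Q := Q.toPrimeSpec)).2 h
    refine ⟨⟨Q', fun i x hx => ?_⟩, HSpec.ext (congrArg PrimeSpec.ideal hQ')⟩
    obtain ⟨a, rfl⟩ := Ideal.Quotient.mk_surjective x
    rw [decompose_quotient_mk, ← mem_comapMk, hQ']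
    rw [← mem_comapMk, hQ'] at hx
    exact Q.isHomogeneous i hx

/-- The homogeneous primes minimal among those strictly above `H`. -/
def hPrimesAbove (H : HSpec 𝒜) : Set (HSpec 𝒜) :=
  {Q | H < Q ∧ ∀ Q', H < Q' → ¬ Q' < Q}

theorem hComapMk_image_hHeightOnePrimes (H : HSpec 𝒜) :
    hComapMk H '' hHeightOnePrimes (quotientGrading 𝒜 H.ideal) = hPrimesAbove H := by
  have hne : ∀ Q, hComapMk H Q ≠ H ↔ Q.ideal ≠ ⊥ := fun Q =>
    not_congr (HSpec.ext_iff.trans comapMk_ideal_eq_iff)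
  have := image_setOf_minimal (hComapMk H) H fun Q => mem_range_hComapMk
  simp only [hne] at this
  simp only [hHeightOnePrimes, bot_lt_iff_ne_bot]
  exact this

theorem finite_or_not_countable_of_image {α β : Type*} {f : α → β} (hf : Function.Injective f)
    {s : Set α} {t : Set β} (h : f '' s = t) :
    (s.Finite ∨ ¬ s.Countable) ↔ (t.Finite ∨ ¬ t.Countable) := by
  rw [← h, Set.finite_image_iff hf.injOn,
    show (f '' s).Countable ↔ s.Countable from
      ⟨fun hs => Set.countable_of_injective_of_countable_image hf.injOn hs, fun hs => hs.image f⟩]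

/-- If no prime strictly above `H` has homogeneous part `H`, then the primes minimal above `H` are
the homogeneous ones. -/
theorem image_hPrimesAbove (H : HSpec 𝒜)
    (hH : ∀ P, H.toPrimeSpec < P → homogeneousPart 𝒜 P ≠ H) :
    HSpec.toPrimeSpec '' hPrimesAbove H = primesAbove H.toPrimeSpec := by
  have hlt : ∀ P, H.toPrimeSpec < P → H < homogeneousPart 𝒜 P := fun P hP =>
    lt_of_le_of_ne (homogeneousPart_toPrimeSpec 𝒜 H ▸ homogeneousPart_mono 𝒜 hP.le) (hH P hP).symm
  ext P
  constructor
  · rintro ⟨Q, ⟨hHQ, hmin⟩, rfl⟩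
    refine ⟨hHQ, fun Q' hQ' hlt' => hmin _ (hlt Q' hQ') ?_⟩
    exact (lt_of_le_of_lt (homogeneousPart_le 𝒜 Q') hlt' :
      (homogeneousPart 𝒜 Q').toPrimeSpec < Q.toPrimeSpec)
  · rintro ⟨hHP, hmin⟩
    have hP : (homogeneousPart 𝒜 P).toPrimeSpec = P := by
      by_contra hne
      exact hmin _ (hlt P hHP) (lt_of_le_of_ne (homogeneousPart_le 𝒜 P) hne)
    refine ⟨homogeneousPart 𝒜 P, ⟨hlt P hHP, fun Q' hQ' hlt' => hmin Q'.toPrimeSpec hQ' ?_⟩, hP⟩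
    rw [← hP]
    exact hlt'

end GradedFactor

/-! ### The spectrum of an algebra with birationally PI factors -/

section Main

variable {k : Type v} [Field k] {A : Type u} [Ring A] [Algebra k A] {𝒜 : ℤ → Submodule k A}
  [GradedAlgebra 𝒜] [IsNoetherianRing A] [IsNoetherianRing Aᵐᵒᵖ]

/-- A prime that is not homogeneous has finite fractions, with denominators that are homogeneous
and lie in no prime having the same homogeneous part. -/
theorem exists_hasFiniteFractions
    (hPI : ∀ P : HSpec 𝒜, IsBirationallyPI (quotientGrading 𝒜 P.ideal)) (P : PrimeSpec A)
    (hP : (homogeneousPart 𝒜 P).toPrimeSpec ≠ P) :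
    ∃ T : Set A, HasFiniteFractions k T P.ideal ∧
      ∀ Q, homogeneousPart 𝒜 Q = homogeneousPart 𝒜 P → ∀ s ∈ T, s ∉ Q.ideal := by
  obtain ⟨S, _, _, 𝒮, _, n, d, φ, h⟩ := exists_isMatrixLocalization 𝒜 _
    (hPI (homogeneousPart 𝒜 P))
  have hle := homogeneousPart_le 𝒜 P
  refine ⟨_, h.hasFiniteFractions P (lt_of_le_of_ne hle hP :
    (homogeneousPart 𝒜 P).toPrimeSpec < P) ((h.homogeneousPart_eq_iff hle).1 rfl), fun Q hQ s hs => ?_⟩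
  exact (h.homogeneousPart_eq_iff (hQ ▸ homogeneousPart_le 𝒜 Q)).1 hQ s hs.1 hs.2

/-- At most two primes in a chain have the same homogeneous part `H`, the lower of them being `H`
itself, whence the descending chain condition. -/
theorem wellFoundedLT_primeSpec
    (hPI : ∀ P : HSpec 𝒜, IsBirationallyPI (quotientGrading 𝒜 P.ideal))
    (hdcc : WellFoundedLT (HSpec 𝒜)) : WellFoundedLT (PrimeSpec A) := by
  classical
  let f : PrimeSpec A → HSpec 𝒜 ×ₗ ℕ := fun P =>
    toLex (homogeneousPart 𝒜 P, if (homogeneousPart 𝒜 P).toPrimeSpec = P then 0 else 1)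
  have hf : StrictMono f := by
    intro Q P hQP
    rw [Prod.Lex.toLex_lt_toLex]
    rcases (homogeneousPart_mono 𝒜 hQP.le).lt_or_eq with hlt | heq
    · exact Or.inl hlt
    · refine Or.inr ⟨heq, ?_⟩
      have hQ : (homogeneousPart 𝒜 Q).toPrimeSpec = Q := by
        by_contra hne
        obtain ⟨T, hT, hTQ⟩ := exists_hasFiniteFractions hPI Q hne
        obtain ⟨s, hs, hsP⟩ := hT.exists_mem hQP
        exact hTQ P heq.symm s hs hsP
      have hP : (homogeneousPart 𝒜 P).toPrimeSpec ≠ P := by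
        rw [← heq, hQ]
        exact hQP.ne
      rw [if_pos hQ, if_neg hP]
      exact Nat.zero_lt_one
  exact hf.wellFoundedLT

theorem finite_or_not_countable_primesAbove [Uncountable k]
    (hA : Module.rank k A ≤ Cardinal.aleph0)
    (hPI : ∀ P : HSpec 𝒜, IsBirationallyPI (quotientGrading 𝒜 P.ideal))
    (hdcc : WellFoundedLT (HSpec 𝒜)) (havoid : HSpecCountableAvoiding 𝒜) (P : PrimeSpec A) :
    (primesAbove P).Finite ∨ ¬ (primesAbove P).Countable := by
  have := wellFoundedLT_primeSpec hPI hdcc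
  by_cases hP : (homogeneousPart 𝒜 P).toPrimeSpec = P
  · rw [← hP]
    generalize homogeneousPart 𝒜 P = H
    by_cases hH : ∀ P, H.toPrimeSpec < P → homogeneousPart 𝒜 P ≠ H
    · rw [← finite_or_not_countable_of_image (fun Q Q' h => HSpec.ext (congrArg PrimeSpec.ideal h))
        (image_hPrimesAbove H hH), ← finite_or_not_countable_of_image (hComapMk H).injective
        (hComapMk_image_hHeightOnePrimes H)]
      exact havoid H
    · push Not at hH
      obtain ⟨Q, hHQ, hQ⟩ := hH
      obtain ⟨S, _, _, 𝒮, _, n, d, φ, h⟩ := exists_isMatrixLocalization 𝒜 _ (hPI H)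
      exact Or.inr (h.not_countable_primesAbove hHQ hQ)
  · obtain ⟨T, hT, -⟩ := exists_hasFiniteFractions hPI P hP
    rcases (primesAbove P).eq_empty_or_nonempty with he | hne
    · rw [he]
      exact Or.inl Set.finite_empty
    · exact Or.inr (hT.not_countable_primesAbove hA hne)

end Main

/-! ### The Dixmier–Moeglin equivalence -/

section Equivalence

variable {A : Type u} [Ring A]

/-- `P` is locally closed if and only if the primes strictly above `P` have a common two-sided ideal
that is not contained in `P`. -/
theorem isLocallyClosed_singleton_iff (P : PrimeSpec A) :
    IsLocallyClosed ({P} : Set (PrimeSpec A)) ↔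
      ∃ I : Ideal A, I.IsTwoSided ∧ ¬ I ≤ P.ideal ∧ ∀ Q, P < Q → I ≤ Q.ideal := by
  constructor
  · rintro ⟨U, Z, ⟨I, hI, hU⟩, hZ, hP⟩
    obtain ⟨J, hJ, hZ⟩ := hZ.isOpen_compl
    rw [compl_compl] at hZ
    have hPUZ : P ∈ U ∩ Z := hP ▸ Set.mem_singleton P
    have hmemU : ∀ Q, Q ∈ U ↔ ¬ I ≤ Q.ideal := by
      intro Q
      rw [← not_iff_not, not_not, ← Set.mem_compl_iff, hU]
      rfl
    refine ⟨I, hI, (hmemU P).1 hPUZ.1, fun Q hPQ => ?_⟩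
    by_contra hIQ
    have hQZ : Q ∈ Z := by
      have hPZ := hPUZ.2
      rw [hZ] at hPZ ⊢
      exact le_trans (show J ≤ P.ideal from hPZ) hPQ.le
    have : Q ∈ ({P} : Set (PrimeSpec A)) := hP ▸ ⟨(hmemU Q).2 hIQ, hQZ⟩
    exact hPQ.ne' this
  · rintro ⟨I, hI, hIP, hIQ⟩
    refine ⟨(zeroLocus I)ᶜ, zeroLocus P.ideal, ⟨I, hI, compl_compl _⟩,
      ⟨⟨P.ideal, inferInstance, compl_compl _⟩⟩, ?_⟩
    ext Q
    constructor
    · rintro rfl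
      exact ⟨hIP, le_refl Q.ideal⟩
    · rintro ⟨hQ, hPQ⟩
      by_contra hne
      exact hQ (hIQ Q (lt_of_le_of_ne hPQ (Ne.symm hne)))

theorem exists_ideal_le_of_finite (P : PrimeSpec A) {F : Set (PrimeSpec A)} (hF : F.Finite)
    (hFP : ∀ Q ∈ F, ¬ Q ≤ P) :
    ∃ I : Ideal A, I.IsTwoSided ∧ ¬ I ≤ P.ideal ∧ ∀ Q ∈ F, I ≤ Q.ideal := by
  induction F, hF using Set.Finite.induction_on with
  | empty => exact ⟨⊤, inferInstance, fun h => P.isPrime.ne_top (top_le_iff.1 h), by simp⟩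
  | @insert Q F _ _ ih =>
    obtain ⟨I, hI, hIP, hIF⟩ := ih fun Q hQ => hFP Q (Set.mem_insert_of_mem _ hQ)
    refine ⟨I * Q.ideal, inferInstance, fun h => ?_, ?_⟩
    · rcases P.isPrime.le_or_le I Q.ideal hI inferInstance h with h | h
      · exact hIP h
      · exact hFP Q (Set.mem_insert _ _) h
    · rintro Q' (rfl | hQ')
      · exact Ideal.mul_le_right
      · exact Ideal.mul_le_left.trans (hIF Q' hQ')

variable {k : Type v} [Field k] [Uncountable k] [Algebra k A] [IsNoetherianRing A]
  [IsNoetherianRing Aᵐᵒᵖ]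

theorem dixmierMoeglinEquivalence_of_finite_or_not_countable [WellFoundedLT (PrimeSpec A)]
    (hA : Module.rank k A ≤ Cardinal.aleph0)
    (hav : ∀ P : PrimeSpec A, (primesAbove P).Finite ∨ ¬ (primesAbove P).Countable) :
    DixmierMoeglinEquivalence k A := by
  intro P
  have hleft : IsLeftPrimitive P.ideal → IsRational k P := isRational_of_isLeftPrimitive hA P
  have hright : IsRightPrimitive P.ideal → IsRational k P := isRational_of_isRightPrimitive hA P
  have hclosed : IsRational k P → IsLocallyClosed ({P} : Set (PrimeSpec A)) := by
    intro hP
    have hfin := (hav P).resolve_right (not_not.2 (hP.countable_primesAbove hA))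
    obtain ⟨I, hI, hIP, hIQ⟩ := exists_ideal_le_of_finite P hfin fun Q hQ => not_le_of_gt hQ.1
    refine (isLocallyClosed_singleton_iff P).2 ⟨I, hI, hIP, fun Q hPQ => ?_⟩
    obtain ⟨Q', hQ', hle⟩ := exists_primesAbove_le hPQ
    exact (hIQ Q' hQ').trans hle
  have hprim : IsLocallyClosed ({P} : Set (PrimeSpec A)) →
      IsLeftPrimitive P.ideal ∧ IsRightPrimitive P.ideal := by
    rw [isLocallyClosed_singleton_iff]
    rintro ⟨I, hI, hIP, hIQ⟩
    exact ⟨isLeftPrimitive_of_forall_le hA P I hIP hIQ, isRightPrimitive_of_forall_le hA P I hIP hIQ⟩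
  exact ⟨⟨fun h => hleft (hprim h).1, hclosed⟩, ⟨hleft, fun h => (hprim (hclosed h)).1⟩,
    ⟨hright, fun h => (hprim (hclosed h)).2⟩⟩

end Equivalence

end DixmierMoeglin

open DixmierMoeglin
theorem mainTheorem8 {k : Type v} [Field k] [Uncountable k] {A : Type u} [Ring A] [Algebra k A]
    (𝒜 : ℤ → Submodule k A) [GradedAlgebra 𝒜]
    (hleft : IsNoetherianRing A) (hright : IsNoetherianRing Aᵐᵒᵖ)
    (hgen : IsCountablyGenerated k A)
    (hPI : ∀ P : HSpec 𝒜, IsBirationallyPI (quotientGrading 𝒜 P.ideal))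
    (hdcc : WellFoundedLT (HSpec 𝒜))
    (havoid : HSpecCountableAvoiding 𝒜) :
    WellFoundedLT (PrimeSpec A) ∧ SpecCountableAvoiding A ∧ DixmierMoeglinEquivalence k A := by
  have hA := hgen.rank_le
  have hav := finite_or_not_countable_primesAbove hA hPI hdcc havoid
  have hwf := wellFoundedLT_primeSpec hPI hdcc
  refine ⟨hwf, fun P => ?_, dixmierMoeglinEquivalence_of_finite_or_not_countable hA hav⟩
  rw [finite_or_not_countable_of_image (comapMk P.ideal).injective (comapMk_image_heightOnePrimes P)]
  exact hav P
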